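/- Let $\alpha\in\mathbb R$, $\beta>0$ and assume $g:=\tfrac12+\tfrac{\alpha}{\beta}>0$. **Hamiltonians.** Let $\sigma_2=\begin{pmatrix}0&-\imath\\ \imath&0\end{pmatrix}$, $$L_j(u)=\begin{pmatrix}u+\imath\partial_{x_j}&e^{-x_j}\\-e^{x_j}&0\end{pmatrix},\qquad K(u)=\begin{pmatrix}-\alpha&u-\frac{\imath}{2}\\-\beta^2(u-\frac{\imath}{2})&-\alpha\end{pmatrix},$$ and let $\mathbb B_n(u)$ be the upper right entry of the $2\times2$ matrix of differential operators $L_n(u)\cdots L_1(u)\,K(u)\,\sigma_2\,L_1^t(-u)\cdots L_n^t(-u)\,\sigma_2$, acting on $C^\infty(\mathbb R^n)$ (so $\mathbb B_0(u)=u-\frac{\imath}{2}$). The Hamiltonians $\mathbb H_1,\dots,\mathbb H_n$ of the $BC$ Toda chain are the operators given by $$\mathbb B_n(u)=(-1)^n\Bigl(u-\frac{\imath}{2}\Bigr)\Bigl(u^{2n}+\sum_{s=1}^n u^{2(n-s)}\,\mathbb H_s\Bigr);$$ that is, $\mathbb H_s$ is $(-1)^n$ times the coefficient of $u^{2(n-s)}$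 in the quotient of $\mathbb B_n(u)$ by $u-\frac{\imath}{2}$. **Raising operators.** For $n\ge1$ and $\lambda\in\mathbb C$ with $\operatorname{Im}\lambda>-g$ (in particular for real $\lambda$), let $\mathbb L_n(\lambda)$ be the operator from functions of $n-1$ real variables to functions of $n$ real variables $$[\mathbb L_n(\lambda)\phi](x)=\frac{(2\beta)^{\imath\lambda}}{\Gamma(g-\imath\lambda)}\int_{\mathbb R^{n-1}}dy\int_{\mathbb R^n}dz\;\exp\Bigl(\imath\lambda\bigl(\sum_{j=1}^n x_j+\sum_{j=1}^{n-1}y_j-2\sum_{j=1}^n z_j\bigr)-\sum_{j=1}^{n-1}\bigl(e^{z_j-x_j}+e^{z_j-y_j}+e^{x_j-z_{j+1}}+e^{y_j-z_{j+1}}\bigr)-e^{z_n-x_n}\Bigr)$$ $$\times\,(1+\beta e^{-z_1})^{-\imath\lambda-g}\,(1-\beta e^{-z_1})^{-\imath\lambda+g-1}\,\theta(z_1-\ln\beta)\;\phi(y),$$ where $\theta$ is the Heaviside step function. For $\lambda_1,\dots,\lambda_n\in\mathbb C$ with $\operatorname{Im}\lambda_j>-g$ define recursively $$\Psi_{\lambda_1,\dots,\lambda_n}=\mathbb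 L_n(\lambda_n)\,\Psi_{\lambda_1,\dots,\lambda_{n-1}},\qquad \Psi_\emptyset=1.$$ **Theorem.** 1. The expansion of $\mathbb B_n(u)$ displayed above holds, and $[\mathbb H_r,\mathbb H_s]=0$ for $1\le r,s\le n$. 2. For $n=1$, $$\Psi_\lambda(x)=\frac{(2\beta)^{\imath\lambda}}{\Gamma(g-\imath\lambda)}\int_{\ln\beta}^\infty dz\;e^{\imath\lambda(x-2z)-e^{z-x}}(1+\beta e^{-z})^{-\imath\lambda-g}(1-\beta e^{-z})^{-\imath\lambda+g-1}.$$ 3. For all $n\ge1$ and $x\in\mathbb R^n$, the $(2n-1)$-fold integral that defines $\Psi_{\lambda_1,\dots,\lambda_n}(x)$ from $\Psi_{\lambda_1,\dots,\lambda_{n-1}}$ converges absolutely. 4. $\Psi_{\lambda_1,\dots,\lambda_n}$ is smooth on $\mathbb R^n$, and for $1\le s\le n$ $$\mathbb H_s\,\Psi_{\lambda_1,\dots,\lambda_n}=(-1)^s\sum_{1\le j_1<\dots<j_s\le n}\lambda_{j_1}^2\cdots\lambda_{j_s}^2\;\Psi_{\lambda_1,\dots,\lambda_n}.$$ 5. Let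 $n\ge1$, $\operatorname{Im}\lambda>-g$, and let $\phi\in C^\infty(\mathbb R^{n-1})$ be exponentially tempered: every partial derivative of $\phi$, of any order, is bounded by $a\,e^{b(|x_1|+\dots+|x_{n-1}|)}$ for some $a,b\ge0$ depending on the derivative. Then the integral defining $\mathbb L_n(\lambda)\phi$ converges absolutely, $\mathbb L_n(\lambda)\phi$ is smooth, and for every $u\in\mathbb C$ $$\mathbb B_n(u)\,\mathbb L_n(\lambda)\,\phi=(\lambda^2-u^2)\,\mathbb L_n(\lambda)\,\mathbb B_{n-1}(u)\,\phi.$$ -/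

import Mathlib

open scoped Matrix Polynomial ContDiff

noncomputable section

namespace BCToda

/-- The smooth complex-valued functions of `x_1, …, x_n`, as a subspace of all functions. -/
def smoothSubmodule (n : ℕ) : Submodule ℂ ((Fin n → ℝ) → ℂ) where
  carrier := {f | ContDiff ℝ ∞ f}
  add_mem' := by
    intro f g hf hg
    have hf' : ContDiff ℝ ∞ f := hf
    exact hf'.add hg
  zero_mem' := by
    change ContDiff ℝ ∞ (fun _ : Fin n → ℝ => (0 : ℂ))
    exact contDiff_const
  smul_mem' := by
    intro c f hf
    have hf' : ContDiff ℝ ∞ f := hf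
    exact hf'.const_smul c

/-- The space `C^∞(ℝⁿ)` of smooth complex-valued functions; `f.1` is the underlying function. -/
def SmoothFun (n : ℕ) : Type := smoothSubmodule n

instance (n : ℕ) : AddCommGroup (SmoothFun n) := inferInstanceAs (AddCommGroup (smoothSubmodule n))

instance (n : ℕ) : Module ℂ (SmoothFun n) := inferInstanceAs (Module ℂ (smoothSubmodule n))

theorem SmoothFun.contDiff {n : ℕ} (f : SmoothFun n) : ContDiff ℝ ∞ f.1 := f.2

theorem SmoothFun.differentiableAt {n : ℕ} (f : SmoothFun n) (x : Fin n → ℝ) :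
    DifferentiableAt ℝ f.1 x :=
  f.contDiff.differentiable (by simp) x

/-- The algebra of linear operators on `C^∞(ℝⁿ)`. -/
abbrev Op (n : ℕ) := Module.End ℂ (SmoothFun n)

/-- The partial derivative `∂/∂x_j` on `C^∞(ℝⁿ)`. -/
def pd {n : ℕ} (j : Fin n) : Op n where
  toFun f := ⟨fun x => fderiv ℝ f.1 x (Pi.single j 1),
    (f.contDiff.fderiv_right (m := ∞) (by simp)).clm_apply contDiff_const⟩
  map_add' f g := by
    apply Subtype.ext
    funext x
    change fderiv ℝ (f.1 + g.1) x (Pi.single j 1) = _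
    rw [fderiv_add (f.differentiableAt x) (g.differentiableAt x)]
    rfl
  map_smul' c f := by
    apply Subtype.ext
    funext x
    change fderiv ℝ (c • f.1) x (Pi.single j 1) = _
    rw [fderiv_const_smul (f.differentiableAt x)]
    rfl

/-- Multiplication by the function `e^{ε x_j}` on `C^∞(ℝⁿ)`. -/
def mulExp {n : ℕ} (ε : ℝ) (j : Fin n) : Op n where
  toFun f := ⟨fun x => (Real.exp (ε * x j) : ℂ) * f.1 x,
    ContDiff.mul (Complex.ofRealCLM.contDiff.comp
      (Real.contDiff_exp.comp (contDiff_const.mul (contDiff_apply ℝ ℝ j)))) f.contDiff⟩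
  map_add' f g := by
    apply Subtype.ext
    funext x
    exact mul_add _ _ _
  map_smul' c f := by
    apply Subtype.ext
    funext x
    exact mul_left_comm _ _ _

/-- A scalar, viewed as a constant operator-valued polynomial in the spectral variable `u = X`. -/
abbrev scal (n : ℕ) (c : ℂ) : (Op n)[X] := algebraMap ℂ (Op n)[X] c

/-- The Toda Lax matrix `L_j(p)` of the `j`-th particle. Its argument `p` is a polynomial in the
spectral variable `u = X`; it is used at `p = u` and `p = -u`. -/
def lax {n : ℕ} (j : Fin n) (p : (Op n)[X]) : Matrix (Fin 2) (Fin 2) (Op n)[X] :=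
  !![p + Polynomial.C (Complex.I • pd j), Polynomial.C (mulExp (-1) j);
     -Polynomial.C (mulExp 1 j), 0]

/-- The boundary matrix `K(u)`, `u = X`. -/
def boundaryK (α β : ℝ) (n : ℕ) : Matrix (Fin 2) (Fin 2) (Op n)[X] :=
  !![scal n (-α), Polynomial.X - scal n (Complex.I / 2);
     -(scal n ((β : ℂ) ^ 2) * (Polynomial.X - scal n (Complex.I / 2))), scal n (-α)]

/-- The Pauli matrix `σ₂`. -/
def sigma2 (n : ℕ) : Matrix (Fin 2) (Fin 2) (Op n)[X] :=
  !![0, scal n (-Complex.I); scal n Complex.I, 0]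

/-- The monodromy matrix
`L_n(u) ⋯ L_1(u) K(u) σ₂ L_1ᵗ(-u) ⋯ L_nᵗ(-u) σ₂` of the `BC` Toda chain, `u = X`. -/
def monodromy (α β : ℝ) (n : ℕ) : Matrix (Fin 2) (Fin 2) (Op n)[X] :=
  (List.ofFn fun j : Fin n => lax j Polynomial.X).reverse.prod * boundaryK α β n * sigma2 n *
    (List.ofFn fun j : Fin n => (lax j (-Polynomial.X))ᵀ).prod * sigma2 n

/-- `𝔹_n(u)`: the upper right entry of the monodromy matrix, a polynomial in `u = X` whose
coefficients are differential operators. -/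
def BPoly (α β : ℝ) (n : ℕ) : (Op n)[X] := monodromy α β n 0 1

/-- The operator `𝔹_n(u)` at a point `u ∈ ℂ`. -/
def BOp (α β : ℝ) (n : ℕ) (u : ℂ) : Op n := (BPoly α β n).eval (algebraMap ℂ (Op n) u)

/-- The Hamiltonian `ℍ_s`, `1 ≤ s ≤ n`: the coefficient of `u^{2(n-s)}` in
`(-1)ⁿ 𝔹_n(u) / (u - i/2)`. -/
def hamiltonian (α β : ℝ) (n s : ℕ) : Op n :=
  (-1) ^ n *
    (BPoly α β n /ₘ (Polynomial.X - Polynomial.C (algebraMap ℂ (Op n) (Complex.I / 2)))).coeff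
      (2 * (n - s))

/-- Exponentially tempered smooth functions: every iterated partial derivative is bounded by
`a e^{b (|x_1| + ⋯ + |x_n|)}` for some `a, b ≥ 0` that may depend on the derivative. -/
def ExpTempered {n : ℕ} (f : SmoothFun n) : Prop :=
  ∀ l : List (Fin n), ∃ a b : ℝ, 0 ≤ a ∧ 0 ≤ b ∧
    ∀ x : Fin n → ℝ, ‖((l.map pd).prod f : SmoothFun n).1 x‖ ≤ a * Real.exp (b * ∑ j, |x j|)

/-- The Heaviside step function. -/
def heaviside (t : ℝ) : ℝ := if 0 ≤ t then 1 else 0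

/-- The parameter `g = 1/2 + α/β`. -/
def gPar (α β : ℝ) : ℝ := 1 / 2 + α / β

/-- The integrand of the kernel of the raising operator from `n` to `n + 1` particles, without the
constant prefactor: `x, z` have `n + 1` components and `y` has `n`. -/
def kernelIntegrand (α β : ℝ) {n : ℕ} (lam : ℂ) (x z : Fin (n + 1) → ℝ) (y : Fin n → ℝ) : ℂ :=
  Complex.exp
      (Complex.I * lam * ((∑ j, x j + ∑ j, y j - 2 * ∑ j, z j : ℝ) : ℂ)
        - ((∑ j : Fin n,
              (Real.exp (z j.castSucc - x j.castSucc) + Real.exp (z j.castSucc - y j)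
                + Real.exp (x j.castSucc - z j.succ) + Real.exp (y j - z j.succ)) : ℝ) : ℂ)
        - (Real.exp (z (Fin.last n) - x (Fin.last n)) : ℂ))
    * ((1 + β * Real.exp (-z 0) : ℝ) : ℂ) ^ (-Complex.I * lam - (gPar α β : ℂ))
    * ((1 - β * Real.exp (-z 0) : ℝ) : ℂ) ^ (-Complex.I * lam + (gPar α β : ℂ) - 1)
    * (heaviside (z 0 - Real.log β) : ℂ)

/-- The constant `(2β)^{iλ} / Γ(g - iλ)`. -/
def prefactor (α β : ℝ) (lam : ℂ) : ℂ :=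
  ((2 * β : ℝ) : ℂ) ^ (Complex.I * lam) / Complex.Gamma ((gPar α β : ℂ) - Complex.I * lam)

/-- The raising operator from functions of `n` variables to functions of `n + 1` variables. -/
def raising (α β : ℝ) {n : ℕ} (lam : ℂ) (φ : (Fin n → ℝ) → ℂ) (x : Fin (n + 1) → ℝ) : ℂ :=
  prefactor α β lam *
    ∫ y : Fin n → ℝ, ∫ z : Fin (n + 1) → ℝ, kernelIntegrand α β lam x z y * φ y

/-- Absolute convergence of the `(2n+1)`-fold integral defining `raising α β lam φ x`. -/
def RaisingConverges (α β : ℝ) {n : ℕ} (lam : ℂ) (φ : (Fin n → ℝ) → ℂ) (x : Fin (n + 1) → ℝ) :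
    Prop :=
  MeasureTheory.Integrable
    (fun p : (Fin n → ℝ) × (Fin (n + 1) → ℝ) => kernelIntegrand α β lam x p.2 p.1 * φ p.1)

/-- The functions `Ψ_{λ_1, …, λ_n}(x_1, …, x_n)`, defined recursively by the integral
representation, starting from the constant `1` for zero particles. -/
def Psi (α β : ℝ) : (n : ℕ) → (Fin n → ℂ) → (Fin n → ℝ) → ℂ
  | 0, _ => fun _ => 1
  | n + 1, lam => raising α β (lam (Fin.last n)) (Psi α β n fun j => lam j.castSucc)

end BCToda

end

/-! Two mechanisms are at work: the monodromy matrix solves a reflection equation, which makes the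
Hamiltonians commute, and the raising kernel intertwines the operators of n + 1 and n particles up
to total derivatives in the integration variables, which integrate to zero.

Algebra. Since `σ₂ Lᵗ(-u) σ₂ = laxHat`, one more particle replaces the monodromy matrix T by L T L̂.
The shape `!![f + u h, (u - i/2) b; (u - i/2) c, f + i h - u h]`, with b, f, h, c depending on w =
u² only, survives this step (`laxMat_mul_toMatrix_mul_laxHat`). This gives the factor u - i/2 of
𝔹_n(u) and the evenness of the quotient; a degree count gives the expansion. Sklyanin's dressing
carries the reflection equation from the boundary matrix to all particle numbers
(`reflection_chainMat`), and its extremal entry says that the upper right entries at two spectral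
points commute.

Intertwining. Applied to an integral of kernel times φ(y), an operator in x becomes multiplication
of the kernel by a symbol, a Laurent polynomial in the exponentials of x, y, z. An operator applied
to φ becomes such a multiplication as well, after integration by parts in y. Both kinds of symbols
obey the same recursion `symStep` (`Acts`, `ActsTransposed`). It remains to see that the x-symbol of
n + 1 particles equals (λ² - w) times the y-symbol of n particles modulo total z-derivatives of
symbol times kernel. This is an induction over particles in which five relations close on themselves
(`Relations`, `relations`); the auxiliary symbol `pot` is a primitive for the difference of the two
b-symbols. The variable z₀ is special because the kernel may be singular at z₀ = ln β: there only
symbols with the factor 1 - β² e^{-2 z₀} are integrated by parts. With this factor the boundary part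
of the kernel is continuous, vanishes at ln β, and has a derivative governed by α and β exactly as
the boundary matrix requires (`edgeReg_hasDerivAt`).

Analysis. The couplings make the kernel decay faster than any exponential of y and z
(`exists_le_couplingSum`), and the edge singularity is integrable because Im λ > -g. Hence all
integrals converge, differentiation under the integral sign is allowed to any order, and a raised
function is again exponentially tempered. Iterating the intertwining relation gives Ψ the eigenvalue
∏ (λ_j² - w) under 𝔹_n(u)/(u - i/2), and comparing coefficients of w yields the elementary symmetric
functions. -/

noncomputable section

namespace BCToda

/-! ### The even data of the monodromy matrix and their recursion. -/

/-- The four functions of `w = u²` that parametrize the monodromy matrix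
`!![f + u h, (u - i/2) b; (u - i/2) c, f + i h - u h]`. -/
@[ext] structure MonodromyData (A : Type*) where
  b : A
  f : A
  h : A
  c : A

namespace MonodromyData

variable {A B : Type*} [Ring A] [Algebra ℂ A] [Ring B] [Algebra ℂ B]

/-- The effect of one more particle, with operators `p = i∂`, `e = eˣ`, `e' = e⁻ˣ`. -/
def step (w p e e' : A) (d : MonodromyData A) : MonodromyData A where
  b := d.b * (p * p) - w * d.b - (2 : ℂ) • (d.h * (e' * p)) - (2 : ℂ) • (d.f * e')
    - d.c * (e' * e')
  f := d.f + Complex.I • d.h + w * (d.b * e) - (Complex.I / 2) • (d.b * (e * p))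
    + (1 / 2 : ℂ) • (d.b * e)
  h := d.b * (e * p) + (Complex.I / 2) • (d.b * e) - d.h
  c := -(d.b * (e * e))

/-- The monodromy data of `k` particles. -/
def chain (α β : ℝ) (w : A) (p e e' : ℕ → A) : ℕ → MonodromyData A
  | 0 => ⟨1, algebraMap ℂ A (-α), 0, algebraMap ℂ A (-β ^ 2)⟩
  | k + 1 => step w (p k) (e k) (e' k) (chain α β w p e e' k)

/-- The matrix with the given data. -/
def toMatrix (u : A) (d : MonodromyData A) : Matrix (Fin 2) (Fin 2) A :=
  !![d.f + u * d.h, (u - algebraMap ℂ A (Complex.I / 2)) * d.b;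
     (u - algebraMap ℂ A (Complex.I / 2)) * d.c, d.f + Complex.I • d.h - u * d.h]

/-- The image of the data under a ring homomorphism. -/
def map (φ : A →ₐ[ℂ] B) (d : MonodromyData A) : MonodromyData B := ⟨φ d.b, φ d.f, φ d.h, φ d.c⟩

/-- Transports the one recursion between its incarnations: polynomials in w, values at a scalar w,
and operators restricted to tempered functions. -/
theorem map_chain (φ : A →ₐ[ℂ] B) (α β : ℝ) (w : A) (p e e' : ℕ → A) (k : ℕ) :
    (chain α β w p e e' k).map φ
      = chain α β (φ w) (fun j => φ (p j)) (fun j => φ (e j)) (fun j => φ (e' j)) k := by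
  induction k with
  | zero => simp [chain, map]
  | succ k ih =>
    rw [chain, chain, ← ih]
    simp [step, map]

/-- All four components commute with `a`. -/
structure CommuteWith (d : MonodromyData A) (a : A) : Prop where
  b : a * d.b = d.b * a
  f : a * d.f = d.f * a
  h : a * d.h = d.h * a
  c : a * d.c = d.c * a

/-- The data of k particles are built from w and the operators of the first k particles only. This
supplies the commutation with the operators of particle k that the next step needs. -/
theorem commuteWith_chain (α β : ℝ) {w a : A} {p e e' : ℕ → A} {k : ℕ}
    (hw : Commute a w) (hp : ∀ j < k, Commute a (p j)) (he : ∀ j < k, Commute a (e j))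
    (he' : ∀ j < k, Commute a (e' j)) : (chain α β w p e e' k).CommuteWith a := by
  induction k with
  | zero =>
    refine ⟨?_, ?_, ?_, ?_⟩
    · simp [chain]
    · exact (Algebra.commutes _ _).symm
    · simp [chain]
    · exact (Algebra.commutes _ _).symm
  | succ k ih =>
    obtain ⟨hb, hf, hh, hc⟩ := ih (fun j hj => hp j (by omega)) (fun j hj => he j (by omega))
      (fun j hj => he' j (by omega))
    replace hb : Commute a _ := hb
    replace hf : Commute a _ := hf
    replace hh : Commute a _ := hh
    replace hc : Commute a _ := hc
    have p0 := hp k (by omega)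
    have e0 := he k (by omega)
    have e0' := he' k (by omega)
    refine ⟨?_, ?_, ?_, ?_⟩ <;> change Commute a _ <;> simp only [chain, step]
    · exact ((((hb.mul_right (p0.mul_right p0)).sub_right (hw.mul_right hb)).sub_right
        ((hh.mul_right (e0'.mul_right p0)).smul_right _)).sub_right
        ((hf.mul_right e0').smul_right _)).sub_right (hc.mul_right (e0'.mul_right e0'))
    · exact (((hf.add_right (hh.smul_right _)).add_right (hw.mul_right (hb.mul_right e0))).sub_right
        ((hb.mul_right (e0.mul_right p0)).smul_right _)).add_right
        ((hb.mul_right e0).smul_right _)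
    · exact ((hb.mul_right (e0.mul_right p0)).add_right ((hb.mul_right e0).smul_right _)).sub_right
        hh
    · exact (hb.mul_right (e0.mul_right e0)).neg_right

end MonodromyData

/-- The defining relations of `p = i∂`, `e = eˣ`, `e' = e⁻ˣ`. -/
structure TodaTriple {A : Type*} [Ring A] [Algebra ℂ A] (p e e' : A) : Prop where
  pe : p * e = e * p + Complex.I • e
  pe' : p * e' = e' * p - Complex.I • e'
  ee' : e * e' = 1
  e'e : e' * e = 1

section

variable {A : Type*} [Ring A] [Algebra ℂ A]

/-- The Toda Lax matrix over a ring. -/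
def laxMat (u p e e' : A) : Matrix (Fin 2) (Fin 2) A := !![u + p, e'; -e, 0]

/-- The reflected Toda Lax matrix `σ₂ Lᵗ(-u) σ₂`. -/
def laxHat (u p e e' : A) : Matrix (Fin 2) (Fin 2) A := !![0, -e'; e, p - u]

-- The diagonal entries of `toMatrix` are exchanged by u ↦ i - u and the off-diagonal ones are odd
-- under it up to w. The Lax step preserves this structure, so the powers of u recombine into
-- functions of u².
open MonodromyData in
theorem laxMat_mul_toMatrix_mul_laxHat {u p e e' : A} {d : MonodromyData A}
    (hu : ∀ a, a * u = u * a) (ht : TodaTriple p e e')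
    (dp : d.CommuteWith p) (de : d.CommuteWith e) (de' : d.CommuteWith e') :
    laxMat u p e e' * d.toMatrix u * laxHat u p e e'
      = (step (u * u) p e e' d).toMatrix u := by
  obtain ⟨b, f, h, c⟩ := d
  obtain ⟨pe, pe', ee', e'e⟩ := ht
  obtain ⟨p1, p2, p3, p4⟩ := dp
  obtain ⟨e1, e2, e3, e4⟩ := de
  obtain ⟨q1, q2, q3, q4⟩ := de'
  simp only at p1 p2 p3 p4 e1 e2 e3 e4 q1 q2 q3 q4
  have cu (a v : A) : a * (u * v) = u * (a * v) := by rw [← mul_assoc, hu, mul_assoc]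
  have hub := hu b
  have huf := hu f
  have huh := hu h
  have huc := hu c
  have hup := hu p
  have hue := hu e
  have hue' := hu e'
  simp only [laxMat, laxHat, toMatrix, step, Matrix.mul_fin_two]
  ext i j
  -- Normal ordering: the central u goes to the far left, the data come before the new particle's
  -- operators, and p is moved to the right of e and e'. Afterwards only scalar coefficients are
  -- compared.
  fin_cases i <;> fin_cases j <;>
  simp only [Fin.zero_eta, Fin.mk_one, Matrix.of_apply, Matrix.cons_val', Matrix.cons_val_zero,
    Matrix.cons_val_one, Matrix.cons_val_fin_one, Fin.isValue,
    mul_add, add_mul, mul_sub, sub_mul, mul_neg, neg_mul, mul_zero, zero_mul, mul_one, one_mul,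
    mul_assoc, smul_add, smul_sub, smul_neg, smul_mul_assoc, mul_smul_comm, Algebra.algebraMap_eq_smul_one,
    p1, p2, p3, e1, e2, e3, q2, q3, q4, pe, pe', ee', e'e, hub, hup, hue, hue', cu b, cu f, cu h,
    cu p, cu e, cu e', smul_smul]
  all_goals match_scalars <;> ring_nf <;> simp [Complex.I_sq] <;> ring_nf
end

end BCToda

namespace BCToda

theorem TodaTriple.map {A B : Type*} [Ring A] [Algebra ℂ A] [Ring B] [Algebra ℂ B]
    (φ : A →ₐ[ℂ] B) {p e e' : A} (h : TodaTriple p e e') : TodaTriple (φ p) (φ e) (φ e') where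
  pe := by rw [← map_mul, h.pe, map_add, map_mul, map_smul]
  pe' := by rw [← map_mul, h.pe', map_sub, map_mul, map_smul]
  ee' := by rw [← map_mul, h.ee', map_one]
  e'e := by rw [← map_mul, h.e'e, map_one]

/-! ### Differential and multiplication operators on smooth functions. -/

section operators

variable {n : ℕ}

@[ext] theorem SmoothFun.ext {f g : SmoothFun n} (h : ∀ x, f.1 x = g.1 x) : f = g :=
  Subtype.ext (funext h)

theorem pd_commute (i j : Fin n) : Commute (pd i) (pd j) := by
  refine LinearMap.ext fun f => SmoothFun.ext fun x => ?_
  change fderiv ℝ (fun x => fderiv ℝ f.1 x (Pi.single j 1)) x (Pi.single i 1)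
    = fderiv ℝ (fun x => fderiv ℝ f.1 x (Pi.single i 1)) x (Pi.single j 1)
  have hd : DifferentiableAt ℝ (fderiv ℝ f.1) x :=
    (f.contDiff.fderiv_right (m := ∞) (by simp)).differentiable (by simp) x
  rw [fderiv_clm_apply hd (differentiableAt_const _), fderiv_clm_apply hd (differentiableAt_const _)]
  simpa using (f.contDiff.contDiffAt.isSymmSndFDerivAt (by
    rw [minSmoothness_of_isRCLikeNormedField]
    exact WithTop.coe_le_coe.2 (le_top : (2 : ℕ∞) ≤ ⊤)))
    (Pi.single i 1) (Pi.single j 1)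

theorem mulExp_commute (ε δ : ℝ) (i j : Fin n) : Commute (mulExp ε i) (mulExp δ j) := by
  refine LinearMap.ext fun f => SmoothFun.ext fun x => ?_
  exact mul_left_comm _ _ _

theorem mulExp_mul_mulExp_neg (ε δ : ℝ) (h : ε + δ = 0) (i : Fin n) :
    mulExp ε i * mulExp δ i = 1 := by
  refine LinearMap.ext fun f => SmoothFun.ext fun x => ?_
  change (Real.exp (ε * x i) : ℂ) * ((Real.exp (δ * x i) : ℂ) * f.1 x) = f.1 x
  rw [← mul_assoc, ← Complex.ofReal_mul, ← Real.exp_add, ← add_mul, h]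
  simp

theorem pd_mul_mulExp (ε : ℝ) (i j : Fin n) :
    pd i * mulExp ε j = mulExp ε j * pd i + (if i = j then (ε : ℂ) else 0) • mulExp ε j := by
  refine LinearMap.ext fun f => SmoothFun.ext fun x => ?_
  change fderiv ℝ (fun x => (Real.exp (ε * x j) : ℂ) * f.1 x) x (Pi.single i 1)
    = (Real.exp (ε * x j) : ℂ) * fderiv ℝ f.1 x (Pi.single i 1)
      + (if i = j then (ε : ℂ) else 0) * ((Real.exp (ε * x j) : ℂ) * f.1 x)
  have h1 : HasFDerivAt (fun x : Fin n → ℝ => (Real.exp (ε * x j) : ℂ))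
      (Complex.ofRealCLM.comp
        (Real.exp (ε * x j) • (ε • ContinuousLinearMap.proj (R := ℝ) (φ := fun _ => ℝ) j))) x :=
    Complex.ofRealCLM.hasFDerivAt.comp x (((hasFDerivAt_apply j x).const_mul ε).exp)
  rw [show fderiv ℝ (fun x => (Real.exp (ε * x j) : ℂ) * f.1 x) x = _ from
    (h1.mul (f.differentiableAt x).hasFDerivAt).fderiv]
  by_cases h : i = j
  · subst h
    simp
    ring
  · simp [h, Ne.symm h]

theorem pd_commute_mulExp (ε : ℝ) {i j : Fin n} (h : i ≠ j) : Commute (pd i) (mulExp ε j) := by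
  change _ = _
  rw [pd_mul_mulExp]
  simp [h]

/-- `p_j = i ∂/∂x_j`, indexed by natural numbers. -/
def opP (n j : ℕ) : Op n := if h : j < n then Complex.I • pd ⟨j, h⟩ else 0

/-- Multiplication by `e^{ε x_j}`, indexed by natural numbers. -/
def opE (n : ℕ) (ε : ℝ) (j : ℕ) : Op n := if h : j < n then mulExp ε ⟨j, h⟩ else 0

theorem todaTriple_op {j : ℕ} (h : j < n) : TodaTriple (opP n j) (opE n 1 j) (opE n (-1) j) := by
  simp only [opP, opE, dif_pos h]
  refine ⟨?_, ?_, mulExp_mul_mulExp_neg _ _ (by norm_num) _,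
    mulExp_mul_mulExp_neg _ _ (by norm_num) _⟩ <;>
  · rw [smul_mul_assoc, pd_mul_mulExp]
    simp [sub_eq_add_neg]

theorem opP_commute (i j : ℕ) : Commute (opP n i) (opP n j) := by
  unfold opP
  split_ifs
  · exact ((pd_commute _ _).smul_left _).smul_right _
  all_goals simp

theorem opE_commute (ε δ : ℝ) (i j : ℕ) : Commute (opE n ε i) (opE n δ j) := by
  unfold opE
  split_ifs
  · exact mulExp_commute _ _ _ _
  all_goals simp

theorem opP_commute_opE (ε : ℝ) {i j : ℕ} (h : i ≠ j) : Commute (opP n i) (opE n ε j) := by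
  unfold opP opE
  split_ifs
  · exact (pd_commute_mulExp _ (by simpa using h)).smul_left _
  all_goals simp

end operators

/-! ### The monodromy product as a recursion from the inside out. -/

section monodromy

variable {A : Type*} [Ring A] [Algebra ℂ A]

/-- The reflected boundary matrix and Pauli matrices over a ring. -/
def bdryMat (α β : ℝ) (u : A) : Matrix (Fin 2) (Fin 2) A :=
  !![algebraMap ℂ A (-α), u - algebraMap ℂ A (Complex.I / 2);
     -(algebraMap ℂ A ((β : ℂ) ^ 2) * (u - algebraMap ℂ A (Complex.I / 2))), algebraMap ℂ A (-α)]

/-- The Pauli matrix over a ring. -/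
def pauli (A : Type*) [Ring A] [Algebra ℂ A] : Matrix (Fin 2) (Fin 2) A :=
  !![0, algebraMap ℂ A (-Complex.I); algebraMap ℂ A Complex.I, 0]

theorem pauli_mul_pauli : pauli A * pauli A = 1 := by
  simp only [pauli, Matrix.mul_fin_two, Matrix.one_fin_two, ← map_mul]
  simp

theorem pauli_mul_transpose_mul_pauli (u p e e' : A) :
    pauli A * (laxMat (-u) p e e')ᵀ * pauli A = laxHat u p e e' := by
  have hT : (laxMat (-u) p e e')ᵀ = !![-u + p, -e; e', 0] := by
    ext i j
    fin_cases i <;> fin_cases j <;> rfl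
  rw [hT]
  simp [pauli, laxHat, Algebra.algebraMap_eq_smul_one, smul_smul, sub_eq_add_neg, add_comm]

/-- The monodromy matrix of `k` particles over a ring. -/
def chainMat (α β : ℝ) (u : A) (p e e' : ℕ → A) : ℕ → Matrix (Fin 2) (Fin 2) A
  | 0 => bdryMat α β u
  | k + 1 => laxMat u (p k) (e k) (e' k) * chainMat α β u p e e' k * laxHat u (p k) (e k) (e' k)

/-- Inserting σ₂² = 1 between the transposed factors turns each of them into `laxHat`; the last
particle then sits at both outer ends of the product and can be peeled off. -/
theorem chainMat_eq_prod (α β : ℝ) (u : A) (p e e' : ℕ → A) (k : ℕ) :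
    ((List.range k).map fun j => laxMat u (p j) (e j) (e' j)).reverse.prod * bdryMat α β u * pauli A
        * ((List.range k).map fun j => (laxMat (-u) (p j) (e j) (e' j))ᵀ).prod * pauli A
      = chainMat α β u p e e' k := by
  induction k with
  | zero => simp [chainMat, mul_assoc, pauli_mul_pauli]
  | succ k ih =>
    rw [chainMat, ← ih, List.range_succ, List.map_append, List.map_append, List.reverse_append,
      List.prod_append, List.prod_append, ← pauli_mul_transpose_mul_pauli]
    simp only [List.map_cons, List.map_nil, List.reverse_cons, List.reverse_nil, List.nil_append,
      List.prod_cons, List.prod_nil, mul_one, mul_assoc]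
    rw [← mul_assoc (pauli A) (pauli A), pauli_mul_pauli, one_mul]

/-- The relations between the operators of different particles. -/
structure TodaFamily (n : ℕ) (p e e' : ℕ → A) : Prop where
  triple : ∀ j < n, TodaTriple (p j) (e j) (e' j)
  pp : ∀ i j, Commute (p i) (p j)
  pe : ∀ i j, i ≠ j → Commute (p i) (e j)
  pe' : ∀ i j, i ≠ j → Commute (p i) (e' j)
  ee : ∀ i j, Commute (e i) (e j)
  ee' : ∀ i j, Commute (e i) (e' j)
  e'e' : ∀ i j, Commute (e' i) (e' j)

theorem TodaFamily.map {B : Type*} [Ring B] [Algebra ℂ B] (φ : A →ₐ[ℂ] B) {n : ℕ} {p e e' : ℕ → A}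
    (h : TodaFamily n p e e') :
    TodaFamily n (fun j => φ (p j)) (fun j => φ (e j)) (fun j => φ (e' j)) where
  triple j hj := (h.triple j hj).map φ
  pp i j := (h.pp i j).map φ
  pe i j hij := (h.pe i j hij).map φ
  pe' i j hij := (h.pe' i j hij).map φ
  ee i j := (h.ee i j).map φ
  ee' i j := (h.ee' i j).map φ
  e'e' i j := (h.e'e' i j).map φ

theorem todaFamily_op (n : ℕ) : TodaFamily n (opP n) (opE n 1) (opE n (-1)) where
  triple _ h := todaTriple_op h
  pp := opP_commute
  pe _ _ := opP_commute_opE _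
  pe' _ _ := opP_commute_opE _
  ee := opE_commute _ _
  ee' := opE_commute _ _
  e'e' := opE_commute _ _

open MonodromyData in
theorem chainMat_eq_toMatrix (α β : ℝ) {u : A} {p e e' : ℕ → A} {n : ℕ}
    (hu : ∀ a, a * u = u * a) (hF : TodaFamily n p e e') {k : ℕ} (hk : k ≤ n) :
    chainMat α β u p e e' k = (chain α β (u * u) p e e' k).toMatrix u := by
  induction k with
  | zero =>
    simp only [chainMat, chain, toMatrix, bdryMat]
    ext i j
    fin_cases i <;> fin_cases j <;> simp
    rw [← map_pow, ← Algebra.commutes]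
  | succ k ih =>
    rw [chainMat, ih (by omega)]
    have hw (a : A) : Commute a (u * u) := by
      have : Commute a u := hu a
      exact this.mul_right this
    refine laxMat_mul_toMatrix_mul_laxHat hu (hF.triple k (by omega)) ?_ ?_ ?_
    · exact commuteWith_chain _ _ (hw _) (fun j _ => hF.pp k j)
        (fun j hj => hF.pe k j hj.ne') (fun j hj => hF.pe' k j hj.ne')
    · exact commuteWith_chain _ _ (hw _) (fun j hj => (hF.pe j k hj.ne).symm)
        (fun j _ => hF.ee k j) (fun j _ => hF.ee' k j)
    · exact commuteWith_chain _ _ (hw _) (fun j hj => (hF.pe' j k hj.ne).symm)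
        (fun j _ => (hF.ee' j k).symm) (fun j _ => hF.e'e' k j)

end monodromy

end BCToda

namespace BCToda

/-! ### The reflection equation and its extremal entry. -/

section fin_two

variable {A : Type*}

theorem add_fin_two [Add A] (a b c d a' b' c' d' : A) :
    !![a, b; c, d] + !![a', b'; c', d'] = !![a + a', b + b'; c + c', d + d'] := by
  simp

theorem fin_two_ext {a b c d a' b' c' d' : A} (ha : a = a') (hb : b = b') (hc : c = c')
    (hd : d = d') : !![a, b; c, d] = !![a', b'; c', d'] := by
  rw [ha, hb, hc, hd]

end fin_two

section legs

variable {A : Type*} [Ring A]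

/-- `M ⊗ 1`, as a block matrix. -/
def leftLeg (M : Matrix (Fin 2) (Fin 2) A) : Matrix (Fin 2) (Fin 2) (Matrix (Fin 2) (Fin 2) A) :=
  !![!![M 0 0, 0; 0, M 0 0], !![M 0 1, 0; 0, M 0 1]; !![M 1 0, 0; 0, M 1 0], !![M 1 1, 0; 0, M 1 1]]

/-- `1 ⊗ M`, as a block matrix. -/
def rightLeg (M : Matrix (Fin 2) (Fin 2) A) : Matrix (Fin 2) (Fin 2) (Matrix (Fin 2) (Fin 2) A) :=
  !![M, 0; 0, M]

theorem leftLeg_mul (M N : Matrix (Fin 2) (Fin 2) A) :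
    leftLeg (M * N) = leftLeg M * leftLeg N := by
  ext i j k l
  fin_cases i <;> fin_cases j <;> fin_cases k <;> fin_cases l <;>
    simp [leftLeg, Matrix.mul_apply, Fin.sum_univ_two]

theorem rightLeg_mul (M N : Matrix (Fin 2) (Fin 2) A) :
    rightLeg (M * N) = rightLeg M * rightLeg N := by
  simp [rightLeg]

theorem leftLeg_mul_rightLeg {M N : Matrix (Fin 2) (Fin 2) A}
    (h : ∀ i j k l, Commute (M i j) (N k l)) :
    leftLeg M * rightLeg N = rightLeg N * leftLeg M := by
  rw [N.eta_fin_two]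
  simp [leftLeg, rightLeg, fun i j k l => (h i j k l).eq]

/-- Reflection equations are stable under dressing. -/
theorem reflection_dressing {S S' l₁ t₁ k₁ l₂ t₂ k₂ : A}
    (hll : S * l₁ * l₂ = l₂ * l₁ * S) (hkk : S * k₁ * k₂ = k₂ * k₁ * S)
    (hkl : k₁ * S' * l₂ = l₂ * S' * k₁) (hlk : l₁ * S' * k₂ = k₂ * S' * l₁)
    (ht : S * t₁ * S' * t₂ = t₂ * S' * t₁ * S)
    (htl : t₁ * l₂ = l₂ * t₁) (htk : t₁ * k₂ = k₂ * t₁) (hlt : l₁ * t₂ = t₂ * l₁)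
    (hkt : k₁ * t₂ = t₂ * k₁) :
    S * (l₁ * t₁ * k₁) * S' * (l₂ * t₂ * k₂) = (l₂ * t₂ * k₂) * S' * (l₁ * t₁ * k₁) * S :=
  -- The second copy is carried through the first: its outer factors are exchanged first so that the
  -- two middle factors meet and the equation for t applies; then the exchanges are undone in the
  -- reverse order.
  calc S * (l₁ * t₁ * k₁) * S' * (l₂ * t₂ * k₂)
      = S * l₁ * t₁ * (k₁ * S' * l₂) * t₂ * k₂ := by simp only [mul_assoc]
    _ = S * l₁ * (t₁ * l₂) * S' * (k₁ * t₂) * k₂ := by rw [hkl]; simp only [mul_assoc]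
    _ = (S * l₁ * l₂) * t₁ * S' * t₂ * k₁ * k₂ := by rw [htl, hkt]; simp only [mul_assoc]
    _ = l₂ * l₁ * (S * t₁ * S' * t₂) * k₁ * k₂ := by rw [hll]; simp only [mul_assoc]
    _ = l₂ * (l₁ * t₂) * S' * t₁ * (S * k₁ * k₂) := by rw [ht]; simp only [mul_assoc]
    _ = l₂ * t₂ * l₁ * S' * (t₁ * k₂) * k₁ * S := by rw [hkk, hlt]; simp only [mul_assoc]
    _ = l₂ * t₂ * (l₁ * S' * k₂) * t₁ * k₁ * S := by rw [htk]; simp only [mul_assoc]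
    _ = (l₂ * t₂ * k₂) * S' * (l₁ * t₁ * k₁) * S := by rw [hlk]; simp only [mul_assoc]

end legs

section reflection

variable {A : Type*} [Ring A] [Algebra ℂ A]

/-- Yang's R-matrix `x + iP`, as a block matrix. -/
def yang (A : Type*) [Ring A] [Algebra ℂ A] (x : ℂ) :
    Matrix (Fin 2) (Fin 2) (Matrix (Fin 2) (Fin 2) A) :=
  !![!![algebraMap ℂ A (x + Complex.I), 0; 0, algebraMap ℂ A x],
     !![0, 0; algebraMap ℂ A Complex.I, 0];
     !![0, algebraMap ℂ A Complex.I; 0, 0],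
     !![algebraMap ℂ A x, 0; 0, algebraMap ℂ A (x + Complex.I)]]

variable {p e e' : A}

/-- This and the next three relations are the exchange relations of a single particle. Each is
checked entry by entry after normal ordering with `TodaTriple`. The mixed relations hold at the
shifted argument u + v - i, the one in the reflection equation. -/
theorem yang_lax_lax (h : TodaTriple p e e') (u v : ℂ) :
    yang A (u - v) * leftLeg (laxMat (algebraMap ℂ A u) p e e')
        * rightLeg (laxMat (algebraMap ℂ A v) p e e')
      = rightLeg (laxMat (algebraMap ℂ A v) p e e') * leftLeg (laxMat (algebraMap ℂ A u) p e e')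
        * yang A (u - v) := by
  obtain ⟨pe, pe', ee', e'e⟩ := h
  simp only [leftLeg, rightLeg, yang, laxMat, Matrix.mul_fin_two, Matrix.of_apply,
    Matrix.cons_val', Matrix.cons_val_zero, Matrix.cons_val_one, Matrix.cons_val_fin_one,
    Fin.isValue, add_fin_two, zero_mul, mul_zero, add_zero, zero_add, neg_mul, mul_neg, neg_zero,
    Algebra.algebraMap_eq_smul_one, smul_mul_assoc, mul_smul_comm, one_mul, mul_one, mul_add,
    add_mul, mul_sub, sub_mul, smul_add, smul_neg, smul_smul, pe, pe', ee', e'e, smul_sub]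
  apply fin_two_ext <;> apply fin_two_ext <;>
    match_scalars <;> ring

theorem yang_laxHat_laxHat (h : TodaTriple p e e') (u v : ℂ) :
    yang A (u - v) * leftLeg (laxHat (algebraMap ℂ A u) p e e')
        * rightLeg (laxHat (algebraMap ℂ A v) p e e')
      = rightLeg (laxHat (algebraMap ℂ A v) p e e') * leftLeg (laxHat (algebraMap ℂ A u) p e e')
        * yang A (u - v) := by
  obtain ⟨pe, pe', ee', e'e⟩ := h
  simp only [leftLeg, rightLeg, yang, laxHat, Matrix.mul_fin_two, Matrix.of_apply,
    Matrix.cons_val', Matrix.cons_val_zero, Matrix.cons_val_one, Matrix.cons_val_fin_one,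
    Fin.isValue, add_fin_two, zero_mul, mul_zero, add_zero, zero_add, neg_mul, mul_neg, neg_zero,
    Algebra.algebraMap_eq_smul_one, smul_mul_assoc, mul_smul_comm, one_mul, mul_one, mul_add,
    add_mul, mul_sub, sub_mul, smul_add, smul_neg, smul_smul, pe, pe', ee', e'e, smul_sub]
  apply fin_two_ext <;> apply fin_two_ext <;>
    match_scalars <;> ring

theorem laxHat_yang_lax (h : TodaTriple p e e') (u v : ℂ) :
    leftLeg (laxHat (algebraMap ℂ A u) p e e') * yang A (u + v - Complex.I)
        * rightLeg (laxMat (algebraMap ℂ A v) p e e')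
      = rightLeg (laxMat (algebraMap ℂ A v) p e e') * yang A (u + v - Complex.I)
        * leftLeg (laxHat (algebraMap ℂ A u) p e e') := by
  obtain ⟨pe, pe', ee', e'e⟩ := h
  simp only [leftLeg, rightLeg, yang, laxMat, laxHat, Matrix.mul_fin_two, Matrix.of_apply,
    Matrix.cons_val', Matrix.cons_val_zero, Matrix.cons_val_one, Matrix.cons_val_fin_one,
    Fin.isValue, add_fin_two, zero_mul, mul_zero, add_zero, zero_add, neg_mul, mul_neg, neg_zero,
    Algebra.algebraMap_eq_smul_one, smul_mul_assoc, mul_smul_comm, one_mul, mul_one, mul_add,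
    add_mul, mul_sub, sub_mul, smul_add, smul_neg, smul_smul, pe, pe', ee', e'e, smul_sub]
  apply fin_two_ext <;> apply fin_two_ext <;>
    match_scalars <;> ring

theorem lax_yang_laxHat (h : TodaTriple p e e') (u v : ℂ) :
    leftLeg (laxMat (algebraMap ℂ A u) p e e') * yang A (u + v - Complex.I)
        * rightLeg (laxHat (algebraMap ℂ A v) p e e')
      = rightLeg (laxHat (algebraMap ℂ A v) p e e') * yang A (u + v - Complex.I)
        * leftLeg (laxMat (algebraMap ℂ A u) p e e') := by
  obtain ⟨pe, pe', ee', e'e⟩ := h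
  simp only [leftLeg, rightLeg, yang, laxMat, laxHat, Matrix.mul_fin_two, Matrix.of_apply,
    Matrix.cons_val', Matrix.cons_val_zero, Matrix.cons_val_one, Matrix.cons_val_fin_one,
    Fin.isValue, add_fin_two, zero_mul, mul_zero, add_zero, zero_add, neg_mul, mul_neg, neg_zero,
    Algebra.algebraMap_eq_smul_one, smul_mul_assoc, mul_smul_comm, one_mul, mul_one, mul_add,
    add_mul, mul_sub, sub_mul, smul_add, smul_neg, smul_smul, pe, pe', ee', e'e, smul_sub]
  apply fin_two_ext <;> apply fin_two_ext <;>
    match_scalars <;> ring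

/-- The reflection equation for the boundary matrix. -/
theorem reflection_bdryMat (α β : ℝ) (u v : ℂ) :
    yang A (u - v) * leftLeg (bdryMat α β (algebraMap ℂ A u)) * yang A (u + v - Complex.I)
        * rightLeg (bdryMat α β (algebraMap ℂ A v))
      = rightLeg (bdryMat α β (algebraMap ℂ A v)) * yang A (u + v - Complex.I)
        * leftLeg (bdryMat α β (algebraMap ℂ A u)) * yang A (u - v) := by
  simp only [leftLeg, rightLeg, yang, bdryMat, Matrix.mul_fin_two, Matrix.of_apply,
    Matrix.cons_val', Matrix.cons_val_zero, Matrix.cons_val_one, Matrix.cons_val_fin_one,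
    Fin.isValue, add_fin_two, zero_mul, mul_zero, add_zero, zero_add, ← map_mul, ← map_sub,
    ← map_neg, ← map_add]
  apply fin_two_ext <;> apply fin_two_ext <;> congr 1 <;> ring

/-- The entries of the new Lax matrices commute with those of the inner chain, so
`reflection_dressing` applies to the two tensor legs. -/
theorem reflection_chainMat (α β : ℝ) {p e e' : ℕ → A} {n : ℕ} (hF : TodaFamily n p e e')
    (u v : ℂ) {k : ℕ} (hk : k ≤ n) :
    yang A (u - v) * leftLeg (chainMat α β (algebraMap ℂ A u) p e e' k) * yang A (u + v - Complex.I)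
        * rightLeg (chainMat α β (algebraMap ℂ A v) p e e' k)
      = rightLeg (chainMat α β (algebraMap ℂ A v) p e e' k) * yang A (u + v - Complex.I)
        * leftLeg (chainMat α β (algebraMap ℂ A u) p e e' k) * yang A (u - v) := by
  induction k with
  | zero => exact reflection_bdryMat α β u v
  | succ k ih =>
    have hk' := hF.triple k (by omega)
    have hc (u a : A) (ha : ∀ j < k, Commute a (p j)) (ha' : ∀ j < k, Commute a (e j))
        (ha'' : ∀ j < k, Commute a (e' j)) (hu : ∀ a, Commute a u) (i j : Fin 2) :
        Commute a (chainMat α β u p e e' k i j) := by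
      rw [chainMat_eq_toMatrix α β (fun a => hu a) hF (by omega : k ≤ n)]
      obtain ⟨hb, hf, hh, hc⟩ := MonodromyData.commuteWith_chain α β
        ((hu a).mul_right (hu a)) ha ha' ha''
      replace hb : Commute a _ := hb
      replace hf : Commute a _ := hf
      replace hh : Commute a _ := hh
      replace hc : Commute a _ := hc
      have hi : Commute a (u - algebraMap ℂ A (Complex.I / 2)) :=
        (hu a).sub_right (Algebra.commutes _ _).symm
      fin_cases i <;> fin_cases j
      · exact hf.add_right ((hu a).mul_right hh)
      · exact hi.mul_right hb
      · exact hi.mul_right hc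
      · exact (hf.add_right (hh.smul_right _)).sub_right ((hu a).mul_right hh)
    have hs (x : ℂ) (a : A) : Commute a (algebraMap ℂ A x) := (Algebra.commutes _ _).symm
    have hp (x : ℂ) (i j : Fin 2) : Commute (p k) (chainMat α β (algebraMap ℂ A x) p e e' k i j) :=
      hc _ _ (fun j _ => hF.pp k j) (fun j hj => hF.pe k j hj.ne') (fun j hj => hF.pe' k j hj.ne')
        (hs x) i j
    have he (x : ℂ) (i j : Fin 2) : Commute (e k) (chainMat α β (algebraMap ℂ A x) p e e' k i j) :=
      hc _ _ (fun j hj => (hF.pe j k hj.ne).symm) (fun j _ => hF.ee k j) (fun j _ => hF.ee' k j)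
        (hs x) i j
    have he' (x : ℂ) (i j : Fin 2) : Commute (e' k) (chainMat α β (algebraMap ℂ A x) p e e' k i j) :=
      hc _ _ (fun j hj => (hF.pe' j k hj.ne).symm) (fun j _ => (hF.ee' j k).symm)
        (fun j _ => hF.e'e' k j) (hs x) i j
    have hl (x y : ℂ) (i j i' j' : Fin 2) :
        Commute (laxMat (algebraMap ℂ A y) (p k) (e k) (e' k) i j)
          (chainMat α β (algebraMap ℂ A x) p e e' k i' j') := by
      fin_cases i <;> fin_cases j
      · exact (hs y _).symm.add_left (hp x _ _)
      · exact he' x _ _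
      · exact (he x _ _).neg_left
      · exact Commute.zero_left _
    have hh (x y : ℂ) (i j i' j' : Fin 2) :
        Commute (laxHat (algebraMap ℂ A y) (p k) (e k) (e' k) i j)
          (chainMat α β (algebraMap ℂ A x) p e e' k i' j') := by
      fin_cases i <;> fin_cases j
      · exact Commute.zero_left _
      · exact (he' x _ _).neg_left
      · exact he x _ _
      · exact (hp x _ _).sub_left (hs y _).symm
    simp only [chainMat, leftLeg_mul, rightLeg_mul]
    exact reflection_dressing (yang_lax_lax hk' u v) (yang_laxHat_laxHat hk' u v)
      (laxHat_yang_lax hk' u v) (lax_yang_laxHat hk' u v) (ih (by omega))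
      (leftLeg_mul_rightLeg fun i j i' j' => (hl _ _ _ _ _ _).symm)
      (leftLeg_mul_rightLeg fun i j i' j' => (hh _ _ _ _ _ _).symm)
      (leftLeg_mul_rightLeg fun i j i' j' => hl _ _ _ _ _ _)
      (leftLeg_mul_rightLeg fun i j i' j' => hh _ _ _ _ _ _)

/-- In the entry from (0,0) to (1,1) of the tensor square each R-matrix contributes only a diagonal
scalar, so both sides reduce to (x + i) y times a product of upper right entries, in the two orders.
-/
theorem commute_of_reflection {M N : Matrix (Fin 2) (Fin 2) A} {x y : ℂ}
    (hx : x + Complex.I ≠ 0) (hy : y ≠ 0)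
    (h : yang A x * leftLeg M * yang A y * rightLeg N
      = rightLeg N * yang A y * leftLeg M * yang A x) :
    Commute (M 0 1) (N 0 1) := by
  rw [M.eta_fin_two, N.eta_fin_two] at h
  have h' := congrFun (congrFun (congrFun (congrFun h 0) 1) 0) 1
  simp [leftLeg, rightLeg, yang, Algebra.algebraMap_eq_smul_one, smul_smul,
    -smul_add, -mul_eq_mul_left_iff] at h'
  rw [mul_comm y] at h'
  exact smul_right_injective A (mul_ne_zero hx hy) h'

end reflection

end BCToda

namespace BCToda

open MonodromyData

/-! ### Polynomials with noncommuting coefficients, evaluated at central elements. -/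

section polynomial

variable {A : Type*} [Ring A] [Algebra ℂ A]

omit [Algebra ℂ A] in
theorem neg_one_pow_mul_self (n : ℕ) : ((-1) ^ n * (-1) ^ n : A) = 1 := by
  rw [← pow_add, Even.neg_one_pow ⟨n, rfl⟩]

omit [Algebra ℂ A] in
theorem neg_one_pow_commute (n : ℕ) (a : A) : Commute ((-1) ^ n) a :=
  (Commute.neg_one_left a).pow_left n

/-- Evaluation of polynomials with noncommuting coefficients at a central element. -/
def evalCentral {B : Type*} [Ring B] [Algebra ℂ B] (f : A →ₐ[ℂ] B) (x : B)
    (hx : ∀ a, Commute (f a) x) : A[X] →ₐ[ℂ] B :=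
  { Polynomial.eval₂RingHom' (f : A →+* B) x hx with
    commutes' := fun r => by simp [Polynomial.algebraMap_apply, Polynomial.eval₂RingHom'] }

theorem evalCentral_apply {B : Type*} [Ring B] [Algebra ℂ B] (f : A →ₐ[ℂ] B) (x : B)
    (hx : ∀ a, Commute (f a) x) (q : A[X]) :
    evalCentral f x hx q = q.eval₂ (f : A →+* B) x := rfl

/-- Evaluation at a scalar. -/
def evalScalar (u : ℂ) : A[X] →ₐ[ℂ] A :=
  evalCentral (AlgHom.id ℂ A) (algebraMap ℂ A u) fun a => (Algebra.commutes u a).symm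

theorem evalScalar_apply (u : ℂ) (q : A[X]) : evalScalar u q = q.eval (algebraMap ℂ A u) := rfl

@[simp] theorem evalScalar_X (u : ℂ) : evalScalar u (Polynomial.X : A[X]) = algebraMap ℂ A u := by
  simp [evalScalar_apply]

@[simp] theorem evalScalar_C (u : ℂ) (a : A) : evalScalar u (Polynomial.C a) = a := by
  simp [evalScalar_apply]

/-- The substitution of `X²` for `X`. -/
def substSq : A[X] →ₐ[ℂ] A[X] :=
  evalCentral Polynomial.CAlgHom (Polynomial.X * Polynomial.X) fun a =>
    ((Polynomial.commute_X (Polynomial.C a)).symm.mul_right (Polynomial.commute_X _).symm)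

@[simp] theorem substSq_X : substSq (Polynomial.X : A[X]) = Polynomial.X * Polynomial.X :=
  (evalCentral_apply _ _ _ _).trans (by simp)

@[simp] theorem substSq_C (a : A) : substSq (Polynomial.C a) = Polynomial.C a :=
  (evalCentral_apply _ _ _ _).trans (by simp)

theorem coeff_substSq (q : A[X]) (m : ℕ) : (substSq q).coeff (2 * m) = q.coeff m := by
  induction q using Polynomial.induction_on' with
  | add p q hp hq => simp [hp, hq]
  | monomial k a =>
    rw [← Polynomial.C_mul_X_pow_eq_monomial, map_mul, map_pow, substSq_X, substSq_C, ← pow_two,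
      ← pow_mul, Polynomial.coeff_C_mul_X_pow, Polynomial.coeff_C_mul_X_pow]
    simp

/-- Linear functionals on A separate points, so it suffices to apply one to all coefficients; the
scalar polynomial obtained has the infinitely many roots m². -/
theorem eq_zero_of_evalScalar_sq_eq_zero {q : A[X]}
    (h : ∀ m : ℕ, evalScalar ((m : ℂ) ^ 2) q = 0) : q = 0 := by
  ext i
  rw [Polynomial.coeff_zero, ← Module.forall_dual_apply_eq_zero_iff ℂ]
  intro φ
  let r : ℂ[X] := ∑ j ∈ Finset.range (q.natDegree + 1), Polynomial.C (φ (q.coeff j)) * Polynomial.X ^ j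
  have hr (m : ℕ) : r.eval ((m : ℂ) ^ 2) = 0 := by
    have h' := congrArg φ (h m)
    rw [evalScalar_apply, Polynomial.eval_eq_sum_range, map_sum, map_zero] at h'
    rw [← h', Polynomial.eval_finsetSum]
    refine Finset.sum_congr rfl fun j _ => ?_
    rw [← map_pow, ← Algebra.commutes, ← Algebra.smul_def, map_smul]
    rw [Polynomial.eval_mul, Polynomial.eval_C, Polynomial.eval_pow, Polynomial.eval_X, smul_eq_mul,
      mul_comm]
  have hr0 : r = 0 := by
    refine Polynomial.eq_zero_of_infinite_isRoot r
      (Set.infinite_of_injective_forall_mem (f := fun m : ℕ => (m : ℂ) ^ 2) ?_ hr)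
    intro a b hab
    have : a ^ 2 = b ^ 2 := by
      have hab' : (a : ℂ) ^ 2 = (b : ℂ) ^ 2 := hab
      exact_mod_cast hab'
    exact Nat.pow_left_injective (by norm_num) this
  have hc := congrArg (fun s => Polynomial.coeff s i) hr0
  simp only [r, Polynomial.finsetSum_coeff, Polynomial.coeff_C_mul_X_pow, Polynomial.coeff_zero] at hc
  rw [Finset.sum_ite_eq] at hc
  split_ifs at hc with hi
  · exact hc
  · rw [Polynomial.coeff_eq_zero_of_natDegree_lt (by simpa using hi), map_zero]

theorem commute_coeff_of_commute_evalScalar {q : A[X]} {a : A}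
    (h : ∀ m : ℕ, Commute (evalScalar ((m : ℂ) ^ 2) q) a) (i : ℕ) : Commute (q.coeff i) a := by
  have : q * Polynomial.C a - Polynomial.C a * q = 0 :=
    eq_zero_of_evalScalar_sq_eq_zero fun m => by
      simp [(h m).eq]
  have hc := congrArg (fun s => Polynomial.coeff s i) this
  simp only [Polynomial.coeff_sub, Polynomial.coeff_mul_C, Polynomial.coeff_C_mul,
    Polynomial.coeff_zero] at hc
  exact sub_eq_zero.1 hc

/-- Only the terms w b in `b` and w b e in `f` raise the degree in w. Hence all data of k particles
have degree at most k, and the leading coefficient of `b` changes sign at each step. -/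
theorem coeff_chain (α β : ℝ) (p e e' : ℕ → A) (k : ℕ) :
    let d := chain α β Polynomial.X (fun j => Polynomial.C (p j)) (fun j => Polynomial.C (e j))
      (fun j => Polynomial.C (e' j)) k
    d.b.coeff k = (-1) ^ k ∧ ∀ m, k < m → d.b.coeff m = 0 ∧ d.f.coeff m = 0 ∧ d.h.coeff m = 0
      ∧ d.c.coeff m = 0 := by
  induction k with
  | zero =>
    refine ⟨by simp [chain], fun m hm => ?_⟩
    simp only [chain, Polynomial.algebraMap_apply, Polynomial.coeff_C, Polynomial.coeff_one,
      Polynomial.coeff_zero, if_neg hm.ne', and_self]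
  | succ k ih =>
    obtain ⟨h1, h2⟩ := ih
    generalize hd : chain α β Polynomial.X (fun j => Polynomial.C (p j)) (fun j => Polynomial.C (e j))
      (fun j => Polynomial.C (e' j)) k = d at *
    have h3 := h2 (k + 1) (by omega)
    simp only [chain, hd, step, ← Polynomial.C_mul]
    refine ⟨?_, fun m hm => ?_⟩
    · simp [h3, Polynomial.coeff_mul_C, Polynomial.coeff_X_mul, h1, pow_succ, -map_mul]
    · obtain ⟨m, rfl⟩ : ∃ l, m = l + 1 := ⟨m - 1, by omega⟩
      have h4 := h2 m (by omega)
      have h5 := h2 (m + 1) (by omega)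
      simp [h4, h5, Polynomial.coeff_mul_C, Polynomial.coeff_X_mul, ← mul_assoc, -map_mul]

end polynomial

/-! ### The expansion of 𝔹_n and the commutativity of its coefficients. -/

section hamiltonians

variable (α β : ℝ) (n : ℕ)

/-- `𝔹_n(u)/(u - i/2)` as a polynomial in `w = u²`. -/
def bPoly : (Op n)[X] :=
  (chain α β Polynomial.X (fun j => Polynomial.C (opP n j)) (fun j => Polynomial.C (opE n 1 j))
    (fun j => Polynomial.C (opE n (-1) j)) n).b

/-- `𝔹_n(u)/(u - i/2)` at `u² = w`. -/
def bOp (w : ℂ) : Op n :=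
  (chain α β (algebraMap ℂ (Op n) w) (opP n) (opE n 1) (opE n (-1)) n).b

theorem evalScalar_bPoly (w : ℂ) : evalScalar w (bPoly α β n) = bOp α β n w := by
  have := congrArg MonodromyData.b (map_chain (evalScalar w) α β Polynomial.X
    (fun j => Polynomial.C (opP n j)) (fun j => Polynomial.C (opE n 1 j))
    (fun j => Polynomial.C (opE n (-1) j)) n)
  simp only [evalScalar_X, evalScalar_C] at this
  exact this

theorem list_ofFn_eq_map_range {B : Type*} {n : ℕ} (f : Fin n → B) (g : ℕ → B)
    (h : ∀ j : Fin n, f j = g j) : List.ofFn f = (List.range n).map g :=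
  List.ext_getElem (by simp) fun i h1 h2 => by simp [h]

theorem BPoly_eq : BPoly α β n
    = (Polynomial.X - scal n (Complex.I / 2)) * substSq (bPoly α β n) := by
  have hl (u : (Op n)[X]) (j : Fin n) : lax j u = laxMat u (Polynomial.C (opP n j))
      (Polynomial.C (opE n 1 j)) (Polynomial.C (opE n (-1) j)) := by
    simp [lax, laxMat, opP, opE]
  have hF : TodaFamily n (fun j => (Polynomial.C (opP n j) : (Op n)[X]))
      (fun j => Polynomial.C (opE n 1 j)) (fun j => Polynomial.C (opE n (-1) j)) :=
    (todaFamily_op n).map (Polynomial.CAlgHom (R := ℂ))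
  have h1 : monodromy α β n = chainMat α β (Polynomial.X : (Op n)[X])
      (fun j => Polynomial.C (opP n j)) (fun j => Polynomial.C (opE n 1 j))
      (fun j => Polynomial.C (opE n (-1) j)) n := by
    rw [← chainMat_eq_prod, monodromy]
    rw [list_ofFn_eq_map_range _ (fun j => laxMat Polynomial.X (Polynomial.C (opP n j))
      (Polynomial.C (opE n 1 j)) (Polynomial.C (opE n (-1) j))) fun j => hl Polynomial.X j,
      list_ofFn_eq_map_range _ (fun j => (laxMat (-Polynomial.X) (Polynomial.C (opP n j))
      (Polynomial.C (opE n 1 j)) (Polynomial.C (opE n (-1) j)))ᵀ) fun j => by rw [hl]]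
    rfl
  have h2 := congrArg MonodromyData.b (map_chain (substSq (A := Op n)) α β Polynomial.X
    (fun j => Polynomial.C (opP n j)) (fun j => Polynomial.C (opE n 1 j))
    (fun j => Polynomial.C (opE n (-1) j)) n)
  simp only [substSq_X, substSq_C] at h2
  rw [BPoly, h1, chainMat_eq_toMatrix α β (fun a => (Polynomial.commute_X a).symm.eq) hF le_rfl]
  exact congrArg (fun t => (Polynomial.X - scal n (Complex.I / 2)) * t) h2.symm

/-- Division by the monic factor is exact by `BPoly_eq`, and passing from u² to w halves the index.
-/
theorem hamiltonian_eq (s : ℕ) :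
    hamiltonian α β n s = (-1) ^ n * (bPoly α β n).coeff (n - s) := by
  rw [hamiltonian, BPoly_eq]
  change _ * (((Polynomial.X - Polynomial.C (algebraMap ℂ (Op n) (Complex.I / 2))) * _) /ₘ _).coeff _
    = _
  rw [Polynomial.mul_divByMonic_cancel_left _ (Polynomial.monic_X_sub_C _), coeff_substSq]

theorem bPoly_eq_sum : (-1) ^ n * bPoly α β n = Polynomial.X ^ n + ∑ s ∈ Finset.Icc 1 n,
    Polynomial.C (hamiltonian α β n s) * Polynomial.X ^ (n - s) := by
  obtain ⟨h1, h2⟩ := coeff_chain α β (opP n) (opE n 1) (opE n (-1)) n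
  change (bPoly α β n).coeff n = _ at h1
  have h3 : (bPoly α β n).natDegree < n + 1 := by
    refine Nat.lt_succ_of_le (Polynomial.natDegree_le_iff_coeff_eq_zero.2 fun m hm => (h2 m hm).1)
  conv_lhs => rw [(bPoly α β n).as_sum_range_C_mul_X_pow' h3]
  rw [← Finset.sum_range_reflect, Finset.sum_range_succ', mul_add, add_comm, Finset.mul_sum]
  congr 1
  · simp only [Nat.add_sub_cancel, Nat.sub_zero, h1]
    rw [← mul_assoc, map_pow, map_neg, map_one, neg_one_pow_mul_self, one_mul]
  · rw [Finset.range_eq_Ico, Finset.sum_Ico_add' (fun j => (-1 : (Op n)[X]) ^ n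
      * (Polynomial.C ((bPoly α β n).coeff (n + 1 - 1 - j)) * Polynomial.X ^ (n + 1 - 1 - j)))]
    refine Finset.sum_congr (by ext; simp) fun s _ => ?_
    rw [hamiltonian_eq, map_mul, map_pow, map_neg, map_one, mul_assoc, Nat.add_sub_cancel]

theorem BPoly_expansion : BPoly α β n
    = (-1) ^ n * (Polynomial.X - scal n (Complex.I / 2))
      * (Polynomial.X ^ (2 * n) + ∑ s ∈ Finset.Icc 1 n,
          Polynomial.C (hamiltonian α β n s) * Polynomial.X ^ (2 * (n - s))) := by
  have h := congrArg (substSq (A := Op n)) (bPoly_eq_sum α β n)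
  simp only [map_mul, map_add, map_sum, map_pow, substSq_X, substSq_C, map_neg, map_one,
    ← pow_two, ← pow_mul] at h
  rw [← h, BPoly_eq]
  rw [(neg_one_pow_commute n _).eq, mul_assoc, ← mul_assoc ((-1) ^ n), neg_one_pow_mul_self, one_mul]

/-- Natural numbers as spectral points keep all factors to be cancelled nonzero (m - i/2, m - k + i
and m + k - i have nonzero imaginary part), and their squares are numerous enough to determine a
polynomial in w. -/
theorem commute_bOp_sq (m k : ℕ) : Commute (bOp α β n ((m : ℂ) ^ 2)) (bOp α β n ((k : ℂ) ^ 2)) := by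
  have hb (m : ℕ) : chainMat α β (algebraMap ℂ (Op n) m) (opP n) (opE n 1) (opE n (-1)) n 0 1
      = ((m : ℂ) - Complex.I / 2) • bOp α β n ((m : ℂ) ^ 2) := by
    rw [chainMat_eq_toMatrix α β (fun a => (Algebra.commutes _ _).symm) (todaFamily_op n) le_rfl,
      bOp, pow_two, map_mul, Algebra.smul_def, map_sub]
    rfl
  have h0 (m : ℕ) : (m : ℂ) - Complex.I / 2 ≠ 0 := fun h => by
    have := congrArg Complex.im h
    simp at this
  have h1 : (m : ℂ) - k + Complex.I ≠ 0 := fun h => by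
    have := congrArg Complex.im h
    simp at this
  have h2 : (m : ℂ) + k - Complex.I ≠ 0 := fun h => by
    have := congrArg Complex.im h
    simp at this
  have := commute_of_reflection h1 h2 (reflection_chainMat α β (todaFamily_op n) m k le_rfl)
  rw [hb, hb] at this
  have h3 := (this.smul_left ((m : ℂ) - Complex.I / 2)⁻¹).smul_right ((k : ℂ) - Complex.I / 2)⁻¹
  rwa [inv_smul_smul₀ (h0 m), inv_smul_smul₀ (h0 k)] at h3

/-- Values are replaced by coefficients in one factor at a time with
`commute_coeff_of_commute_evalScalar`. -/
theorem commute_hamiltonian (r s : ℕ) :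
    Commute (hamiltonian α β n r) (hamiltonian α β n s) := by
  have h1 (i : ℕ) (k : ℕ) : Commute ((bPoly α β n).coeff i) (bOp α β n ((k : ℂ) ^ 2)) :=
    commute_coeff_of_commute_evalScalar
      (fun m => by rw [evalScalar_bPoly]; exact commute_bOp_sq α β n m k) i
  have h2 (i j : ℕ) : Commute ((bPoly α β n).coeff i) ((bPoly α β n).coeff j) :=
    commute_coeff_of_commute_evalScalar
      (fun m => by rw [evalScalar_bPoly]; exact (h1 j m).symm) i
  rw [hamiltonian_eq, hamiltonian_eq]
  exact (neg_one_pow_commute n _).mul_left ((neg_one_pow_commute n _).symm.mul_right (h2 _ _))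

theorem BOp_eq (u : ℂ) : BOp α β n u = (u - Complex.I / 2) • bOp α β n (u ^ 2) := by
  have h : BOp α β n u = evalScalar u (BPoly α β n) := rfl
  have hs : evalScalar u (substSq (bPoly α β n)) = bOp α β n (u ^ 2) := by
    have := congrArg MonodromyData.b (map_chain ((evalScalar u).comp (substSq (A := Op n))) α β
      Polynomial.X (fun j => Polynomial.C (opP n j)) (fun j => Polynomial.C (opE n 1 j))
      (fun j => Polynomial.C (opE n (-1) j)) n)
    simp only [AlgHom.comp_apply, substSq_X, substSq_C, map_mul, evalScalar_X, evalScalar_C] at this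
    rw [bOp, pow_two, map_mul]
    exact this
  rw [h, BPoly_eq, map_mul, hs, map_sub, evalScalar_X, AlgHom.commutes, ← map_sub, Algebra.smul_def]

end hamiltonians

end BCToda

namespace BCToda

/-! ### Polynomial identities behind the induction over particles. -/

section identities

variable {R : Type*} [CommRing R]

/-- The step of the monodromy data for commutative symbols, where `p` has been replaced by `i A`
and `p²` by `-(A² - t - r)`, with `A = i λ + t - r`. -/
def symStep (I hf lam w X X' t r : R) (d : MonodromyData R) : MonodromyData R where
  b := d.b * (-((I * lam + t - r) ^ 2 - t - r) - w)
    - 2 * X' * (I * (I * lam + t - r) * d.h + d.f) - X' ^ 2 * d.c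
  f := d.f + I * d.h + X * (w + hf * (I * lam + t - r) + hf) * d.b
  h := X * I * (I * lam + t - r + hf) * d.b - d.h
  c := -X ^ 2 * d.b

/-- The combination `b + 2i e⁻ᶻ h + e⁻²ᶻ c`. -/
def symJ (I Z' : R) (d : MonodromyData R) : R := d.b + 2 * I * Z' * d.h + Z' ^ 2 * d.c

/-- The combination of the data that is annihilated at `w = λ²`; `dJ` is the total `z`-derivative
of `symJ`. -/
def symD (I lam Z' : R) (d : MonodromyData R) (dJ : R) : R :=
  dJ + 2 * I * lam * d.b + 2 * (I - lam) * Z' * d.h + 2 * Z' * d.f + Z' ^ 2 * d.c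

/-- The total `z'`-derivative of `symJ` after one more step. -/
def symDJ (I hf lam w X X' U' t r q : R) (d : MonodromyData R) : R :=
  -d.b * (2 * (I * lam + t - r) * r + r) - 2 * I * X' * r * d.h
    - 2 * I * U' * (symStep I hf lam w X X' t r d).h + 2 * I * U' * X * I * r * d.b
    - 2 * U' ^ 2 * (symStep I hf lam w X X' t r d).c
    + (-2 * I * lam + r + q) * symJ I U' (symStep I hf lam w X X' t r d)

variable {I hf lam w X X' Y Y' Z Z' U U' : R}

/-- In this and the following identities X, Y, Z, U stand for the exponentials of x_k, y_k, z_k,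
z_{k+1} and primes for inverses, so Z X', Z Y', X U', Y U' are the couplings of step k. S and dS are
the potential and its total derivative; `d` and `dy` are the x- and y-data. Each identity writes a
relation of step k + 1 as a combination of relations of step k, with coefficients free of the
earlier z-variables, plus terms of the form G' F + G dF - G c F, which are total z_k-derivatives of
G F. -/
theorem symD_symStep (hI : I * I = -1) (hh : 2 * hf = 1) (hX : X * X' = 1) (hY : Y * Y' = 1)
    (hZ : Z * Z' = 1) (d : MonodromyData R) (S dJ : R) :
    symD I lam U' (symStep I hf lam w X X' (Z * X') (X * U') d)
        (symDJ I hf lam w X X' U' (Z * X') (X * U') (Y * U') d)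
      - (lam ^ 2 - w) * ((Y * U' - X * U') * d.b - Y * U' * (Z * X') * S)
      = -(Y * U' * (Z * X')) * (symD I lam Z' d dJ - (lam ^ 2 - w) * S)
        + (Y * U' * (Z * X') * symJ I Z' d + Y * U' * (Z * X') * dJ
          - Y * U' * (Z * X') * (Z * X' + Z * Y') * symJ I Z' d) := by
  simp only [symD, symDJ, symStep, symJ]
  linear_combination
      (-U' * Z * d.b - 2 * I * U' * d.h - 4 * I * U' * Z * d.b * lam - 2 * I ^ 2 * U' * d.h *
      lam - 4 * I ^ 3 * U' * Z * d.b * lam - U' * X' * Z ^ 2 * d.b + 2 * U' ^ 2 * X * Z * d.b -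
      2 * I * U' * X' * Z * d.h + 2 * I * U' ^ 2 * X * d.h - 2 * U' * d.f - U' * X' * d.c + 2 *
      I ^ 2 * U' ^ 2 * X * Z * d.b + 2 * U' ^ 2 * Y * Z * d.b + 2 * I * U' ^ 2 * Y * d.h + 2 * I
      ^ 2 * U' ^ 2 * Y * Z * d.b + 2 * U' * Z * d.b * hf) * hX + (U' * X' * Z ^ 2 * d.b + 2 * I
      * U' * X' * Z ^ 2 * Z' * d.h + U' * X' * Z ^ 2 * Z' ^ 2 * d.c) * hY + (-2 * U' * X' * Y *
      d.h * lam + 2 * U' * X' * Y * d.f + 2 * I * U' * X' ^ 2 * Y * Z * d.h + U' * X' ^ 2 * Y *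
      d.c + U' * X' ^ 2 * Y * Z * Z' * d.c + 2 * I * U' * X' * Z * d.h + U' * X' * d.c + U' * X'
      * Z * Z' * d.c) * hZ + (2 * U' ^ 2 * X ^ 2 * d.b + U' * X * d.b * lam ^ 2 + 2 * U' * d.h *
      lam - 4 * I ^ 2 * U' * X * d.b * lam ^ 2 - 4 * I * U' * Z * d.b * lam + 6 * I * U' ^ 2 * X
      ^ 2 * d.b * lam - 4 * I * U' * X * d.b * hf * lam + 2 * U' ^ 2 * X * Z * d.b - 2 * U' ^ 3
      * X ^ 3 * d.b + 2 * U' ^ 2 * X ^ 2 * d.b * hf - U' * Y * d.b * lam ^ 2 - 2 * U' * X' * Y *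
      d.h * lam + 2 * I * U' ^ 2 * X * Y * d.b * lam + 2 * U' ^ 2 * Y * Z * d.b - 2 * U' ^ 3 * X
      ^ 2 * Y * d.b + 2 * U' ^ 2 * X * Y * d.b * hf) * hI + (2 * I * U' * X * d.b * lam - 2 * U'
      ^ 2 * X ^ 2 * d.b - U' ^ 2 * X * Y * d.b + U' * Z * d.b + U' * X * d.b) * hh

/-- The summand `0 * S` is the derivative of a coefficient without z_k; it is written out so that
the bracket has the literal form required by `pot_total_mem`. -/
theorem symD_symStep' (hI : I * I = -1) (hh : 2 * hf = 1) (hX : X * X' = 1) (hY : Y * Y' = 1)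
    (hZ : Z * Z' = 1) (d dy : MonodromyData R) (S dS dJy : R) :
    symD I lam U' (symStep I hf lam w Y Y' (Z * Y') (Y * U') dy)
        (symDJ I hf lam w Y Y' U' (Z * Y') (Y * U') (X * U') dy)
      + (lam ^ 2 - w) * ((Y * U' - X * U') * d.b - Y * U' * (Z * X') * S)
      = -(X * U' * (Z * Y')) * (symD I lam Z' dy dJy + (lam ^ 2 - w) * S)
        + (X * U' * (Z * Y') * symJ I Z' dy + X * U' * (Z * Y') * dJy
          - X * U' * (Z * Y') * (Z * X' + Z * Y') * symJ I Z' dy)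
        + (lam ^ 2 - w) * ((Y * U' - X * U') * (d.b - dy.b - dS)
          + (0 * S + (Y * U' - X * U') * dS - (Y * U' - X * U') * (Z * X' + Z * Y') * S)) := by
  simp only [symD, symDJ, symStep, symJ]
  linear_combination
      (U' * Y' * Z ^ 2 * dy.b + 2 * I * U' * Y' * Z ^ 2 * Z' * dy.h + U' * Y' * Z ^ 2 * Z' ^ 2 *
      dy.c - S * U' * Z * lam ^ 2 + S * U' * Z * w) * hX + (-U' * Z * dy.b - 2 * I * U' * dy.h -
      4 * I * U' * Z * dy.b * lam - 2 * I ^ 2 * U' * dy.h * lam - 4 * I ^ 3 * U' * Z * dy.b *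
      lam - U' * Y' * Z ^ 2 * dy.b + 2 * U' ^ 2 * Y * Z * dy.b - 2 * I * U' * Y' * Z * dy.h + 2
      * I * U' ^ 2 * Y * dy.h - 2 * U' * dy.f - U' * Y' * dy.c + 2 * I ^ 2 * U' ^ 2 * Y * Z *
      dy.b + 2 * U' ^ 2 * X * Z * dy.b + 2 * I * U' ^ 2 * X * dy.h + 2 * I ^ 2 * U' ^ 2 * X * Z
      * dy.b + 2 * U' * Z * dy.b * hf + S * U' * Z * lam ^ 2 - S * U' * Z * w) * hY + (-2 * U' *
      X * Y' * dy.h * lam + 2 * U' * X * Y' * dy.f + 2 * I * U' * X * Y' ^ 2 * Z * dy.h + U' * X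
      * Y' ^ 2 * dy.c + U' * X * Y' ^ 2 * Z * Z' * dy.c + 2 * I * U' * Y' * Z * dy.h + U' * Y' *
      dy.c + U' * Y' * Z * Z' * dy.c) * hZ + (2 * U' ^ 2 * Y ^ 2 * dy.b + U' * Y * dy.b * lam ^
      2 + 2 * U' * dy.h * lam - 4 * I ^ 2 * U' * Y * dy.b * lam ^ 2 - 4 * I * U' * Z * dy.b *
      lam + 6 * I * U' ^ 2 * Y ^ 2 * dy.b * lam - 4 * I * U' * Y * dy.b * hf * lam + 2 * U' ^ 2
      * Y * Z * dy.b - 2 * U' ^ 3 * Y ^ 3 * dy.b + 2 * U' ^ 2 * Y ^ 2 * dy.b * hf - U' * X *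
      dy.b * lam ^ 2 - 2 * U' * X * Y' * dy.h * lam + 2 * I * U' ^ 2 * X * Y * dy.b * lam + 2 *
      U' ^ 2 * X * Z * dy.b - 2 * U' ^ 3 * X * Y ^ 2 * dy.b + 2 * U' ^ 2 * X * Y * dy.b * hf) *
      hI + (2 * I * U' * Y * dy.b * lam - 2 * U' ^ 2 * Y ^ 2 * dy.b - U' ^ 2 * X * Y * dy.b + U'
      * Z * dy.b + U' * Y * dy.b) * hh

theorem b_symStep_sub (hI : I * I = -1) (hX : X * X' = 1) (hY : Y * Y' = 1)
    (hZ : Z * Z' = 1) (d dy : MonodromyData R) (S dS dJ dJy : R) :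
    (symStep I hf lam w X X' (Z * X') (X * U') d).b - (symStep I hf lam w Y Y' (Z * Y') (Y * U') dy).b
      - (-(Y * U' - X * U') * d.b + Y * U' * (Z * X') * S
        + (-2 * I * lam + X * U' + Y * U') * ((Y * U' - X * U') * d.b - Y * U' * (Z * X') * S))
      = -(Z * X') * (symD I lam Z' d dJ - (lam ^ 2 - w) * S)
        + Z * Y' * (symD I lam Z' dy dJy + (lam ^ 2 - w) * S)
        + (Z * X' * symJ I Z' d + Z * X' * dJ - Z * X' * (Z * X' + Z * Y') * symJ I Z' d)
        - (Z * Y' * symJ I Z' dy + Z * Y' * dJy - Z * Y' * (Z * X' + Z * Y') * symJ I Z' dy)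
        + (lam ^ 2 - w) * (d.b - dy.b - dS) + (lam ^ 2 - w) * (dS - (Z * X' + Z * Y') * S)
        + Z * X' * (Z * Y') * (symJ I Z' d - symJ I Z' dy)
        + U' * (2 * I * (d.h - dy.h) + Z * (2 * dS + (1 + 2 * I * lam) * S))
        + (2 * (X * U') * (Z * X') + Y * U' + 2 * I * lam * (Y * U') - (Y * U') ^ 2)
          * (d.b - dy.b - dS)
        + (0 * S + (Y * U' + 2 * I * lam * (Y * U') - (Y * U') ^ 2) * dS
          - (Y * U' + 2 * I * lam * (Y * U') - (Y * U') ^ 2) * (Z * X' + Z * Y') * S) := by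
  simp only [symD, symStep, symJ]
  linear_combination
      (2 * I * U' * d.h + S * U' ^ 2 * Y * Z + 2 * U' * Z * dy.b + 2 * U' * Z * dS) * hX + (-2 *
      U' * Z * dy.b - 2 * I * U' * dy.h + S * U' * Z + 2 * I * S * U' * Z * lam - S * U' ^ 2 * Y
      * Z) * hY + (-2 * X' * d.h * lam + 2 * X' * d.f + 2 * Y' * dy.h * lam - 2 * Y' * dy.f + 2
      * I * X' ^ 2 * Z * d.h + X' ^ 2 * d.c + X' ^ 2 * Z * Z' * d.c - 2 * I * Y' ^ 2 * Z * dy.h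
      - Y' ^ 2 * dy.c - Y' ^ 2 * Z * Z' * dy.c) * hZ + (-d.b * lam ^ 2 - 2 * X' * d.h * lam +
      dy.b * lam ^ 2 + 2 * Y' * dy.h * lam) * hI

theorem symJ_symStep_sub (hI : I * I = -1) (hh : 2 * hf = 1) (hX : X * X' = 1) (hY : Y * Y' = 1)
    (hZ : Z * Z' = 1) (d dy : MonodromyData R) (S dS dJ dJy : R) :
    symJ I U' (symStep I hf lam w X X' (Z * X') (X * U') d)
        - symJ I U' (symStep I hf lam w Y Y' (Z * Y') (Y * U') dy)
      = -(Z * X') * (symD I lam Z' d dJ - (lam ^ 2 - w) * S)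
        + Z * Y' * (symD I lam Z' dy dJy + (lam ^ 2 - w) * S)
        + (Z * X' * symJ I Z' d + Z * X' * dJ - Z * X' * (Z * X' + Z * Y') * symJ I Z' d)
        - (Z * Y' * symJ I Z' dy + Z * Y' * dJy - Z * Y' * (Z * X' + Z * Y') * symJ I Z' dy)
        + (lam ^ 2 - w) * (d.b - dy.b - dS) + (lam ^ 2 - w) * (dS - (Z * X' + Z * Y') * S)
        + Z * X' * (Z * Y') * (symJ I Z' d - symJ I Z' dy) := by
  simp only [symD, symStep, symJ]
  linear_combination
      (2 * U' * Z * d.b + 2 * I * U' * d.h + 2 * I ^ 2 * U' * Z * d.b) * hX + (-2 * U' * Z *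
      dy.b - 2 * I * U' * dy.h - 2 * I ^ 2 * U' * Z * dy.b) * hY + (-2 * X' * d.h * lam + 2 * X'
      * d.f + 2 * Y' * dy.h * lam - 2 * Y' * dy.f + 2 * I * X' ^ 2 * Z * d.h + X' ^ 2 * d.c + X'
      ^ 2 * Z * Z' * d.c - 2 * I * Y' ^ 2 * Z * dy.h - Y' ^ 2 * dy.c - Y' ^ 2 * Z * Z' * dy.c) *
      hZ + (-d.b * lam ^ 2 - 2 * X' * d.h * lam + 2 * I * U' * X * d.b * lam + 2 * U' * Z * d.b
      - 2 * U' ^ 2 * X ^ 2 * d.b + 2 * U' * X * d.b * hf + dy.b * lam ^ 2 + 2 * Y' * dy.h * lam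
      - 2 * I * U' * Y * dy.b * lam - 2 * U' * Z * dy.b + 2 * U' ^ 2 * Y ^ 2 * dy.b - 2 * U' * Y
      * dy.b * hf) * hI + (-U' * X * d.b + U' * Y * dy.b) * hh

theorem h_symStep_sub (hI : I * I = -1) (hh : 2 * hf = 1) (hX : X * X' = 1) (hY : Y * Y' = 1)
    (hU : U * U' = 1) (d dy : MonodromyData R) (S dS : R) :
    2 * I * ((symStep I hf lam w X X' (Z * X') (X * U') d).h
        - (symStep I hf lam w Y Y' (Z * Y') (Y * U') dy).h)
      + U * (2 * (-(Y * U' - X * U') * d.b + Y * U' * (Z * X') * S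
        + (-2 * I * lam + X * U' + Y * U') * ((Y * U' - X * U') * d.b - Y * U' * (Z * X') * S))
        + (1 + 2 * I * lam) * ((Y * U' - X * U') * d.b - Y * U' * (Z * X') * S))
      = -(2 * I * (d.h - dy.h) + Z * (2 * dS + (1 + 2 * I * lam) * S))
        - 2 * Z * (d.b - dy.b - dS) - Y * (2 * I * lam + 1 - 2 * (Y * U')) * (d.b - dy.b - dS)
        - (0 * S + Y * (2 * I * lam + 1 - 2 * (Y * U')) * dS
          - Y * (2 * I * lam + 1 - 2 * (Y * U')) * (Z * X' + Z * Y') * S) := by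
  simp only [symStep]
  linear_combination
      (2 * I ^ 2 * Z * d.b - 2 * S * U * U' ^ 2 * Y * Z) * hX + (-2 * I ^ 2 * Z * dy.b - 2 * I *
      S * Z * lam - S * Z + 2 * S * U' * Y * Z) * hY + (-Y * d.b + X * d.b + S * X' * Y * Z - 2
      * I * Y * d.b * lam + 2 * I * X * d.b * lam + 2 * I * S * X' * Y * Z * lam - 2 * U' * X ^
      2 * d.b - 2 * S * U' * Y * Z + 2 * U' * Y ^ 2 * d.b - 2 * S * U' * X' * Y ^ 2 * Z) * hU +
      (2 * I * X * d.b * lam + 2 * Z * d.b - 2 * U' * X ^ 2 * d.b + 2 * X * d.b * hf - 2 * I * Y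
      * dy.b * lam - 2 * Z * dy.b + 2 * U' * Y ^ 2 * dy.b - 2 * Y * dy.b * hf) * hI + (-X * d.b
      + Y * dy.b) * hh

/-- The closing identity: the last particle has no coupling to a following z, so r = 0 and the only
coupling of z_n is Z X'. The data `dy` enter without a further step. -/
theorem b_symStep_last (hI : I * I = -1) (hZ : Z * Z' = 1) (d dy : MonodromyData R)
    (S dS dJ : R) :
    (symStep I hf lam w X X' (Z * X') 0 d).b - (lam ^ 2 - w) * dy.b
      = (lam ^ 2 - w) * (d.b - dy.b - dS)
        + (lam ^ 2 - w) * (dS - Z * X' * S)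
        - Z * X' * (symD I lam Z' d dJ - (lam ^ 2 - w) * S)
        + (Z * X' * symJ I Z' d + Z * X' * dJ - Z * X' * (Z * X') * symJ I Z' d) := by
  simp only [symD, symStep, symJ]
  linear_combination
      (-2 * X' * d.h * lam + 2 * X' * d.f + 2 * I * X' ^ 2 * Z * d.h + X' ^ 2 * d.c + X' ^ 2 * Z
      * Z' * d.c) * hZ + (-d.b * lam ^ 2 - 2 * X' * d.h * lam) * hI

end identities

end BCToda

namespace BCToda

/-! ### Symbols, their derivations, and total derivatives. -/

/-- Names of variables: `(0, j)` is `x_j`, `(1, j)` is `y_j`, `(2, j)` is `z_j`. -/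
abbrev Var := Fin 3 × ℕ

/-- Laurent polynomials in the exponentials of the variables `x_j, y_j, z_j`. -/
def Sym : Type := AddMonoidAlgebra ℂ (Var →₀ ℤ)

instance : CommRing Sym := inferInstanceAs (CommRing (AddMonoidAlgebra ℂ (Var →₀ ℤ)))

instance : Algebra ℂ Sym := inferInstanceAs (Algebra ℂ (AddMonoidAlgebra ℂ (Var →₀ ℤ)))

namespace Sym

/-- The exponential of an integral linear form. -/
def mono (m : Var →₀ ℤ) : Sym := AddMonoidAlgebra.single m 1

theorem mono_zero : mono 0 = 1 := rfl

theorem mono_add (m m' : Var →₀ ℤ) : mono (m + m') = mono m * mono m' := by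
  have := AddMonoidAlgebra.single_mul_single (R := ℂ) m m' 1 1
  rw [one_mul] at this
  exact this.symm

theorem induction {motive : Sym → Prop} (P : Sym) (zero : motive 0)
    (add : ∀ P Q, motive P → motive Q → motive (P + Q))
    (smul_mono : ∀ (c : ℂ) m, motive (c • mono m)) : motive P := by
  refine AddMonoidAlgebra.induction_linear P zero add fun m r => ?_
  have h : (AddMonoidAlgebra.single m r : AddMonoidAlgebra ℂ (Var →₀ ℤ))
      = r • AddMonoidAlgebra.single m 1 := by
    rw [AddMonoidAlgebra.smul_single, smul_eq_mul, mul_one]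
  rw [h]
  exact smul_mono r m

/-- The partial derivative, as a linear map. -/
def derivLin (i : Var) : Sym →ₗ[ℂ] Sym :=
  (AddMonoidAlgebra.coeffLinearEquiv ℂ).symm.toLinearMap ∘ₗ
    Finsupp.lsum ℂ (fun m : Var →₀ ℤ => ((m i : ℤ) : ℂ) • Finsupp.lsingle m) ∘ₗ
      (AddMonoidAlgebra.coeffLinearEquiv (S := ℂ) (M := Var →₀ ℤ) ℂ).toLinearMap

theorem derivLin_mono (i : Var) (m : Var →₀ ℤ) : derivLin i (mono m) = (m i : ℂ) • mono m := by
  change AddMonoidAlgebra.ofCoeff (Finsupp.lsum ℂ (fun m : Var →₀ ℤ => ((m i : ℤ) : ℂ) •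
    (Finsupp.lsingle m : ℂ →ₗ[ℂ] _)) (Finsupp.single m 1)) = _
  rw [Finsupp.lsum_single]
  rfl

/-- The partial derivative with respect to a variable. -/
def D (i : Var) : Derivation ℂ Sym Sym :=
  Derivation.mk' (derivLin i) fun P Q => by
    induction P using induction with
    | zero => simp
    | add P P' h h' => rw [add_mul, map_add, h, h', map_add]; simp only [smul_eq_mul]; ring
    | smul_mono c m =>
      induction Q using induction with
      | zero => simp
      | add Q Q' h h' => rw [mul_add, map_add, h, h', map_add]; simp only [smul_eq_mul]; ring
      | smul_mono c' m' =>
        rw [smul_mul_smul_comm, ← mono_add]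
        simp only [map_smul, derivLin_mono, smul_eq_mul, smul_mul_assoc, mul_smul_comm, smul_smul,
          ← mono_add, Finsupp.add_apply, Int.cast_add, add_comm m' m, ← add_smul]
        congr 1
        ring

theorem D_mono (i : Var) (m : Var →₀ ℤ) : D i (mono m) = (m i : ℂ) • mono m := derivLin_mono i m

/-- The value at a point. -/
def ev (v : Var → ℝ) : Sym →ₐ[ℂ] ℂ :=
  AddMonoidAlgebra.lift ℂ ℂ (Var →₀ ℤ)
    { toFun := fun m => (Real.exp (m.toAdd.sum fun i a => a * v i) : ℂ)
      map_one' := by simp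
      map_mul' := fun m m' => by
        rw [toAdd_mul, Finsupp.sum_add_index' (by simp) (by intros; push_cast; ring), Real.exp_add,
          Complex.ofReal_mul] }

theorem ev_mono (v : Var → ℝ) (m : Var →₀ ℤ) :
    ev v (mono m) = (Real.exp (m.sum fun i a => a * v i) : ℂ) := by
  refine (AddMonoidAlgebra.lift_single (R := ℂ) _ m 1).trans ?_
  rw [one_smul]
  rfl

/-- The exponential `e^{ε v_i}` of a single variable. -/
def gen (i : Var) (ε : ℤ) : Sym := mono (Finsupp.single i ε)

theorem gen_mul_gen_neg (i : Var) : gen i 1 * gen i (-1) = 1 := by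
  rw [gen, gen, ← mono_add, ← Finsupp.single_add]
  simp [mono_zero]

theorem D_gen (i j : Var) (ε : ℤ) : D i (gen j ε) = if j = i then (ε : ℂ) • gen j ε else 0 := by
  rw [gen, D_mono, Finsupp.single_apply]
  split_ifs <;> simp

theorem ev_gen (v : Var → ℝ) (i : Var) (ε : ℤ) : ev v (gen i ε) = (Real.exp (ε * v i) : ℂ) := by
  rw [gen, ev_mono, Finsupp.sum_single_index (by simp)]

/-- Scalars. -/
abbrev sc : ℂ → Sym := algebraMap ℂ Sym

/-- The coupling `e^{z_k - x_k}` (`a = 0`) or `e^{z_k - y_k}` (`a = 1`). -/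
def up (a : Fin 3) (k : ℕ) : Sym := gen (2, k) 1 * gen (a, k) (-1)

/-- The coupling `e^{x_k - z_{k+1}}` (`a = 0`) or `e^{y_k - z_{k+1}}` (`a = 1`). -/
def dn (a : Fin 3) (k : ℕ) : Sym := gen (a, k) 1 * gen (2, k + 1) (-1)

/-- The symbols of the monodromy data of the `x`-particles (`a = 0`) or `y`-particles (`a = 1`). -/
def data (α β : ℝ) (lam w : ℂ) (a : Fin 3) : ℕ → MonodromyData Sym
  | 0 => ⟨1, -sc α, 0, -sc β ^ 2⟩
  | k + 1 => symStep (sc Complex.I) (sc (1 / 2)) (sc lam) (sc w) (gen (a, k) 1) (gen (a, k) (-1))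
      (up a k) (dn a k) (data α β lam w a k)

/-- The potential whose total derivative is the difference of the `x`- and `y`-symbols. -/
def pot (α β : ℝ) (lam w : ℂ) : ℕ → Sym
  | 0 => 0
  | k + 1 => (dn 1 k - dn 0 k) * (data α β lam w 0 k).b - dn 1 k * up 0 k * pot α β lam w k

/-- The boundary factor `1 - β² e^{-2 z_0}`. -/
def bdry (β : ℝ) : Sym := 1 - sc β ^ 2 * gen (2, 0) (-1) ^ 2

/-- The derivative of the boundary factor times the boundary part of the kernel. -/
def dBdry (α β : ℝ) (lam : ℂ) : Sym :=
  -2 * sc Complex.I * sc lam + 2 * sc α * gen (2, 0) (-1) + sc β ^ 2 * gen (2, 0) (-1) ^ 2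

/-- The logarithmic derivative in `z_{j+1}` of the part of the kernel that involves
`z_0, …, z_{j+1}` and the first `j + 1` particles. -/
def logD (lam : ℂ) (j : ℕ) : Sym := -2 * sc Complex.I * sc lam + dn 0 j + dn 1 j

/-- The total derivative with respect to `z_j` of a symbol times the kernel, where `c` is the
sum of the couplings `e^{z_j - ·}`. For `j = 0` the symbol is multiplied by the boundary factor. -/
def zTotal (α β : ℝ) (lam : ℂ) : ℕ → Sym → Sym → Sym
  | 0, c, P => D (2, 0) P * bdry β + P * dBdry α β lam - P * c * bdry β
  | j + 1, c, P => D (2, j + 1) P + logD lam j * P - P * c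

/-- The span of the total derivatives with respect to `z_0, …, z_{k-1}`. -/
def totals (α β : ℝ) (lam : ℂ) (k : ℕ) : Submodule ℂ Sym :=
  Submodule.span ℂ {Q | ∃ j < k, ∃ P, Q = zTotal α β lam j (up 0 j + up 1 j) P}

section

variable {α β : ℝ} {lam w : ℂ}

theorem totals_mono {k l : ℕ} (h : k ≤ l) : totals α β lam k ≤ totals α β lam l :=
  Submodule.span_mono fun _ ⟨j, hj, P, hP⟩ => ⟨j, hj.trans_le h, P, hP⟩

theorem zTotal_mem (k : ℕ) (P : Sym) :
    zTotal α β lam k (up 0 k + up 1 k) P ∈ totals α β lam (k + 1) :=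
  Submodule.subset_span ⟨k, k.lt_succ_self, P, rfl⟩

theorem mul_zTotal {j : ℕ} {g : Sym} (hg : D (2, j) g = 0) (c P : Sym) :
    g * zTotal α β lam j c P = zTotal α β lam j c (g * P) := by
  cases j <;> simp only [zTotal, Derivation.leibniz, hg, smul_eq_mul] <;> ring

/-- A factor that does not depend on z_j passes inside the total z_j-derivative. This lets earlier
relations be multiplied by the couplings of the new particle. -/
theorem mul_mem_totals {k : ℕ} {g Q : Sym} (hg : ∀ j < k, D (2, j) g = 0)
    (hQ : Q ∈ totals α β lam k) : g * Q ∈ totals α β lam k := by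
  induction hQ using Submodule.span_induction with
  | mem Q hQ =>
    obtain ⟨j, hj, P, rfl⟩ := hQ
    rw [mul_zTotal (hg j hj)]
    exact Submodule.subset_span ⟨j, hj, _, rfl⟩
  | zero => simp
  | add P Q _ _ hP hQ => rw [mul_add]; exact add_mem hP hQ
  | smul c Q _ hQ => rw [mul_smul_comm]; exact Submodule.smul_mem _ _ hQ

theorem D_sc (i : Var) (c : ℂ) : D i (sc c) = 0 := (D i).map_algebraMap c

theorem D_two (i : Var) : D i (2 : Sym) = 0 := (D i).map_natCast 2

theorem D_gen_of_ne {i j : Var} (h : j ≠ i) (ε : ℤ) : D i (gen j ε) = 0 := by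
  rw [D_gen, if_neg h]

/-- The data of step k involve, among the variables of index at least k, only z_k. -/
theorem D_data {i : Var} (a : Fin 3) {k : ℕ} (h : k ≤ i.2) (h' : i ≠ (2, k)) :
    D i (data α β lam w a k).b = 0 ∧ D i (data α β lam w a k).f = 0
      ∧ D i (data α β lam w a k).h = 0 ∧ D i (data α β lam w a k).c = 0 := by
  induction k with
  | zero => simp [data]
  | succ k ih =>
    obtain ⟨h1, h2, h3, h4⟩ := ih (by omega) (by rintro rfl; simp at h)
    have g1 : (2, k) ≠ i := by rintro rfl; simp at h
    have g2 : (a, k) ≠ i := by rintro rfl; simp at h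
    simp only [data, symStep, up, dn, map_add, map_sub, map_neg, Derivation.leibniz,
      Derivation.leibniz_pow, D_sc, D_two, D_gen_of_ne g1, D_gen_of_ne g2, D_gen_of_ne h'.symm,
      h1, h2, h3, h4, smul_zero, add_zero, neg_zero, sub_zero, and_self]

theorem D_pot {i : Var} {k : ℕ} (h : k ≤ i.2) (h' : i ≠ (2, k)) :
    D i (pot α β lam w k) = 0 := by
  induction k with
  | zero => simp [pot]
  | succ k ih =>
    have h1 := ih (by omega) (by rintro rfl; simp at h)
    have h2 := (D_data (α := α) (β := β) (lam := lam) (w := w) 0 (i := i) (k := k) (by omega)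
      (by rintro rfl; simp at h)).1
    have g1 : (2, k) ≠ i := by rintro rfl; simp at h
    have g2 (a : Fin 3) : (a, k) ≠ i := by rintro rfl; simp at h
    simp only [pot, up, dn, map_sub, Derivation.leibniz,
      D_gen_of_ne g1, D_gen_of_ne (g2 _), D_gen_of_ne h'.symm,
      h1, h2, smul_zero, add_zero, sub_zero]

/-- The total `z_k`-derivative of `symJ`. -/
def dJ (α β : ℝ) (lam w : ℂ) (a : Fin 3) : ℕ → Sym
  | 0 => dBdry α β lam
  | k + 1 => D (2, k + 1) (symJ (sc Complex.I) (gen (2, k + 1) (-1)) (data α β lam w a (k + 1)))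
      + logD lam k * symJ (sc Complex.I) (gen (2, k + 1) (-1)) (data α β lam w a (k + 1))

/-- The total `z_k`-derivative of the potential. -/
def dPot (α β : ℝ) (lam w : ℂ) : ℕ → Sym
  | 0 => 0
  | k + 1 => D (2, k + 1) (pot α β lam w (k + 1)) + logD lam k * pot α β lam w (k + 1)

/-- The combination `symJ` is the one that may be multiplied by any G and integrated by parts in
z_k, including at the singular variable z₀. -/
theorem exists_zTotal_symJ (a : Fin 3) (k : ℕ) (c G : Sym) : ∃ P,
    D (2, k) G * symJ (sc Complex.I) (gen (2, k) (-1)) (data α β lam w a k)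
      + G * dJ α β lam w a k - G * c * symJ (sc Complex.I) (gen (2, k) (-1)) (data α β lam w a k)
      = zTotal α β lam k c P := by
  cases k with
  | zero =>
    -- At k = 0, `symJ` is itself the boundary factor, which `zTotal` already contains.
    refine ⟨G, ?_⟩
    have : symJ (sc Complex.I) (gen (2, 0) (-1)) (data α β lam w a 0) = bdry β := by
      simp only [symJ, data, bdry]
      ring
    rw [this]
    rfl
  | succ k =>
    refine ⟨G * symJ (sc Complex.I) (gen (2, k + 1) (-1)) (data α β lam w a (k + 1)), ?_⟩
    simp only [zTotal, dJ, Derivation.leibniz, smul_eq_mul]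
    ring

theorem exists_zTotal_pot (k : ℕ) (c G : Sym) : ∃ P,
    D (2, k) G * pot α β lam w k + G * dPot α β lam w k - G * c * pot α β lam w k
      = zTotal α β lam k c P := by
  cases k with
  | zero => exact ⟨0, by simp [pot, dPot, zTotal]⟩
  | succ k =>
    refine ⟨G * pot α β lam w (k + 1), ?_⟩
    simp only [zTotal, dPot, Derivation.leibniz, smul_eq_mul]
    ring

theorem sc_I_mul_I : sc Complex.I * sc Complex.I = -1 := by
  rw [← map_mul, Complex.I_mul_I, map_neg, map_one]

theorem two_mul_sc_half : 2 * sc (1 / 2) = 1 := by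
  have : (2 : Sym) = sc 2 := (map_ofNat _ 2).symm
  rw [this, ← map_mul]
  norm_num

/-- Only the explicit dependence on z_{k+1} of the last step is differentiated; the result has the
form used in the polynomial identities. The index a' is the other species, whose coupling also
contributes to `logD`. -/
theorem dJ_succ (a a' : Fin 3) (h : a = 0 ∧ a' = 1 ∨ a = 1 ∧ a' = 0) (k : ℕ) :
    dJ α β lam w a (k + 1) = symDJ (sc Complex.I) (sc (1 / 2)) (sc lam) (sc w)
      (gen (a, k) 1) (gen (a, k) (-1)) (gen (2, k + 1) (-1)) (up a k) (dn a k) (dn a' k)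
      (data α β lam w a k) := by
  obtain ⟨h1, h2, h3, h4⟩ := D_data (α := α) (β := β) (lam := lam) (w := w) a (i := (2, k + 1))
    (k := k) (by simp) (by simp)
  have g1 : ((2, k) : Var) ≠ (2, k + 1) := by simp
  have g2 : ((a, k) : Var) ≠ (2, k + 1) := by simp
  have g3 : D (2, k + 1) (gen (2, k + 1) (-1)) = -gen (2, k + 1) (-1) := by simp [D_gen]
  have hl : logD lam k = -2 * sc Complex.I * sc lam + dn a k + dn a' k := by
    rcases h with ⟨rfl, rfl⟩ | ⟨rfl, rfl⟩
    · rfl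
    · rw [logD]; ring
  rw [dJ, symDJ, hl, data]
  congr 1
  simp only [symJ, symStep, up, dn, map_add, map_sub, map_neg, Derivation.leibniz, pow_two,
      D_sc, D_two, D_gen_of_ne g1, D_gen_of_ne g2, g3,
      h1, h2, h3, h4, smul_eq_mul]
  ring

theorem dPot_succ (k : ℕ) :
    dPot α β lam w (k + 1) = -(dn 1 k - dn 0 k) * (data α β lam w 0 k).b
      + dn 1 k * up 0 k * pot α β lam w k
      + (-2 * sc Complex.I * sc lam + dn 0 k + dn 1 k)
        * ((dn 1 k - dn 0 k) * (data α β lam w 0 k).b - dn 1 k * up 0 k * pot α β lam w k) := by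
  have h1 := (D_data (α := α) (β := β) (lam := lam) (w := w) 0 (i := (2, k + 1))
    (k := k) (by simp) (by simp)).1
  have h2 := D_pot (α := α) (β := β) (lam := lam) (w := w) (i := (2, k + 1))
    (k := k) (by simp) (by simp)
  have g1 : ((2, k) : Var) ≠ (2, k + 1) := by simp
  have g2 (a : Fin 3) : ((a, k) : Var) ≠ (2, k + 1) := by simp
  have g3 : D (2, k + 1) (gen (2, k + 1) (-1)) = -gen (2, k + 1) (-1) := by simp [D_gen]
  rw [dPot, logD, pot]
  congr 1
  simp only [up, dn, map_sub, Derivation.leibniz, D_gen_of_ne g1, D_gen_of_ne (g2 _), g3,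
    h1, h2, smul_eq_mul]
  ring

end

end Sym

end BCToda

namespace BCToda

namespace Sym

/-! ### The five relations modulo total derivatives. -/

section

variable {α β : ℝ} {lam w : ℂ}

/-- The relations between the symbols of the `x`- and `y`-particles, modulo total derivatives with
respect to `z_0, …, z_{k-1}`. -/
structure Relations (α β : ℝ) (lam w : ℂ) (k : ℕ) : Prop where
  dx : symD (sc Complex.I) (sc lam) (gen (2, k) (-1)) (data α β lam w 0 k) (dJ α β lam w 0 k)
    - (sc lam ^ 2 - sc w) * pot α β lam w k ∈ totals α β lam k
  dy : symD (sc Complex.I) (sc lam) (gen (2, k) (-1)) (data α β lam w 1 k) (dJ α β lam w 1 k)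
    + (sc lam ^ 2 - sc w) * pot α β lam w k ∈ totals α β lam k
  b : (data α β lam w 0 k).b - (data α β lam w 1 k).b - dPot α β lam w k ∈ totals α β lam k
  j : symJ (sc Complex.I) (gen (2, k) (-1)) (data α β lam w 0 k)
    - symJ (sc Complex.I) (gen (2, k) (-1)) (data α β lam w 1 k) ∈ totals α β lam k
  h : 2 * sc Complex.I * ((data α β lam w 0 k).h - (data α β lam w 1 k).h)
    + gen (2, k) 1 * (2 * dPot α β lam w k + (1 + 2 * sc Complex.I * sc lam) * pot α β lam w k)
      ∈ totals α β lam k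

/-- The symbols that do not depend on the first `k` variables of the kind `a`. -/
def indep (a : Fin 3) (k : ℕ) : Subalgebra ℂ Sym where
  carrier := {g | ∀ j < k, D (a, j) g = 0}
  mul_mem' := fun ha hb j hj => by simp [Derivation.leibniz, ha j hj, hb j hj]
  add_mem' := fun ha hb j hj => by simp [ha j hj, hb j hj]
  algebraMap_mem' := fun c j _ => D_sc _ c

theorem gen_mem_indep {a : Fin 3} {k : ℕ} {i : Var} (h : i.1 = a → k ≤ i.2) (ε : ℤ) :
    gen i ε ∈ indep a k :=
  fun j hj => D_gen_of_ne (by rintro rfl; exact absurd (h rfl) (by simpa using hj)) ε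

theorem sc_mem_indep (a : Fin 3) (k : ℕ) (c : ℂ) : sc c ∈ indep a k := (indep a k).algebraMap_mem c

theorem gen_z_mem_indep (k : ℕ) (ε : ℤ) : gen (2, k) ε ∈ indep 2 k :=
  gen_mem_indep (i := (2, k)) (fun _ => le_rfl) ε

theorem gen_z_succ_mem_indep (k : ℕ) (ε : ℤ) : gen (2, k + 1) ε ∈ indep 2 k :=
  gen_mem_indep (fun _ => Nat.le_succ k) ε

theorem gen_x_mem_indep (k j : ℕ) (ε : ℤ) : gen (0, j) ε ∈ indep 2 k := gen_mem_indep (by simp) ε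

theorem gen_y_mem_indep (k j : ℕ) (ε : ℤ) : gen (1, j) ε ∈ indep 2 k := gen_mem_indep (by simp) ε

theorem up_x_mem_indep (k : ℕ) : up 0 k ∈ indep 2 k :=
  mul_mem (gen_z_mem_indep k 1) (gen_x_mem_indep k k (-1))

theorem up_y_mem_indep (k : ℕ) : up 1 k ∈ indep 2 k :=
  mul_mem (gen_z_mem_indep k 1) (gen_y_mem_indep k k (-1))

theorem dn_x_mem_indep (k : ℕ) : dn 0 k ∈ indep 2 k :=
  mul_mem (gen_x_mem_indep k k 1) (gen_z_succ_mem_indep k (-1))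

theorem dn_y_mem_indep (k : ℕ) : dn 1 k ∈ indep 2 k :=
  mul_mem (gen_y_mem_indep k k 1) (gen_z_succ_mem_indep k (-1))

theorem ofNat_mem_indep (k m : ℕ) : (m : Sym) ∈ indep 2 k := natCast_mem _ m

theorem totals_of_mul {k : ℕ} {g Q : Sym} (hg : g ∈ indep 2 k) (hQ : Q ∈ totals α β lam k) :
    g * Q ∈ totals α β lam (k + 1) :=
  totals_mono k.le_succ (mul_mem_totals hg hQ)

theorem D_gen_z (k : ℕ) : D (2, k) (gen (2, k) 1) = gen (2, k) 1 := by simp [D_gen]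

theorem D_gen_x (k j : ℕ) (ε : ℤ) : D (2, k) (gen (0, j) ε) = 0 := D_gen_of_ne (by simp) ε

theorem D_gen_y (k j : ℕ) (ε : ℤ) : D (2, k) (gen (1, j) ε) = 0 := D_gen_of_ne (by simp) ε

theorem D_gen_z_succ (k : ℕ) (ε : ℤ) : D (2, k) (gen (2, k + 1) ε) = 0 := D_gen_of_ne (by simp) ε

theorem symJ_total_mem {k : ℕ} (a : Fin 3) {G G' : Sym} (h : D (2, k) G = G') :
    G' * symJ (sc Complex.I) (gen (2, k) (-1)) (data α β lam w a k) + G * dJ α β lam w a k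
      - G * (up 0 k + up 1 k) * symJ (sc Complex.I) (gen (2, k) (-1)) (data α β lam w a k)
      ∈ totals α β lam (k + 1) := by
  obtain ⟨P, hP⟩ := exists_zTotal_symJ (α := α) (β := β) (lam := lam) (w := w) a k
    (up 0 k + up 1 k) G
  rw [← h, hP]
  exact zTotal_mem k P

theorem pot_total_mem {k : ℕ} {G G' : Sym} (h : D (2, k) G = G') :
    G' * pot α β lam w k + G * dPot α β lam w k - G * (up 0 k + up 1 k) * pot α β lam w k
      ∈ totals α β lam (k + 1) := by
  obtain ⟨P, hP⟩ := exists_zTotal_pot (α := α) (β := β) (lam := lam) (w := w) k (up 0 k + up 1 k) G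
  rw [← h, hP]
  exact zTotal_mem k P

/-- No relation propagates alone: the step for `b` uses those for `dx`, `dy`, `b`, `j` and `h`. The
polynomial identities exhibit each new relation through old ones times symbols free of z_0, …,
z_{k-1}, plus total z_k-derivatives. -/
theorem relations (k : ℕ) : Relations α β lam w k := by
  induction k with
  | zero =>
    refine ⟨?_, ?_, ?_, ?_, ?_⟩
    -- At k = 0 all five combinations vanish identically; for the first two, `dBdry` exactly cancels
    -- the contributions of the boundary data.
    all_goals
      convert Submodule.zero_mem _ using 1
      simp only [symD, symJ, data, dJ, dBdry, pot, dPot]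
      ring
  | succ k ih =>
    obtain ⟨hdx, hdy, hb, hj, hh⟩ := ih
    have m (g Q : Sym) (hg : g ∈ indep 2 k) (hQ : Q ∈ totals α β lam k) :=
      totals_of_mul hg hQ
    have hI := sc_I_mul_I
    have hhf := two_mul_sc_half
    have hX := gen_mul_gen_neg (0, k)
    have hY := gen_mul_gen_neg (1, k)
    have hZ := gen_mul_gen_neg (2, k)
    have hU := gen_mul_gen_neg (2, k + 1)
    have ft := up_x_mem_indep k
    have fs := up_y_mem_indep k
    have fr := dn_x_mem_indep k
    have fq := dn_y_mem_indep k
    have f2 : (2 : Sym) ∈ indep 2 k := ofNat_mem_indep k 2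
    have fI : sc Complex.I ∈ indep 2 k := sc_mem_indep 2 k _
    have fl : sc lam ∈ indep 2 k := sc_mem_indep 2 k _
    have fw : sc lam ^ 2 - sc w ∈ indep 2 k := sub_mem (pow_mem fl 2) (sc_mem_indep 2 k _)
    have fZ := gen_z_mem_indep k 1
    have fU := gen_z_succ_mem_indep k (-1)
    have fY := gen_y_mem_indep k k 1
    have fq2 : 2 * dn 0 k * up 0 k + dn 1 k + 2 * sc Complex.I * sc lam * dn 1 k - dn 1 k ^ 2
        ∈ indep 2 k :=
      sub_mem (add_mem (add_mem (mul_mem (mul_mem f2 fr) ft) fq)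
        (mul_mem (mul_mem (mul_mem f2 fI) fl) fq)) (pow_mem fq 2)
    have fk : gen (1, k) 1 * (2 * sc Complex.I * sc lam + 1 - 2 * dn 1 k) ∈ indep 2 k :=
      mul_mem fY (sub_mem (add_mem (mul_mem (mul_mem f2 fI) fl) (one_mem _)) (mul_mem f2 fq))
    have dt : D (2, k) (up 0 k) = up 0 k := by
      simp [up, Derivation.leibniz, D_gen_z, D_gen_x, mul_comm]
    have ds : D (2, k) (up 1 k) = up 1 k := by
      simp [up, Derivation.leibniz, D_gen_z, D_gen_y, mul_comm]
    have dr : D (2, k) (dn 0 k) = 0 := by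
      simp [dn, Derivation.leibniz, D_gen_z_succ, D_gen_x]
    have dq : D (2, k) (dn 1 k) = 0 := by
      simp [dn, Derivation.leibniz, D_gen_z_succ, D_gen_y]
    have ex := dJ_succ (α := α) (β := β) (lam := lam) (w := w) 0 1 (Or.inl ⟨rfl, rfl⟩) k
    have ey := dJ_succ (α := α) (β := β) (lam := lam) (w := w) 1 0 (Or.inr ⟨rfl, rfl⟩) k
    have ep := dPot_succ (α := α) (β := β) (lam := lam) (w := w) k
    have Jx := symJ_total_mem (α := α) (β := β) (lam := lam) (w := w) (k := k) 0 dt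
    have Jy := symJ_total_mem (α := α) (β := β) (lam := lam) (w := w) (k := k) 1 ds
    -- The coefficient G = 1: the total z_k-derivative of the potential itself.
    have P1 := pot_total_mem (α := α) (β := β) (lam := lam) (w := w) (k := k) (D (2, k)).map_one_eq_zero
    -- A constant may also multiply total derivatives in the new variable z_k.
    have fm : sc lam ^ 2 - sc w ∈ indep 2 (k + 1) := sub_mem (pow_mem (sc_mem_indep 2 _ _) 2) (sc_mem_indep 2 _ _)
    -- This expression is the whole right-hand side of the identity for `symJ` and the first part of
    -- the one for `b`.
    have common : -(up 0 k) * (symD (sc Complex.I) (sc lam) (gen (2, k) (-1)) (data α β lam w 0 k)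
          (dJ α β lam w 0 k) - (sc lam ^ 2 - sc w) * pot α β lam w k)
        + up 1 k * (symD (sc Complex.I) (sc lam) (gen (2, k) (-1)) (data α β lam w 1 k)
          (dJ α β lam w 1 k) + (sc lam ^ 2 - sc w) * pot α β lam w k) 
        + (up 0 k * symJ (sc Complex.I) (gen (2, k) (-1)) (data α β lam w 0 k)
          + up 0 k * dJ α β lam w 0 k
          - up 0 k * (up 0 k + up 1 k) * symJ (sc Complex.I) (gen (2, k) (-1)) (data α β lam w 0 k))
        - (up 1 k * symJ (sc Complex.I) (gen (2, k) (-1)) (data α β lam w 1 k)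
          + up 1 k * dJ α β lam w 1 k
          - up 1 k * (up 0 k + up 1 k) * symJ (sc Complex.I) (gen (2, k) (-1)) (data α β lam w 1 k))
        + (sc lam ^ 2 - sc w) * ((data α β lam w 0 k).b - (data α β lam w 1 k).b - dPot α β lam w k)
        + (sc lam ^ 2 - sc w) * (dPot α β lam w k - (up 0 k + up 1 k) * pot α β lam w k)
        + up 0 k * up 1 k * (symJ (sc Complex.I) (gen (2, k) (-1)) (data α β lam w 0 k)
          - symJ (sc Complex.I) (gen (2, k) (-1)) (data α β lam w 1 k))
        ∈ totals α β lam (k + 1) := by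
      refine add_mem (add_mem (add_mem (sub_mem (add_mem (add_mem (m _ _ (neg_mem ft) hdx)
        (m _ _ fs hdy)) Jx) Jy) (m _ _ fw hb)) (mul_mem_totals fm ?_)) (m _ _ (mul_mem ft fs) hj)
      simpa using P1
    refine ⟨?_, ?_, ?_, ?_, ?_⟩
    · have key := symD_symStep (lam := sc lam) (w := sc w) (U' := gen (2, k + 1) (-1)) hI hhf hX hY hZ
        (data α β lam w 0 k) (pot α β lam w k) (dJ α β lam w 0 k)
      have hG : D (2, k) (dn 1 k * up 0 k) = dn 1 k * up 0 k := by
        simp [Derivation.leibniz, dt, dq]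
      rw [ex]
      refine (congrArg (· ∈ totals α β lam (k + 1)) key).mpr ?_
      exact add_mem (m _ _ (neg_mem (mul_mem fq ft)) hdx) (symJ_total_mem 0 hG)
    · have key := symD_symStep' (lam := sc lam) (w := sc w) (U' := gen (2, k + 1) (-1)) hI hhf hX hY hZ
        (data α β lam w 0 k) (data α β lam w 1 k) (pot α β lam w k) (dPot α β lam w k)
        (dJ α β lam w 1 k)
      have hG : D (2, k) (dn 0 k * up 1 k) = dn 0 k * up 1 k := by
        simp [Derivation.leibniz, ds, dr]
      have hG' : D (2, k) (dn 1 k - dn 0 k) = 0 := by simp [dr, dq]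
      rw [ey]
      refine (congrArg (· ∈ totals α β lam (k + 1)) key).mpr ?_
      exact add_mem (add_mem (m _ _ (neg_mem (mul_mem fr fs)) hdy) (symJ_total_mem 1 hG))
        (mul_mem_totals fm (add_mem (m _ _ (sub_mem fq fr) hb) (pot_total_mem hG')))
    · have key := b_symStep_sub (hf := sc (1 / 2)) (lam := sc lam) (w := sc w)
        (U' := gen (2, k + 1) (-1)) hI hX hY hZ (data α β lam w 0 k) (data α β lam w 1 k)
        (pot α β lam w k) (dPot α β lam w k) (dJ α β lam w 0 k) (dJ α β lam w 1 k)
      have hG : D (2, k) (dn 1 k + 2 * sc Complex.I * sc lam * dn 1 k - dn 1 k ^ 2) = 0 := by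
        simp only [map_add, map_sub, Derivation.leibniz, Derivation.leibniz_pow, dq, D_sc, D_two,
          smul_zero, add_zero, sub_zero]
      rw [ep]
      refine (congrArg (· ∈ totals α β lam (k + 1)) key).mpr ?_
      exact add_mem (add_mem (add_mem common (m _ _ fU hh)) (m _ _ fq2 hb)) (pot_total_mem hG)
    · have key := symJ_symStep_sub (lam := sc lam) (w := sc w) (U' := gen (2, k + 1) (-1)) hI hhf hX
        hY hZ (data α β lam w 0 k) (data α β lam w 1 k)
        (pot α β lam w k) (dPot α β lam w k) (dJ α β lam w 0 k) (dJ α β lam w 1 k)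
      exact (congrArg (· ∈ totals α β lam (k + 1)) key).mpr common
    · have key := h_symStep_sub (Z := gen (2, k) 1) (lam := sc lam) (w := sc w) hI hhf hX hY hU
        (data α β lam w 0 k) (data α β lam w 1 k) (pot α β lam w k) (dPot α β lam w k)
      have hG : D (2, k) (gen (1, k) 1 * (2 * sc Complex.I * sc lam + 1 - 2 * dn 1 k)) = 0 := by
        simp only [map_add, map_sub, Derivation.leibniz, dq, D_sc, D_two, D_gen_y,
          Derivation.map_one_eq_zero, smul_zero, add_zero, sub_zero]
      rw [ep]
      refine (congrArg (· ∈ totals α β lam (k + 1)) key).mpr ?_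
      exact sub_mem (sub_mem (sub_mem (totals_mono k.le_succ (neg_mem hh))
        (m _ _ (mul_mem f2 fZ) hb)) (m _ _ fk hb)) (pot_total_mem hG)

/-- The symbol of `𝔹_{n+1}(u)/(u - i/2)` on the full kernel, whose last particle is only coupled
to `z_n`. -/
def lastB (α β : ℝ) (lam w : ℂ) (n : ℕ) : Sym :=
  (symStep (sc Complex.I) (sc (1 / 2)) (sc lam) (sc w) (gen (0, n) 1) (gen (0, n) (-1))
    (up 0 n) 0 (data α β lam w 0 n)).b

/-- The outcome of the algebra, for any linear map that kills total derivatives. For z_n the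
coupling is `up 0 n` alone, since there is no y_n. -/
theorem apply_lastB {M : Type*} [AddCommGroup M] [Module ℂ M] {n : ℕ} (T : Sym →ₗ[ℂ] M)
    (h : ∀ j < n, ∀ P, T (zTotal α β lam j (up 0 j + up 1 j) P) = 0)
    (h' : ∀ P, T (zTotal α β lam n (up 0 n) P) = 0) :
    T (lastB α β lam w n) = (lam ^ 2 - w) • T (data α β lam w 1 n).b := by
  have hT {Q : Sym} (hQ : Q ∈ totals α β lam n) : T Q = 0 := by
    refine (Submodule.span_le (p := LinearMap.ker T)).2 ?_ hQ
    rintro _ ⟨j, hj, P, rfl⟩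
    exact h j hj P
  have hs (Q : Sym) : T ((sc lam ^ 2 - sc w) * Q) = (lam ^ 2 - w) • T Q := by
    rw [← map_pow, ← map_sub, ← Algebra.smul_def, map_smul]
  obtain ⟨hdx, hdy, hb, hj, hh⟩ := relations (α := α) (β := β) (lam := lam) (w := w) n
  have key := b_symStep_last (hf := sc (1 / 2)) (X := gen (0, n) 1) (lam := sc lam) (w := sc w)
    (X' := gen (0, n) (-1)) sc_I_mul_I (gen_mul_gen_neg (2, n)) (data α β lam w 0 n)
    (data α β lam w 1 n) (pot α β lam w n) (dPot α β lam w n) (dJ α β lam w 0 n)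
  have dt : D (2, n) (up 0 n) = up 0 n := by
    simp [up, Derivation.leibniz, D_gen_z, D_gen_x, mul_comm]
  obtain ⟨P, hP⟩ := exists_zTotal_symJ (α := α) (β := β) (lam := lam) (w := w) 0 n (up 0 n) (up 0 n)
  obtain ⟨Q, hQ⟩ := exists_zTotal_pot (α := α) (β := β) (lam := lam) (w := w) n (up 0 n) 1
  rw [dt] at hP
  simp only [Derivation.map_one_eq_zero, zero_mul, zero_add, one_mul] at hQ
  have hg := hT (mul_mem_totals (up_x_mem_indep n) hdx)
  have key' := congrArg T key
  rw [← sub_eq_zero, ← hs, ← map_sub, lastB]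
  refine key'.trans ?_
  change T (_ + _ - up 0 n * _ + (up 0 n * _ + up 0 n * _ - up 0 n * up 0 n * _)) = 0
  rw [map_add, map_sub, map_add, hs, hs, hT hb, hP, h', hg]
  change _ + (lam ^ 2 - w) • T (dPot α β lam w n - up 0 n * pot α β lam w n) - _ + _ = _
  rw [hQ, h']
  simp

end

end Sym

end BCToda

namespace BCToda

namespace Sym

/-! ### Evaluation of symbols and logarithmic derivatives of the kernel. -/

/-- The point with the given coordinates; coordinates out of range are zero. -/
def pt {n : ℕ} (x z : Fin (n + 1) → ℝ) (y : Fin n → ℝ) : Var → ℝ := fun i =>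
  if i.1 = 0 then if h : i.2 < n + 1 then x ⟨i.2, h⟩ else 0
  else if i.1 = 1 then if h : i.2 < n then y ⟨i.2, h⟩ else 0
  else if h : i.2 < n + 1 then z ⟨i.2, h⟩ else 0

section pt

variable {n : ℕ} (x z : Fin (n + 1) → ℝ) (y : Fin n → ℝ)

theorem pt_x (j : Fin (n + 1)) : pt x z y (0, j) = x j := by
  have := j.isLt
  simp only [pt, this, if_true, dif_pos]

theorem pt_y (j : Fin n) : pt x z y (1, j) = y j := by simp [pt]

theorem pt_z (j : Fin (n + 1)) : pt x z y (2, j) = z j := by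
  have := j.isLt
  simp [pt, -Order.lt_add_one_iff]

theorem pt_update_x (j : Fin (n + 1)) (t : ℝ) :
    pt (Function.update x j t) z y = Function.update (pt x z y) (0, (j : ℕ)) t := by
  ext ⟨a, l⟩
  fin_cases a <;> simp [pt, Function.update_apply, Fin.ext_iff]
  grind

theorem pt_update_y (j : Fin n) (t : ℝ) :
    pt x z (Function.update y j t) = Function.update (pt x z y) (1, (j : ℕ)) t := by
  ext ⟨a, l⟩
  fin_cases a <;> simp [pt, Function.update_apply, Fin.ext_iff]
  grind

theorem pt_update_z (j : Fin (n + 1)) (t : ℝ) :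
    pt x (Function.update z j t) y = Function.update (pt x z y) (2, (j : ℕ)) t := by
  ext ⟨a, l⟩
  fin_cases a <;> simp [pt, Function.update_apply, Fin.ext_iff]
  grind

theorem abs_pt_le (i : Var) : |pt x z y i| ≤ ∑ j, |x j| + ∑ j, |y j| + ∑ j, |z j| := by
  have hx : 0 ≤ ∑ j, |x j| := Finset.sum_nonneg fun _ _ => abs_nonneg _
  have hy : 0 ≤ ∑ j, |y j| := Finset.sum_nonneg fun _ _ => abs_nonneg _
  have hz : 0 ≤ ∑ j, |z j| := Finset.sum_nonneg fun _ _ => abs_nonneg _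
  have hs {m : ℕ} (f : Fin m → ℝ) (j : Fin m) : |f j| ≤ ∑ j, |f j| :=
    Finset.single_le_sum (f := fun j => |f j|) (fun _ _ => abs_nonneg _) (Finset.mem_univ j)
  unfold pt
  split_ifs with h1 h2 h3 h4 h5
  · linarith [hs x ⟨_, h2⟩]
  · simp; positivity
  · linarith [hs y ⟨_, h4⟩]
  · simp; positivity
  · linarith [hs z ⟨_, h5⟩]
  · simp; positivity

theorem continuous_pt (i : Var) :
    Continuous fun q : (Fin (n + 1) → ℝ) × (Fin n → ℝ) × (Fin (n + 1) → ℝ) =>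
      pt q.1 q.2.2 q.2.1 i := by
  unfold pt
  split_ifs <;> fun_prop

end pt

theorem ev_hasDerivAt (v : Var → ℝ) (i : Var) (P : Sym) (t : ℝ) :
    HasDerivAt (fun s => ev (Function.update v i s) P) (ev (Function.update v i t) (D i P)) t := by
  induction P using induction with
  | zero => simpa using hasDerivAt_const t (0 : ℂ)
  | add P Q hP hQ =>
    simp only [map_add]
    exact hP.add hQ
  | smul_mono c m =>
    simp only [(D i).map_smul, map_smul, D_mono, ev_mono, smul_eq_mul]
    refine HasDerivAt.const_mul c ?_
    have h : ∀ s, (m.sum fun j a => (a : ℝ) * Function.update v i s j)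
        = (m i : ℝ) * s + ((m.sum fun j a => (a : ℝ) * v j) - m i * v i) := by
      intro s
      by_cases hi : i ∈ m.support
      · rw [Finsupp.sum, Finsupp.sum, ← Finset.add_sum_erase _ _ hi, ← Finset.add_sum_erase _ _ hi]
        have : ∑ j ∈ m.support.erase i, (m j : ℝ) * Function.update v i s j
            = ∑ j ∈ m.support.erase i, (m j : ℝ) * v j :=
          Finset.sum_congr rfl fun j hj => by
            rw [Function.update_of_ne (Finset.ne_of_mem_erase hj)]
        rw [this, Function.update_self]
        ring
      · have h0 : m i = 0 := Finsupp.notMem_support_iff.1 hi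
        rw [h0, Finsupp.sum, Finsupp.sum]
        have : ∑ j ∈ m.support, (m j : ℝ) * Function.update v i s j
            = ∑ j ∈ m.support, (m j : ℝ) * v j :=
          Finset.sum_congr rfl fun j hj => by
            rw [Function.update_of_ne (by rintro rfl; exact hi hj)]
        rw [this]
        simp
    simp only [h]
    have := (((hasDerivAt_id t).const_mul (m i : ℝ)).add_const
      ((m.sum fun j a => (a : ℝ) * v j) - m i * v i)).exp.ofReal_comp
    simp only [id, mul_one] at this
    refine this.congr_deriv ?_
    push_cast
    ring

theorem continuous_ev {X : Type*} [TopologicalSpace X] {v : X → Var → ℝ}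
    (hv : ∀ i, Continuous fun p => v p i) (P : Sym) : Continuous fun p => ev (v p) P := by
  induction P using induction with
  | zero => simpa using continuous_const
  | add P Q hP hQ =>
    simp only [map_add]
    exact hP.add hQ
  | smul_mono c m =>
    simp only [map_smul, ev_mono, Finsupp.sum]
    fun_prop

theorem ev_up (v : Var → ℝ) (a : Fin 3) (k : ℕ) :
    ev v (up a k) = (Real.exp (v (2, k) - v (a, k)) : ℂ) := by
  rw [up, map_mul, ev_gen, ev_gen, ← Complex.ofReal_mul, ← Real.exp_add]
  simp [sub_eq_add_neg]

theorem ev_dn (v : Var → ℝ) (a : Fin 3) (k : ℕ) :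
    ev v (dn a k) = (Real.exp (v (a, k) - v (2, k + 1)) : ℂ) := by
  rw [dn, map_mul, ev_gen, ev_gen, ← Complex.ofReal_mul, ← Real.exp_add]
  simp [sub_eq_add_neg]

theorem ev_sc (v : Var → ℝ) (c : ℂ) : ev v (sc c) = c := (ev v).commutes c

/-- The sum of all couplings. -/
def couplings (n : ℕ) : Sym :=
  ∑ j ∈ Finset.range n, (up 0 j + up 1 j + dn 0 j + dn 1 j) + up 0 n

/-- The linear form in the exponent of the kernel. -/
def linForm (n : ℕ) (v : Var → ℝ) : ℝ :=
  ∑ j ∈ Finset.range (n + 1), v (0, j) + ∑ j ∈ Finset.range n, v (1, j)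
    - 2 * ∑ j ∈ Finset.range (n + 1), v (2, j)

/-- The coefficients of the linear form. -/
def linCoeff (n : ℕ) (i : Var) : ℂ :=
  if i.1 = 2 then if i.2 < n + 1 then -2 else 0
  else if i.1 = 1 then if i.2 < n then 1 else 0
  else if i.2 < n + 1 then 1 else 0

/-- The part of the kernel without the boundary factors. -/
def bulk (n : ℕ) (lam : ℂ) (v : Var → ℝ) : ℂ :=
  Complex.exp (Complex.I * lam * (linForm n v : ℂ) - ev v (couplings n))

/-- The logarithmic derivatives of the bulk kernel. -/
def bulkLogD (n : ℕ) (lam : ℂ) (i : Var) : Sym :=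
  sc (Complex.I * lam * linCoeff n i) - D i (couplings n)

theorem linForm_hasDerivAt (n : ℕ) (v : Var → ℝ) (i : Var) (t : ℝ) :
    HasDerivAt (fun s => (linForm n (Function.update v i s) : ℂ)) (linCoeff n i) t := by
  have hs (a : Fin 3) (k : ℕ) : HasDerivAt
      (fun s => ((∑ j ∈ Finset.range k, Function.update v i s (a, j) : ℝ) : ℂ))
      (if i.1 = a ∧ i.2 < k then 1 else 0) t := by
    have h1 (j : ℕ) : HasDerivAt (fun s => ((Function.update v i s (a, j) : ℝ) : ℂ))
        (if i = (a, j) then 1 else 0) t := by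
      by_cases h : i = (a, j)
      · subst h
        simpa using (hasDerivAt_id t).ofReal_comp
      · simp [Function.update_of_ne (Ne.symm h), h, hasDerivAt_const]
    have h2 := HasDerivAt.fun_sum (u := Finset.range k) fun j _ => h1 j
    push_cast
    refine h2.congr_deriv ?_
    obtain ⟨b, l⟩ := i
    by_cases hb : b = a
    · subst hb
      simp [Finset.sum_ite_eq]
    · simp [hb]
  have h := ((hs 0 (n + 1)).add (hs 1 n)).sub ((hs 2 (n + 1)).const_mul 2)
  simp only [linForm]
  push_cast at h ⊢
  refine h.congr_deriv ?_
  obtain ⟨b, l⟩ := i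
  fin_cases b <;> simp [linCoeff]
  split_ifs <;> simp

theorem bulk_hasDerivAt (n : ℕ) (lam : ℂ) (v : Var → ℝ) (i : Var) (t : ℝ) :
    HasDerivAt (fun s => bulk n lam (Function.update v i s))
      (ev (Function.update v i t) (bulkLogD n lam i) * bulk n lam (Function.update v i t)) t := by
  have h := (((linForm_hasDerivAt n v i t).const_mul (Complex.I * lam)).sub
    (ev_hasDerivAt v i (couplings n) t)).cexp
  refine h.congr_deriv ?_
  rw [bulkLogD, map_sub, ev_sc, mul_comm]
  rfl

theorem ev_mul_bulk_hasDerivAt (n : ℕ) (lam : ℂ) (v : Var → ℝ) (i : Var) (P : Sym) (t : ℝ) :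
    HasDerivAt (fun s => ev (Function.update v i s) P * bulk n lam (Function.update v i s))
      (ev (Function.update v i t) (D i P + P * bulkLogD n lam i)
        * bulk n lam (Function.update v i t)) t := by
  refine ((ev_hasDerivAt v i P t).mul (bulk_hasDerivAt n lam v i t)).congr_deriv ?_
  rw [map_add, map_mul]
  ring

theorem D_up_coord {a b : Fin 3} (ha : a ≠ 2) (j l : ℕ) :
    D (a, j) (up b l) = if b = a ∧ l = j then -up b l else 0 := by
  rw [up, Derivation.leibniz, D_gen, D_gen]
  by_cases h : b = a ∧ l = j
  · obtain ⟨rfl, rfl⟩ := h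
    simp [Ne.symm ha]
  · simp [Ne.symm ha, h]

theorem D_dn_coord {a b : Fin 3} (ha : a ≠ 2) (j l : ℕ) :
    D (a, j) (dn b l) = if b = a ∧ l = j then dn b l else 0 := by
  rw [dn, Derivation.leibniz, D_gen, D_gen]
  by_cases h : b = a ∧ l = j
  · obtain ⟨rfl, rfl⟩ := h
    simp [Ne.symm ha, mul_comm]
  · simp [Ne.symm ha, h]

theorem D_up_z {b : Fin 3} (hb : b ≠ 2) (j l : ℕ) :
    D (2, j) (up b l) = if l = j then up b l else 0 := by
  rw [up, Derivation.leibniz, D_gen, D_gen]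
  by_cases h : l = j
  · subst h
    simp [hb, mul_comm]
  · simp [hb, h]

theorem D_dn_z {b : Fin 3} (hb : b ≠ 2) (j l : ℕ) :
    D (2, j) (dn b l) = if l + 1 = j then -dn b l else 0 := by
  rw [dn, Derivation.leibniz, D_gen, D_gen]
  by_cases h : l + 1 = j
  · subst h
    simp [hb]
  · simp [hb, h]

theorem bulkLogD_x {n j : ℕ} (h : j < n) (lam : ℂ) :
    bulkLogD n lam (0, j) = sc Complex.I * sc lam + up 0 j - dn 0 j := by
  simp only [bulkLogD, couplings, map_add, map_sum, D_up_coord (show (0 : Fin 3) ≠ 2 by decide),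
    D_dn_coord (show (0 : Fin 3) ≠ 2 by decide), linCoeff]
  simp [Finset.sum_add_distrib, h, h.ne', Nat.lt_succ_of_lt h]
  ring

theorem bulkLogD_x_last (n : ℕ) (lam : ℂ) :
    bulkLogD n lam (0, n) = sc Complex.I * sc lam + up 0 n := by
  simp only [bulkLogD, couplings, map_add, map_sum, D_up_coord (show (0 : Fin 3) ≠ 2 by decide),
    D_dn_coord (show (0 : Fin 3) ≠ 2 by decide), linCoeff]
  simp [Finset.sum_add_distrib]

theorem bulkLogD_y {n j : ℕ} (h : j < n) (lam : ℂ) :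
    bulkLogD n lam (1, j) = sc Complex.I * sc lam + up 1 j - dn 1 j := by
  simp only [bulkLogD, couplings, map_add, map_sum, D_up_coord (show (1 : Fin 3) ≠ 2 by decide),
    D_dn_coord (show (1 : Fin 3) ≠ 2 by decide), linCoeff]
  simp [Finset.sum_add_distrib, h]
  ring

theorem D_couplings_z (n j : ℕ) : D (2, j) (couplings n)
    = (if j < n then up 0 j + up 1 j else 0) + (if j = n then up 0 n else 0)
      - if j ≠ 0 ∧ j ≤ n then dn 0 (j - 1) + dn 1 (j - 1) else 0 := by
  have h0 : (0 : Fin 3) ≠ 2 := by decide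
  have h1 : (1 : Fin 3) ≠ 2 := by decide
  simp only [couplings, map_add, map_sum, D_up_z h0, D_dn_z h0, D_up_z h1, D_dn_z h1]
  cases j with
  | zero =>
    simp [Finset.sum_add_distrib, Finset.sum_ite_eq', eq_comm]
    split_ifs <;> ring
  | succ j =>
    simp [Finset.sum_add_distrib, Finset.sum_ite_eq', eq_comm]
    split_ifs <;> first | omega | ring

/-- The sum of the couplings `e^{z_j - ·}` in the kernel for `n + 1` particles. -/
def upSum (n j : ℕ) : Sym := if j < n then up 0 j + up 1 j else up 0 j

theorem bulkLogD_z_zero (n : ℕ) (lam : ℂ) :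
    bulkLogD n lam (2, 0) = -2 * sc Complex.I * sc lam - upSum n 0 := by
  have h : sc (Complex.I * lam * linCoeff n (2, 0)) = -2 * sc Complex.I * sc lam := by
    simp [linCoeff, map_ofNat]
    ring
  rw [bulkLogD, D_couplings_z, h, upSum]
  rcases Nat.eq_zero_or_pos n with rfl | hn
  · simp
  · simp [hn, hn.ne]

theorem bulkLogD_z_succ {n j : ℕ} (hj : j + 1 ≤ n) (lam : ℂ) :
    bulkLogD n lam (2, j + 1) = logD lam j - upSum n (j + 1) := by
  have h : sc (Complex.I * lam * linCoeff n (2, j + 1)) = -2 * sc Complex.I * sc lam := by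
    simp [linCoeff, show j < n by omega, map_ofNat]
    ring
  rw [bulkLogD, D_couplings_z, h, upSum, logD]
  rcases hj.lt_or_eq with hn | rfl
  · simp [hn, hn.ne, hn.le]
    ring
  · simp
    ring

/-- The boundary factor of the kernel. -/
def edge (α β : ℝ) (lam : ℂ) (t : ℝ) : ℂ :=
  ((1 + β * Real.exp (-t) : ℝ) : ℂ) ^ (-Complex.I * lam - (gPar α β : ℂ))
    * ((1 - β * Real.exp (-t) : ℝ) : ℂ) ^ (-Complex.I * lam + (gPar α β : ℂ) - 1)
    * (heaviside (t - Real.log β) : ℂ)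

end Sym

end BCToda

namespace BCToda

/-! ### Estimates: edge singularity and decay of the kernel. -/

open MeasureTheory

/-- For s ≥ 0 this is e^s ≥ 1 + s + s²/2 together with K s ≤ (K² + s²)/2. -/
theorem exists_le_exp (K : ℝ) : ∃ C, 0 ≤ C ∧ ∀ s : ℝ, K * max s 0 - C ≤ Real.exp s := by
  refine ⟨K ^ 2 / 2, by positivity, fun s => ?_⟩
  rcases le_total s 0 with h | h
  · rw [max_eq_right h]
    nlinarith [Real.exp_pos s, sq_nonneg K]
  · rw [max_eq_left h]
    nlinarith [Real.quadratic_le_exp_of_nonneg h, sq_nonneg (K - s)]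

/-- The singular weight that dominates the boundary factor of the kernel. -/
def edgeWeight (β σ t : ℝ) : ℝ :=
  if Real.log β ≤ t then (1 - β * Real.exp (-t)) ^ (σ - 1) else 0

section edge

variable {β : ℝ} (hβ : 0 < β)
include hβ

theorem mul_exp_neg_le_one {t : ℝ} (ht : Real.log β ≤ t) : β * Real.exp (-t) ≤ 1 := by
  calc β * Real.exp (-t) = Real.exp (Real.log β - t) := by
        rw [sub_eq_add_neg, Real.exp_add, Real.exp_log hβ]
    _ ≤ 1 := Real.exp_le_one_iff.2 (by linarith)

theorem mul_exp_neg_lt_one {t : ℝ} (ht : Real.log β < t) : β * Real.exp (-t) < 1 := by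
  calc β * Real.exp (-t) = Real.exp (Real.log β - t) := by
        rw [sub_eq_add_neg, Real.exp_add, Real.exp_log hβ]
    _ < 1 := by rw [← Real.exp_zero]; exact Real.exp_lt_exp.2 (by linarith)

theorem edgeWeight_nonneg (σ t : ℝ) : 0 ≤ edgeWeight β σ t := by
  unfold edgeWeight
  split_ifs with h
  · exact Real.rpow_nonneg (by linarith [mul_exp_neg_le_one hβ h]) _
  · rfl

/-- Up to the factor σβ, e^{-t} (1 - β e^{-t})^{σ-1} is the derivative of (1 - β e^{-t})^σ, which
rises from 0 at ln β to 1 at infinity; and e^{-|t|} ≤ e^{-t}. -/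
theorem integrable_exp_mul_edgeWeight {σ : ℝ} (hσ : 0 < σ) :
    Integrable fun t => Real.exp (-|t|) * edgeWeight β σ t := by
  have hd : ∀ t ∈ Set.Ioi (Real.log β), HasDerivAt (fun t => (1 - β * Real.exp (-t)) ^ σ)
      (σ * β * (Real.exp (-t) * (1 - β * Real.exp (-t)) ^ (σ - 1))) t := by
    intro t ht
    have hp : 0 < 1 - β * Real.exp (-t) := by linarith [mul_exp_neg_lt_one hβ ht]
    have h1 : HasDerivAt (fun t => 1 - β * Real.exp (-t)) (β * Real.exp (-t)) t := by
      refine (((hasDerivAt_neg t).exp.const_mul β).const_sub 1).congr_deriv ?_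
      ring
    refine (h1.rpow_const (p := σ) (Or.inl hp.ne')).congr_deriv ?_
    ring
  have hlim : Filter.Tendsto (fun t => (1 - β * Real.exp (-t)) ^ σ) Filter.atTop (nhds 1) := by
    have h1 : Filter.Tendsto (fun t => 1 - β * Real.exp (-t)) Filter.atTop (nhds (1 - β * 0)) :=
      (Real.tendsto_exp_neg_atTop_nhds_zero.const_mul β).const_sub 1
    have h2 := h1.rpow_const (p := σ) (Or.inl (by simp))
    simpa using h2
  have h1 : IntegrableOn (fun t => σ * β * (Real.exp (-t) * (1 - β * Real.exp (-t)) ^ (σ - 1)))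
      (Set.Ioi (Real.log β)) := by
    refine integrableOn_Ioi_deriv_of_nonneg ?_ hd ?_ hlim
    · refine Continuous.continuousWithinAt ?_
      exact (by fun_prop : Continuous fun t => 1 - β * Real.exp (-t)).rpow_const
        fun _ => Or.inr hσ.le
    · intro t ht
      have hp : 0 < 1 - β * Real.exp (-t) := by linarith [mul_exp_neg_lt_one hβ ht]
      positivity
  have h2 : IntegrableOn (fun t => Real.exp (-t) * (1 - β * Real.exp (-t)) ^ (σ - 1))
      (Set.Ioi (Real.log β)) := by
    have := h1.const_mul (σ * β)⁻¹
    refine this.congr (Filter.Eventually.of_forall fun t => ?_)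
    simp only
    rw [inv_mul_cancel_left₀ (mul_pos hσ hβ).ne']
  have h3 : IntegrableOn (fun t => Real.exp (-t) * edgeWeight β σ t) (Set.Ici (Real.log β)) := by
    rw [integrableOn_Ici_iff_integrableOn_Ioi]
    refine h2.congr_fun (fun t ht => ?_) measurableSet_Ioi
    simp only [edgeWeight, if_pos (le_of_lt (Set.mem_Ioi.1 ht))]
  have h4 : Integrable fun t => Real.exp (-t) * edgeWeight β σ t := by
    refine (integrableOn_iff_integrable_of_support_subset fun t ht => ?_).1 h3
    by_contra hn
    rw [Set.mem_Ici] at hn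
    exact ht (by simp [edgeWeight, hn])
  refine h4.mono' ?_ (Filter.Eventually.of_forall fun t => ?_)
  · refine ((by fun_prop : Measurable fun t : ℝ => Real.exp (-|t|)).mul ?_).aestronglyMeasurable
    exact Measurable.ite measurableSet_Ici (by fun_prop) measurable_const
  · rw [Real.norm_of_nonneg (mul_nonneg (Real.exp_nonneg _) (edgeWeight_nonneg hβ σ t))]
    refine mul_le_mul_of_nonneg_right ?_ (edgeWeight_nonneg hβ σ t)
    exact Real.exp_le_exp.2 (neg_le_neg (le_abs_self t))

theorem norm_one_add_cpow_le (s : ℂ) {t : ℝ} (ht : Real.log β ≤ t) :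
    ‖((1 + β * Real.exp (-t) : ℝ) : ℂ) ^ s‖ ≤ 2 ^ |s.re| := by
  have h0 : 0 < β * Real.exp (-t) := by positivity
  have h1 := mul_exp_neg_le_one hβ ht
  rw [Complex.norm_cpow_eq_rpow_re_of_pos (by linarith)]
  calc (1 + β * Real.exp (-t)) ^ s.re ≤ (1 + β * Real.exp (-t)) ^ |s.re| :=
        Real.rpow_le_rpow_of_exponent_le (by linarith) (le_abs_self _)
    _ ≤ 2 ^ |s.re| := Real.rpow_le_rpow (by linarith) (by linarith) (abs_nonneg _)

/-- At t = ln β the base is 0 and the modulus of the complex power need not be the real power (s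
imaginary and nonzero), hence an inequality. -/
theorem norm_one_sub_cpow_le (s : ℂ) {t : ℝ} (ht : Real.log β ≤ t) :
    ‖((1 - β * Real.exp (-t) : ℝ) : ℂ) ^ s‖ ≤ (1 - β * Real.exp (-t)) ^ s.re := by
  have h1 := mul_exp_neg_le_one hβ ht
  rcases h1.lt_or_eq with h | h
  · rw [Complex.norm_cpow_eq_rpow_re_of_pos (by linarith)]
  · rw [h, sub_self, Complex.ofReal_zero]
    by_cases hs : s = 0
    · simp [hs]
    · rw [Complex.zero_cpow hs, norm_zero]
      exact Real.rpow_nonneg le_rfl _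

theorem norm_edge_le (α : ℝ) (lam : ℂ) : ∃ C, 0 ≤ C ∧
    ∀ t, ‖Sym.edge α β lam t‖ ≤ C * edgeWeight β (gPar α β + lam.im) t := by
  refine ⟨2 ^ |(-Complex.I * lam - (gPar α β : ℂ)).re|, by positivity, fun t => ?_⟩
  by_cases ht : Real.log β ≤ t
  · have h := norm_one_sub_cpow_le hβ (-Complex.I * lam + (gPar α β : ℂ) - 1) ht
    have hre : (-Complex.I * lam + (gPar α β : ℂ) - 1).re = gPar α β + lam.im - 1 := by
      simp [add_comm]
    rw [hre] at h
    rw [Sym.edge, heaviside, if_pos (by linarith), Complex.ofReal_one, mul_one, norm_mul,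
      edgeWeight, if_pos ht]
    exact mul_le_mul (norm_one_add_cpow_le hβ _ ht) h (norm_nonneg _) (by positivity)
  · rw [Sym.edge, heaviside, if_neg (by linarith), Complex.ofReal_zero, mul_zero, norm_zero,
      edgeWeight, if_neg ht, mul_zero]

end edge

theorem measurable_edge (α β : ℝ) (lam : ℂ) : Measurable (Sym.edge α β lam) := by
  unfold Sym.edge heaviside
  refine Measurable.mul (Measurable.mul ?_ ?_) ?_
  · exact Measurable.pow_const (by fun_prop) _
  · exact Measurable.pow_const (by fun_prop) _
  · refine Complex.measurable_ofReal.comp ?_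
    exact Measurable.ite (measurableSet_le measurable_const (by fun_prop)) measurable_const
      measurable_const

/-- The function that dominates the kernel. -/
def dom (β σ : ℝ) {n : ℕ} (q : (Fin n → ℝ) × (Fin (n + 1) → ℝ)) : ℝ :=
  (∏ j, Real.exp (-|q.1 j|)) * ∏ j, Real.exp (-|q.2 j|) * if j = 0 then edgeWeight β σ (q.2 j) else 1

theorem integrable_exp_neg_abs : Integrable fun t : ℝ => Real.exp (-|t|) := by
  rw [← integrableOn_univ, ← Set.Iic_union_Ioi (a := (0 : ℝ))]
  refine IntegrableOn.union ?_ ?_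
  · refine (integrableOn_exp_Iic 0).congr_fun (fun t ht => ?_) measurableSet_Iic
    simp only [abs_of_nonpos (Set.mem_Iic.1 ht), neg_neg]
  · refine (integrableOn_exp_neg_Ioi 0).congr_fun (fun t ht => ?_) measurableSet_Ioi
    simp only [abs_of_pos (Set.mem_Ioi.1 ht)]

theorem integrable_dom {β σ : ℝ} (hβ : 0 < β) (hσ : 0 < σ) (n : ℕ) :
    Integrable (dom β σ (n := n)) := by
  have h1 : Integrable fun y : Fin n → ℝ => ∏ j, Real.exp (-|y j|) :=
    Integrable.fintype_prod fun _ => integrable_exp_neg_abs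
  have h2 : Integrable fun z : Fin (n + 1) → ℝ =>
      ∏ j, Real.exp (-|z j|) * if j = 0 then edgeWeight β σ (z j) else 1 := by
    refine Integrable.fintype_prod (f := fun (j : Fin (n + 1)) t =>
      Real.exp (-|t|) * if j = 0 then edgeWeight β σ t else 1) fun j => ?_
    by_cases hj : j = 0
    · simpa [hj] using integrable_exp_mul_edgeWeight hβ hσ
    · simpa [hj] using integrable_exp_neg_abs
  exact h1.mul_prod h2

theorem dom_eq (β σ : ℝ) {n : ℕ} (q : (Fin n → ℝ) × (Fin (n + 1) → ℝ)) :
    dom β σ q = Real.exp (-∑ j, |q.1 j|) * Real.exp (-∑ j, |q.2 j|) * edgeWeight β σ (q.2 0) := by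
  rw [dom, Finset.prod_mul_distrib, ← Real.exp_sum, ← Real.exp_sum, Finset.sum_neg_distrib,
    Finset.sum_neg_distrib, Finset.prod_ite_eq' Finset.univ 0, if_pos (Finset.mem_univ _), mul_assoc]

/-- The sum of the couplings at a real point. -/
def couplingSum {n : ℕ} (x z : Fin (n + 1) → ℝ) (y : Fin n → ℝ) : ℝ :=
  (∑ j : Fin n,
      (Real.exp (z j.castSucc - x j.castSucc) + Real.exp (z j.castSucc - y j)
        + Real.exp (x j.castSucc - z j.succ) + Real.exp (y j - z j.succ)))
    + Real.exp (z (Fin.last n) - x (Fin.last n))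

/-- The couplings to x bound z_j from above and z_{j+1} from below, z₀ is bounded below by a, and
y_j is held between z_j and z_{j+1}. Every direction is thus controlled by an exponential, which
beats any linear function. -/
theorem exists_le_couplingSum (n : ℕ) (a : ℝ) {N : ℝ} (hN : 0 ≤ N) : ∃ C, 0 ≤ C ∧
    ∀ (x z : Fin (n + 1) → ℝ) (y : Fin n → ℝ), a ≤ z 0 →
      N * ∑ j, |y j| + N * ∑ j, |z j| - 6 * N * ∑ j, |x j| - C ≤ couplingSum x z y := by
  obtain ⟨C, hC, hexp⟩ := exists_le_exp (3 * N)
  -- There are 4n + 1 exponentials, each losing C; the negative part of z₀ costs 3N|a|.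
  refine ⟨3 * N * |a| + (4 * n + 1) * C, by positivity, fun x z y hz => ?_⟩
  have hterm (j : Fin n) : 3 * N * max (z j.castSucc) 0 + 3 * N * max (-z j.succ) 0
      + N * |y j| - N * |z j.castSucc| - N * |z j.succ| - 6 * N * |x j.castSucc| - 4 * C
      ≤ Real.exp (z j.castSucc - x j.castSucc) + Real.exp (z j.castSucc - y j)
        + Real.exp (x j.castSucc - z j.succ) + Real.exp (y j - z j.succ) := by
    have e1 := hexp (z j.castSucc - x j.castSucc)
    have e2 := hexp (z j.castSucc - y j)
    have e3 := hexp (x j.castSucc - z j.succ)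
    have e4 := hexp (y j - z j.succ)
    have m1 : max (z j.castSucc) 0 ≤ max (z j.castSucc - x j.castSucc) 0 + |x j.castSucc| := by
      grind
    have m3 : max (-z j.succ) 0 ≤ max (x j.castSucc - z j.succ) 0 + |x j.castSucc| := by
      grind
    -- Bounding |y_j| spends N|z_j| + N|z_{j+1}|. Each z occurs at most twice, so slope 3N in `hexp`
    -- leaves N|z_j|; the factors 3 here match that slope.
    have m2 : |y j| ≤ 3 * max (z j.castSucc - y j) 0 + 3 * max (y j - z j.succ) 0
        + |z j.castSucc| + |z j.succ| := by
      grind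
    have m1' := mul_le_mul_of_nonneg_left m1 hN
    have m2' := mul_le_mul_of_nonneg_left m2 hN
    have m3' := mul_le_mul_of_nonneg_left m3 hN
    linarith
  have hlast : 3 * N * max (z (Fin.last n)) 0 - 3 * N * |x (Fin.last n)| - C
      ≤ Real.exp (z (Fin.last n) - x (Fin.last n)) := by
    have e1 := hexp (z (Fin.last n) - x (Fin.last n))
    have m1 : max (z (Fin.last n)) 0 ≤ max (z (Fin.last n) - x (Fin.last n)) 0 + |x (Fin.last n)| := by
      grind
    have m1' := mul_le_mul_of_nonneg_left m1 hN
    linarith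
  have hfirst : 3 * N * max (-z 0) 0 - 3 * N * |a| ≤ 0 := by
    have m1 : max (-z 0) 0 ≤ |a| := by grind
    have m1' := mul_le_mul_of_nonneg_left m1 hN
    linarith
  have hsum := Finset.sum_le_sum fun j (_ : j ∈ Finset.univ) => hterm j
  simp only [Finset.sum_add_distrib, Finset.sum_sub_distrib, ← Finset.mul_sum, Finset.sum_const,
    Finset.card_univ, Fintype.card_fin, nsmul_eq_mul] at hsum
  have hx : ∑ j, |x j| = ∑ j : Fin n, |x j.castSucc| + |x (Fin.last n)| := Fin.sum_univ_castSucc _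
  have hzabs : ∑ j, |z j| = ∑ j, max (z j) 0 + ∑ j, max (-z j) 0 := by
    rw [← Finset.sum_add_distrib]
    refine Finset.sum_congr rfl fun j _ => ?_
    grind
  have hzp : ∑ j, max (z j) 0 = ∑ j : Fin n, max (z j.castSucc) 0 + max (z (Fin.last n)) 0 :=
    Fin.sum_univ_castSucc _
  have hzm : ∑ j, max (-z j) 0 = max (-z 0) 0 + ∑ j : Fin n, max (-z j.succ) 0 :=
    Fin.sum_univ_succ _
  have hz1 : ∑ j, |z j| = ∑ j : Fin n, |z j.castSucc| + |z (Fin.last n)| := Fin.sum_univ_castSucc _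
  have hz2 : ∑ j, |z j| = |z 0| + ∑ j : Fin n, |z j.succ| := Fin.sum_univ_succ _
  have a1 := mul_nonneg hN (abs_nonneg (z (Fin.last n)))
  have a2 := mul_nonneg hN (abs_nonneg (z 0))
  have a3 := mul_nonneg hN (abs_nonneg (x (Fin.last n)))
  have b1 := congrArg (N * ·) hz1
  have b2 := congrArg (N * ·) hz2
  have b3 := congrArg (N * ·) hzabs
  have b4 := congrArg (N * ·) hzp
  have b5 := congrArg (N * ·) hzm
  have b6 := congrArg (N * ·) hx
  simp only [mul_add] at b1 b2 b3 b4 b5 b6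
  simp only [couplingSum, Finset.sum_add_distrib]
  linarith

theorem Sym.norm_ev_le (P : Sym) : ∃ C c, 0 ≤ C ∧ 0 ≤ c ∧ ∀ (v : Var → ℝ) (M : ℝ),
    (∀ i, |v i| ≤ M) → ‖ev v P‖ ≤ C * Real.exp (c * M) := by
  induction P using Sym.induction with
  | zero => exact ⟨0, 0, le_rfl, le_rfl, fun v M _ => by simp⟩
  | add P Q hP hQ =>
    obtain ⟨C, c, hC, hc, h⟩ := hP
    obtain ⟨C', c', hC', hc', h'⟩ := hQ
    refine ⟨C + C', c + c', by positivity, by positivity, fun v M hM => ?_⟩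
    have hM0 : 0 ≤ M := (abs_nonneg _).trans (hM (0, 0))
    rw [map_add, add_mul]
    refine (norm_add_le _ _).trans (add_le_add ((h v M hM).trans ?_) ((h' v M hM).trans ?_))
    · gcongr; linarith
    · gcongr; linarith
  | smul_mono c m =>
    refine ⟨‖c‖, m.sum fun _ a => |(a : ℝ)|, norm_nonneg _,
      Finset.sum_nonneg fun _ _ => abs_nonneg _, fun v M hM => ?_⟩
    rw [map_smul, norm_smul, ev_mono, Complex.norm_real, Real.norm_of_nonneg (Real.exp_nonneg _)]
    gcongr
    rw [Finsupp.sum, Finsupp.sum, Finset.sum_mul]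
    refine Finset.sum_le_sum fun i _ => (le_abs_self _).trans ?_
    rw [abs_mul]
    gcongr
    exact hM i

namespace Sym

theorem ev_couplings {n : ℕ} (x z : Fin (n + 1) → ℝ) (y : Fin n → ℝ) :
    ev (pt x z y) (couplings n) = (couplingSum x z y : ℂ) := by
  have hx (j : Fin n) : pt x z y (0, (j : ℕ)) = x j.castSucc := pt_x x z y j.castSucc
  have hz (j : Fin n) : pt x z y (2, (j : ℕ)) = z j.castSucc := pt_z x z y j.castSucc
  have hz' (j : Fin n) : pt x z y (2, (j : ℕ) + 1) = z j.succ := pt_z x z y j.succ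
  have hl : pt x z y (0, n) = x (Fin.last n) := pt_x x z y (Fin.last n)
  have hl' : pt x z y (2, n) = z (Fin.last n) := pt_z x z y (Fin.last n)
  simp only [couplings, couplingSum, Finset.sum_range, map_add, map_sum, ev_up, ev_dn, hx, hz, hz',
    hl, hl', pt_y]
  push_cast
  rfl

theorem linForm_pt {n : ℕ} (x z : Fin (n + 1) → ℝ) (y : Fin n → ℝ) :
    linForm n (pt x z y) = ∑ j, x j + ∑ j, y j - 2 * ∑ j, z j := by
  simp only [linForm, Finset.sum_range, pt_x, pt_y, pt_z]

theorem kernelIntegrand_eq (α β : ℝ) {n : ℕ} (lam : ℂ) (x z : Fin (n + 1) → ℝ) (y : Fin n → ℝ) :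
    kernelIntegrand α β lam x z y = bulk n lam (pt x z y) * edge α β lam (z 0) := by
  rw [kernelIntegrand, bulk, edge, ev_couplings, linForm_pt, couplingSum,
    Complex.ofReal_add (∑ j : Fin n, _) (Real.exp _), ← sub_sub]
  ring

/-- The integrand of a raising operator with a symbol inserted. -/
def integrand (α β : ℝ) (n : ℕ) (lam : ℂ) (P : Sym) (x : Fin (n + 1) → ℝ)
    (q : (Fin n → ℝ) × (Fin (n + 1) → ℝ)) : ℂ :=
  ev (pt x q.2 q.1) P * bulk n lam (pt x q.2 q.1) * edge α β lam (q.2 0)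

/-- The oscillating factor can grow at rate up to 2|Im λ| in the variables, so the coupling bound is
taken with slope N + 2|Im λ|. -/
theorem norm_bulk_le (n : ℕ) (lam : ℂ) (a : ℝ) {N : ℝ} (hN : 0 ≤ N) : ∃ C, 0 ≤ C ∧
    ∀ (x z : Fin (n + 1) → ℝ) (y : Fin n → ℝ), a ≤ z 0 →
      ‖bulk n lam (pt x z y)‖ ≤ C * Real.exp ((2 * |lam.im| + 6 * (N + 2 * |lam.im|)) * ∑ j, |x j|)
        * Real.exp (-(N * ∑ j, |y j|)) * Real.exp (-(N * ∑ j, |z j|)) := by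
  obtain ⟨C, hC, h⟩ := exists_le_couplingSum n a (N := N + 2 * |lam.im|) (by positivity)
  refine ⟨Real.exp C, Real.exp_nonneg _, fun x z y hz => ?_⟩
  have h1 := h x z y hz
  rw [bulk, Complex.norm_exp, ev_couplings, linForm_pt, ← Real.exp_add, ← Real.exp_add,
    ← Real.exp_add, Real.exp_le_exp]
  have hre : (Complex.I * lam * ((∑ j, x j + ∑ j, y j - 2 * ∑ j, z j : ℝ) : ℂ)
      - (couplingSum x z y : ℂ)).re
      = -lam.im * (∑ j, x j + ∑ j, y j - 2 * ∑ j, z j) - couplingSum x z y := by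
    simp only [Complex.sub_re, Complex.re_mul_ofReal, Complex.I_mul_re, Complex.ofReal_re]
  rw [hre]
  have hx := Finset.abs_sum_le_sum_abs x Finset.univ
  have hy := Finset.abs_sum_le_sum_abs y Finset.univ
  have hz := Finset.abs_sum_le_sum_abs z Finset.univ
  have hl : |∑ j, x j + ∑ j, y j - 2 * ∑ j, z j| ≤ ∑ j, |x j| + ∑ j, |y j| + 2 * ∑ j, |z j| := by
    rw [abs_le] at *
    constructor <;> linarith
  have hm : -lam.im * (∑ j, x j + ∑ j, y j - 2 * ∑ j, z j)
      ≤ |lam.im| * (∑ j, |x j| + ∑ j, |y j| + 2 * ∑ j, |z j|) := by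
    refine (le_abs_self _).trans ?_
    rw [abs_mul, abs_neg]
    exact mul_le_mul_of_nonneg_left hl (abs_nonneg _)
  have hsx := mul_nonneg (abs_nonneg lam.im) (Finset.sum_nonneg fun j (_ : j ∈ Finset.univ) => abs_nonneg (x j))
  have hsy := mul_nonneg (abs_nonneg lam.im) (Finset.sum_nonneg fun j (_ : j ∈ Finset.univ) => abs_nonneg (y j))
  linarith

theorem norm_integrand_le {β : ℝ} (hβ : 0 < β) (α : ℝ) (n : ℕ) (lam : ℂ) (P : Sym) {b : ℝ}
    (hb : 0 ≤ b) : ∃ C c, 0 ≤ C ∧ 0 ≤ c ∧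
      ∀ (x : Fin (n + 1) → ℝ) (q : (Fin n → ℝ) × (Fin (n + 1) → ℝ)),
        ‖integrand α β n lam P x q‖ * Real.exp (b * ∑ j, |q.1 j|)
          ≤ C * Real.exp (c * ∑ j, |x j|) * dom β (gPar α β + lam.im) q := by
  obtain ⟨C₁, c₁, hC₁, hc₁, h₁⟩ := norm_ev_le P
  -- The decay rate absorbs the growth c₁ of the symbol and b of the function, and leaves 1 for
  -- `dom`.
  obtain ⟨C₂, hC₂, h₂⟩ := norm_bulk_le n lam (Real.log β) (N := c₁ + b + 1) (by positivity)
  obtain ⟨C₃, hC₃, h₃⟩ := norm_edge_le hβ α lam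
  refine ⟨C₁ * C₂ * C₃, c₁ + (2 * |lam.im| + 6 * ((c₁ + b + 1) + 2 * |lam.im|)), by positivity,
    by positivity, fun x q => ?_⟩
  have hw := edgeWeight_nonneg hβ (gPar α β + lam.im) (q.2 0)
  by_cases hq : Real.log β ≤ q.2 0
  · have e₁ := h₁ (pt x q.2 q.1) _ (abs_pt_le x q.2 q.1)
    have e₂ := h₂ x q.2 q.1 hq
    have e₃ := h₃ (q.2 0)
    have hy : 0 ≤ ∑ j, |q.1 j| := Finset.sum_nonneg fun _ _ => abs_nonneg _
    have hz : 0 ≤ ∑ j, |q.2 j| := Finset.sum_nonneg fun _ _ => abs_nonneg _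
    rw [integrand, norm_mul, norm_mul, dom_eq]
    calc
      ‖ev (pt x q.2 q.1) P‖ * ‖bulk n lam (pt x q.2 q.1)‖ * ‖edge α β lam (q.2 0)‖
          * Real.exp (b * ∑ j, |q.1 j|)
        ≤ (C₁ * Real.exp (c₁ * (∑ j, |x j| + ∑ j, |q.1 j| + ∑ j, |q.2 j|)))
          * (C₂ * Real.exp ((2 * |lam.im| + 6 * ((c₁ + b + 1) + 2 * |lam.im|)) * ∑ j, |x j|)
            * Real.exp (-((c₁ + b + 1) * ∑ j, |q.1 j|)) * Real.exp (-((c₁ + b + 1) * ∑ j, |q.2 j|)))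
          * (C₃ * edgeWeight β (gPar α β + lam.im) (q.2 0)) * Real.exp (b * ∑ j, |q.1 j|) := by
        gcongr
      _ = C₁ * C₂ * C₃ * edgeWeight β (gPar α β + lam.im) (q.2 0)
          * (Real.exp (c₁ * (∑ j, |x j| + ∑ j, |q.1 j| + ∑ j, |q.2 j|))
            * Real.exp ((2 * |lam.im| + 6 * ((c₁ + b + 1) + 2 * |lam.im|)) * ∑ j, |x j|)
            * Real.exp (-((c₁ + b + 1) * ∑ j, |q.1 j|)) * Real.exp (-((c₁ + b + 1) * ∑ j, |q.2 j|))
            * Real.exp (b * ∑ j, |q.1 j|)) := by ring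
      _ ≤ C₁ * C₂ * C₃ * edgeWeight β (gPar α β + lam.im) (q.2 0)
          * (Real.exp ((c₁ + (2 * |lam.im| + 6 * ((c₁ + b + 1) + 2 * |lam.im|))) * ∑ j, |x j|)
            * Real.exp (-∑ j, |q.1 j|) * Real.exp (-∑ j, |q.2 j|)) := by
        simp only [← Real.exp_add]
        refine mul_le_mul_of_nonneg_left (Real.exp_le_exp.2 ?_) (by positivity)
        linarith [mul_nonneg hb hz]
      _ = _ := by ring
  · have h0 : edge α β lam (q.2 0) = 0 := by
      rw [edge, heaviside, if_neg (by linarith), Complex.ofReal_zero, mul_zero]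
    rw [integrand, h0, mul_zero, norm_zero, zero_mul, dom_eq]
    positivity

end Sym

end BCToda

namespace BCToda

/-! ### Exponentially tempered functions and the operators preserving them. -/

open MeasureTheory

/-- Functions of at most exponential growth. -/
def ExpBounded {n : ℕ} (f : (Fin n → ℝ) → ℂ) : Prop :=
  ∃ a b : ℝ, 0 ≤ a ∧ 0 ≤ b ∧ ∀ x : Fin n → ℝ, ‖f x‖ ≤ a * Real.exp (b * ∑ j, |x j|)

section tempered

variable {n : ℕ}

theorem ExpBounded.add {f g : (Fin n → ℝ) → ℂ} (hf : ExpBounded f) (hg : ExpBounded g) :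
    ExpBounded (f + g) := by
  obtain ⟨a, b, ha, hb, h⟩ := hf
  obtain ⟨a', b', ha', hb', h'⟩ := hg
  refine ⟨a + a', b + b', by positivity, by positivity, fun x => ?_⟩
  have hx : 0 ≤ ∑ j, |x j| := Finset.sum_nonneg fun _ _ => abs_nonneg _
  rw [add_mul]
  refine (norm_add_le _ _).trans (add_le_add ((h x).trans ?_) ((h' x).trans ?_))
  · gcongr; linarith
  · gcongr; linarith

theorem ExpBounded.smul {f : (Fin n → ℝ) → ℂ} (hf : ExpBounded f) (c : ℂ) :
    ExpBounded (c • f) := by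
  obtain ⟨a, b, ha, hb, h⟩ := hf
  refine ⟨‖c‖ * a, b, by positivity, hb, fun x => ?_⟩
  rw [Pi.smul_apply, norm_smul, mul_assoc]
  exact mul_le_mul_of_nonneg_left (h x) (norm_nonneg _)

theorem ExpBounded.exp_mul {f : (Fin n → ℝ) → ℂ} (hf : ExpBounded f) (ε : ℝ) (j : Fin n) :
    ExpBounded fun x => (Real.exp (ε * x j) : ℂ) * f x := by
  obtain ⟨a, b, ha, hb, h⟩ := hf
  refine ⟨a, |ε| + b, ha, by positivity, fun x => ?_⟩
  have h1 : ε * x j ≤ |ε| * ∑ j, |x j| := by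
    refine (le_abs_self _).trans ?_
    rw [abs_mul]
    exact mul_le_mul_of_nonneg_left
      (Finset.single_le_sum (f := fun j => |x j|) (fun _ _ => abs_nonneg _) (Finset.mem_univ j))
      (abs_nonneg _)
  rw [norm_mul, Complex.norm_real, Real.norm_of_nonneg (Real.exp_nonneg _), add_mul, Real.exp_add,
    mul_left_comm]
  exact mul_le_mul (Real.exp_le_exp.2 h1) (h x) (norm_nonneg _) (Real.exp_nonneg _)

/-- The exponentially tempered functions form a subspace. -/
def temperedSubmodule (n : ℕ) : Submodule ℂ (SmoothFun n) where
  carrier := {f | ExpTempered f}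
  add_mem' := by
    intro f g hf hg l
    have h : ((l.map pd).prod (f + g) : SmoothFun n).1
        = ((l.map pd).prod f : SmoothFun n).1 + ((l.map pd).prod g : SmoothFun n).1 := by
      rw [map_add]
      rfl
    have := ExpBounded.add (hf l) (hg l)
    rw [← h] at this
    exact this
  zero_mem' := fun l => ⟨0, 0, le_rfl, le_rfl, fun x => by
    have h : ((l.map pd).prod (0 : SmoothFun n) : SmoothFun n).1 = 0 := by
      rw [map_zero]
      rfl
    rw [h]
    simp⟩
  smul_mem' := by
    intro c f hf l
    have h : ((l.map pd).prod (c • f) : SmoothFun n).1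
        = c • ((l.map pd).prod f : SmoothFun n).1 := by
      rw [map_smul]
      rfl
    have := ExpBounded.smul (hf l) c
    rw [← h] at this
    exact this

theorem ExpTempered.expBounded {f : SmoothFun n} (hf : ExpTempered f) : ExpBounded f.1 := hf []

theorem ExpTempered.pd {f : SmoothFun n} (hf : ExpTempered f) (j : Fin n) :
    ExpTempered (pd j f) := by
  intro l
  have := hf (l ++ [j])
  rw [List.map_append, List.prod_append] at this
  simpa using this

theorem ExpTempered.mulExp {f : SmoothFun n} (hf : ExpTempered f) (ε : ℝ) (j : Fin n) :
    ExpTempered (mulExp ε j f) := by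
  intro l
  change ExpBounded _
  -- The last derivative in the list acts first; it is commuted past the exponential, at the cost of
  -- a multiple of the same exponential.
  induction l using List.reverseRecOn generalizing f with
  | nil => exact ExpBounded.exp_mul hf.expBounded ε j
  | append_singleton l i ih =>
    have h : (((l ++ [i]).map BCToda.pd).prod (BCToda.mulExp ε j f) : SmoothFun n).1
        = ((l.map BCToda.pd).prod (BCToda.mulExp ε j (BCToda.pd i f)) : SmoothFun n).1
          + (if i = j then (ε : ℂ) else 0) • ((l.map BCToda.pd).prod (BCToda.mulExp ε j f) : SmoothFun n).1 := by
      rw [List.map_append, List.prod_append, List.map_singleton, List.prod_singleton,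
        Module.End.mul_apply, ← Module.End.mul_apply (BCToda.pd i), pd_mul_mulExp,
        LinearMap.add_apply, map_add, LinearMap.smul_apply, map_smul]
      rfl
    rw [h]
    exact (ih (hf.pd i)).add ((ih hf).smul _)

/-- The operators that preserve exponentially tempered functions. -/
def temperedOps (n : ℕ) : Subalgebra ℂ (Op n) where
  carrier := {a | ∀ f, ExpTempered f → ExpTempered (a f)}
  mul_mem' := fun ha hb _ hf => ha _ (hb _ hf)
  add_mem' := fun ha hb f hf => (temperedSubmodule n).add_mem (ha f hf) (hb f hf)
  algebraMap_mem' := fun c _ hf => (temperedSubmodule n).smul_mem c hf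

theorem opP_mem_temperedOps (k : ℕ) : opP n k ∈ temperedOps n := by
  unfold opP
  split_ifs with h
  · exact Subalgebra.smul_mem _ (fun f hf => hf.pd _) _
  · exact zero_mem _

theorem opE_mem_temperedOps (ε : ℝ) (k : ℕ) : opE n ε k ∈ temperedOps n := by
  unfold opE
  split_ifs with h
  · exact fun f hf => hf.mulExp _ _
  · exact zero_mem _

end tempered

/-- The rank one map `v ↦ v_j c`, as a linear function of `c`. -/
def coordMap {m : ℕ} (j : Fin m) : ℂ →L[ℝ] ((Fin m → ℝ) →L[ℝ] ℂ) :=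
  ContinuousLinearMap.smulRightL ℝ (Fin m → ℝ) ℂ
    (ContinuousLinearMap.proj (R := ℝ) (φ := fun _ : Fin m => ℝ) j)

theorem coordMap_apply {m : ℕ} (j : Fin m) (c : ℂ) (v : Fin m → ℝ) :
    coordMap j c v = v j • c := rfl

/-- Differentiability is known separately, so the Fréchet derivative may be read off from
one-variable derivatives. -/
theorem hasFDerivAt_of_hasDerivAt_update {m : ℕ} {f : (Fin m → ℝ) → ℂ} {f' : Fin m → ℂ}
    {x : Fin m → ℝ} (hf : DifferentiableAt ℝ f x)
    (h : ∀ j, HasDerivAt (fun s => f (Function.update x j s)) (f' j) (x j)) :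
    HasFDerivAt f (∑ j, coordMap j (f' j)) x := by
  have h1 : ∀ j, fderiv ℝ f x (Pi.single j 1) = f' j := by
    intro j
    refine HasDerivAt.unique ?_ (h j)
    have h2 := hasDerivAt_update x j (x j)
    have h3 : HasFDerivAt f (fderiv ℝ f x) (Function.update x j (x j)) := by
      rw [Function.update_eq_self]
      exact hf.hasFDerivAt
    exact h3.comp_hasDerivAt (x j) h2
  have h2 : fderiv ℝ f x = ∑ j, coordMap j (f' j) := by
    refine ContinuousLinearMap.ext fun v => ?_
    have h3 := LinearMap.pi_apply_eq_sum_univ (fderiv ℝ f x : (Fin m → ℝ) →ₗ[ℝ] ℂ) v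
    refine h3.trans ?_
    rw [sum_apply]
    refine Finset.sum_congr rfl fun j _ => ?_
    rw [coordMap_apply, ← h1 j]
    have h4 : (fun i => if j = i then (1 : ℝ) else 0) = Pi.single j 1 := by
      ext i
      simp [Pi.single_apply, eq_comm]
    rw [h4]
    rfl
  rw [← h2]
  exact hf.hasFDerivAt

namespace Sym

theorem differentiable_ev_pt {n : ℕ} (z : Fin (n + 1) → ℝ) (y : Fin n → ℝ) (P : Sym) :
    Differentiable ℝ fun x => ev (pt x z y) P := by
  have h (i : Var) : Differentiable ℝ fun x => pt x z y i := by
    unfold pt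
    split_ifs <;> fun_prop
  induction P using induction with
  | zero => simp
  | add P Q hP hQ =>
    simp only [map_add]
    exact hP.add hQ
  | smul_mono c m =>
    simp only [map_smul, ev_mono, Finsupp.sum, smul_eq_mul]
    have h2 : Differentiable ℝ fun x => Real.exp (∑ i ∈ m.support, (m i : ℝ) * pt x z y i) := by
      fun_prop
    exact (differentiable_const c).mul (Complex.ofRealCLM.differentiable.comp h2)

theorem differentiable_bulk_pt {n : ℕ} (lam : ℂ) (z : Fin (n + 1) → ℝ) (y : Fin n → ℝ) :
    Differentiable ℝ fun x => bulk n lam (pt x z y) := by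
  simp only [bulk, linForm_pt]
  have h1 : Differentiable ℝ fun x : Fin (n + 1) → ℝ => ∑ j, x j + ∑ j, y j - 2 * ∑ j, z j := by
    fun_prop
  have h2 := (Complex.ofRealCLM.differentiable.comp h1)
  exact ((h2.const_mul (Complex.I * lam)).sub (differentiable_ev_pt z y (couplings n))).cexp

/-- The symbol of the total derivative of a symbol times the kernel, with respect to a variable
other than `z_0`. -/
def totalD (n : ℕ) (lam : ℂ) (i : Var) (P : Sym) : Sym := D i P + P * bulkLogD n lam i

/-! ### Differentiation of the raising integral under the integral sign. -/

section functional

variable {α β : ℝ} {n : ℕ} {lam : ℂ}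

theorem measurable_integrand (P : Sym) (x : Fin (n + 1) → ℝ) :
    Measurable (integrand α β n lam P x) := by
  have hc (i : Var) : Continuous fun q : (Fin n → ℝ) × (Fin (n + 1) → ℝ) =>
      pt x q.2 q.1 i :=
    Continuous.comp' (g := fun q : (Fin (n + 1) → ℝ) × (Fin n → ℝ) × (Fin (n + 1) → ℝ) =>
      pt q.1 q.2.2 q.2.1 i) (continuous_pt i) (continuous_const.prodMk continuous_id)
  refine Measurable.mul (Measurable.mul ?_ ?_) ?_
  · exact (continuous_ev hc P).measurable
  · refine Continuous.measurable ?_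
    have h2 := continuous_ev hc (couplings n)
    simp only [bulk, linForm]
    fun_prop
  · exact (measurable_edge α β lam).comp (by fun_prop)

theorem norm_integrand_mul_le (hβ : 0 < β) (P : Sym) {ψ : (Fin n → ℝ) → ℂ} (hψ : ExpBounded ψ) :
    ∃ C c, 0 ≤ C ∧ 0 ≤ c ∧
      ∀ (x : Fin (n + 1) → ℝ) (q : (Fin n → ℝ) × (Fin (n + 1) → ℝ)),
        ‖integrand α β n lam P x q * ψ q.1‖
          ≤ C * Real.exp (c * ∑ j, |x j|) * dom β (gPar α β + lam.im) q := by
  obtain ⟨a, b, ha, hb, h⟩ := hψ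
  obtain ⟨C, c, hC, hc, h'⟩ := norm_integrand_le hβ α n lam P hb
  refine ⟨a * C, c, by positivity, hc, fun x q => ?_⟩
  rw [norm_mul]
  calc
    ‖integrand α β n lam P x q‖ * ‖ψ q.1‖
      ≤ ‖integrand α β n lam P x q‖ * (a * Real.exp (b * ∑ j, |q.1 j|)) := by gcongr; exact h q.1
    _ = a * (‖integrand α β n lam P x q‖ * Real.exp (b * ∑ j, |q.1 j|)) := by ring
    _ ≤ a * (C * Real.exp (c * ∑ j, |x j|) * dom β (gPar α β + lam.im) q) := by
      exact mul_le_mul_of_nonneg_left (h' x q) ha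
    _ = _ := by ring

theorem integrable_integrand_mul (hβ : 0 < β) (hσ : 0 < gPar α β + lam.im) (P : Sym)
    {ψ : (Fin n → ℝ) → ℂ} (hc : Continuous ψ) (hψ : ExpBounded ψ) (x : Fin (n + 1) → ℝ) :
    Integrable fun q => integrand α β n lam P x q * ψ q.1 := by
  obtain ⟨C, c, hC, hc', h⟩ := norm_integrand_mul_le (α := α) (lam := lam) hβ P hψ
  refine ((integrable_dom hβ hσ n).const_mul (C * Real.exp (c * ∑ j, |x j|))).mono' ?_
    (Filter.Eventually.of_forall fun q => h x q)
  exact ((measurable_integrand P x).mul (hc.measurable.comp measurable_fst)).aestronglyMeasurable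

/-- The raising operator without prefactor, with a symbol inserted into the integrand. -/
def symInt (α β : ℝ) (n : ℕ) (lam : ℂ) (ψ : (Fin n → ℝ) → ℂ) (P : Sym) (x : Fin (n + 1) → ℝ) : ℂ :=
  ∫ q, integrand α β n lam P x q * ψ q.1

theorem integrand_hasFDerivAt (P : Sym) (x : Fin (n + 1) → ℝ)
    (q : (Fin n → ℝ) × (Fin (n + 1) → ℝ)) (c : ℂ) :
    HasFDerivAt (fun x => integrand α β n lam P x q * c)
      (∑ j : Fin (n + 1), coordMap j
        (integrand α β n lam (totalD n lam (0, (j : ℕ)) P) x q * c)) x := by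
  refine hasFDerivAt_of_hasDerivAt_update ?_ fun j => ?_
  · exact ((((differentiable_ev_pt q.2 q.1 P).mul (differentiable_bulk_pt lam q.2 q.1)).mul_const
      _).mul_const c) x
  · have h := ev_mul_bulk_hasDerivAt n lam (pt x q.2 q.1) (0, (j : ℕ)) P (x j)
    simp only [← pt_update_x, Function.update_eq_self] at h
    exact (h.mul_const (edge α β lam (q.2 0))).mul_const c

theorem dom_nonneg (hβ : 0 < β) (σ : ℝ) (q : (Fin n → ℝ) × (Fin (n + 1) → ℝ)) :
    0 ≤ dom β σ q := by
  rw [dom_eq]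
  exact mul_nonneg (by positivity) (edgeWeight_nonneg hβ _ _)

/-- A bound uniform in a unit ball, where |x'_i| ≤ |x_i| + 1: the domination needed for
differentiating the integral. -/
theorem sum_coordMap_bound (hβ : 0 < β) {ψ : (Fin n → ℝ) → ℂ} (hψ : ExpBounded ψ)
    (P : Fin (n + 1) → Sym) (x : Fin (n + 1) → ℝ) : ∃ C, 
      ∀ q : (Fin n → ℝ) × (Fin (n + 1) → ℝ), ∀ x' ∈ Metric.ball x 1,
        ‖∑ j : Fin (n + 1), coordMap j (integrand α β n lam (P j) x' q * ψ q.1)‖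
          ≤ C * dom β (gPar α β + lam.im) q := by
  choose C c hC hc h using fun j : Fin (n + 1) =>
    norm_integrand_mul_le (α := α) (lam := lam) hβ (P j) hψ
  refine ⟨∑ j : Fin (n + 1), ‖(coordMap j : ℂ →L[ℝ] ((Fin (n + 1) → ℝ) →L[ℝ] ℂ))‖
    * (C j * Real.exp (c j * ∑ i, (|x i| + 1))), fun q x' hx' => ?_⟩
  rw [Finset.sum_mul]
  refine (norm_sum_le _ _).trans (Finset.sum_le_sum fun j _ => ?_)
  refine ((coordMap j).le_opNorm _).trans ?_
  rw [mul_assoc]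
  refine mul_le_mul_of_nonneg_left ((h j x' q).trans ?_) (norm_nonneg _)
  refine mul_le_mul_of_nonneg_right (mul_le_mul_of_nonneg_left (Real.exp_le_exp.2
    (mul_le_mul_of_nonneg_left (Finset.sum_le_sum fun i _ => ?_) (hc j))) (hC j))
    (dom_nonneg hβ _ q)
  have h1 := (dist_pi_lt_iff one_pos).1 hx' i
  rw [Real.dist_eq] at h1
  grind

theorem integrable_coordMap (hβ : 0 < β) (hσ : 0 < gPar α β + lam.im)
    {ψ : (Fin n → ℝ) → ℂ} (hc : Continuous ψ) (hψ : ExpBounded ψ) (P : Sym) (j : Fin (n + 1))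
    (x : Fin (n + 1) → ℝ) : Integrable fun q =>
      coordMap j (integrand α β n lam P x q * ψ q.1) := by
  have h := integrable_integrand_mul hβ hσ P hc hψ x
  exact (coordMap j).integrable_comp h

theorem integrable_sum_coordMap (hβ : 0 < β) (hσ : 0 < gPar α β + lam.im)
    {ψ : (Fin n → ℝ) → ℂ} (hc : Continuous ψ) (hψ : ExpBounded ψ) (P : Fin (n + 1) → Sym)
    (x : Fin (n + 1) → ℝ) : Integrable fun q =>
      ∑ j : Fin (n + 1), coordMap j (integrand α β n lam (P j) x q * ψ q.1) := by
  have h := fun j : Fin (n + 1) => integrable_coordMap hβ hσ hc hψ (P j) j x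
  exact integrable_finsetSum Finset.univ (f := fun (j : Fin (n + 1)) q => coordMap j (integrand α β n lam (P j) x q * ψ q.1)) fun j _ => h j

theorem integral_sum_coordMap (hβ : 0 < β) (hσ : 0 < gPar α β + lam.im)
    {ψ : (Fin n → ℝ) → ℂ} (hc : Continuous ψ) (hψ : ExpBounded ψ) (P : Fin (n + 1) → Sym)
    (x : Fin (n + 1) → ℝ) :
    ∫ q, ∑ j : Fin (n + 1), coordMap j (integrand α β n lam (P j) x q * ψ q.1)
      = ∑ j : Fin (n + 1), coordMap j (symInt α β n lam ψ (P j) x) := by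
  rw [integral_finsetSum _ fun j _ =>
    (coordMap j).integrable_comp (integrable_integrand_mul hβ hσ _ hc hψ x)]
  refine Finset.sum_congr rfl fun j _ => ?_
  exact (coordMap j).integral_comp_comm (integrable_integrand_mul hβ hσ _ hc hψ x)

theorem symInt_hasFDerivAt (hβ : 0 < β) (hσ : 0 < gPar α β + lam.im)
    {ψ : (Fin n → ℝ) → ℂ} (hc : Continuous ψ) (hψ : ExpBounded ψ) (P : Sym) (x : Fin (n + 1) → ℝ) :
    HasFDerivAt (symInt α β n lam ψ P)
      (∑ j : Fin (n + 1), coordMap j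
        (symInt α β n lam ψ (totalD n lam (0, (j : ℕ)) P) x)) x := by
  obtain ⟨C, hC⟩ := sum_coordMap_bound (α := α) (lam := lam) hβ hψ
    (fun j => totalD n lam (0, (j : ℕ)) P) x
  have h := hasFDerivAt_integral_of_dominated_of_fderiv_le (𝕜 := ℝ)
    (F := fun x q => integrand α β n lam P x q * ψ q.1)
    (F' := fun x q => ∑ j : Fin (n + 1), coordMap j
      (integrand α β n lam (totalD n lam (0, (j : ℕ)) P) x q * ψ q.1))
    (Metric.ball_mem_nhds x one_pos)
    (Filter.Eventually.of_forall fun x' =>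
      (integrable_integrand_mul hβ hσ P hc hψ x').aestronglyMeasurable)
    (integrable_integrand_mul hβ hσ P hc hψ x)
    (integrable_sum_coordMap hβ hσ hc hψ _ x).aestronglyMeasurable
    (Filter.Eventually.of_forall hC)
    ((integrable_dom hβ hσ n).const_mul C)
    (Filter.Eventually.of_forall fun q x' _ => integrand_hasFDerivAt P x' q (ψ q.1))
  rw [integral_sum_coordMap hβ hσ hc hψ] at h
  exact h

/-- The partial derivatives of such an integral are integrals of the same kind with another symbol,
so differentiability bootstraps itself. -/
theorem symInt_contDiff (hβ : 0 < β) (hσ : 0 < gPar α β + lam.im)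
    {ψ : (Fin n → ℝ) → ℂ} (hc : Continuous ψ) (hψ : ExpBounded ψ) (P : Sym) :
    ContDiff ℝ ∞ (symInt α β n lam ψ P) := by
  rw [contDiff_infty]
  intro k
  induction k generalizing P with
  | zero =>
    exact contDiff_zero.2 (continuous_iff_continuousAt.2 fun x =>
      (symInt_hasFDerivAt hβ hσ hc hψ P x).continuousAt)
  | succ k ih =>
    refine contDiff_succ_iff_hasFDerivAt.2 ⟨_, ?_, symInt_hasFDerivAt hβ hσ hc hψ P⟩
    refine ContDiff.sum fun j _ => ?_
    exact (coordMap j).contDiff.comp (ih _)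

theorem symInt_expBounded (hβ : 0 < β) (hσ : 0 < gPar α β + lam.im)
    {ψ : (Fin n → ℝ) → ℂ} (hψ : ExpBounded ψ) (P : Sym) :
    ExpBounded (symInt α β n lam ψ P) := by
  obtain ⟨C, c, hC, hc', h⟩ := norm_integrand_mul_le (α := α) (lam := lam) hβ P hψ
  have hI : 0 ≤ ∫ q : (Fin n → ℝ) × (Fin (n + 1) → ℝ), dom β (gPar α β + lam.im) q :=
    integral_nonneg (dom_nonneg hβ _)
  refine ⟨C * ∫ q : (Fin n → ℝ) × (Fin (n + 1) → ℝ), dom β (gPar α β + lam.im) q, c,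
    by positivity, hc', fun x => ?_⟩
  have := norm_integral_le_of_norm_le
    ((integrable_dom hβ hσ n).const_mul (C * Real.exp (c * ∑ j, |x j|)))
    (Filter.Eventually.of_forall fun q => h x q)
  refine this.trans (le_of_eq ?_)
  rw [integral_const_mul]
  ring

theorem integrand_add (P Q : Sym) (x : Fin (n + 1) → ℝ) (q : (Fin n → ℝ) × (Fin (n + 1) → ℝ)) :
    integrand α β n lam (P + Q) x q = integrand α β n lam P x q + integrand α β n lam Q x q := by
  simp only [integrand, map_add, add_mul]

theorem integrand_smul (c : ℂ) (P : Sym) (x : Fin (n + 1) → ℝ)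
    (q : (Fin n → ℝ) × (Fin (n + 1) → ℝ)) :
    integrand α β n lam (c • P) x q = c * integrand α β n lam P x q := by
  simp only [integrand, map_smul, smul_eq_mul, mul_assoc]

/-- `symInt` as a linear map from symbols to smooth functions. -/
def symMap (hβ : 0 < β) (hσ : 0 < gPar α β + lam.im) {ψ : SmoothFun n} (hψ : ExpTempered ψ) :
    Sym →ₗ[ℂ] SmoothFun (n + 1) where
  toFun P := ⟨symInt α β n lam ψ.1 P,
    symInt_contDiff hβ hσ ψ.contDiff.continuous hψ.expBounded P⟩
  map_add' P Q := by
    apply Subtype.ext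
    funext x
    refine Eq.trans ?_ (integral_add
      (integrable_integrand_mul hβ hσ P ψ.contDiff.continuous hψ.expBounded x)
      (integrable_integrand_mul hβ hσ Q ψ.contDiff.continuous hψ.expBounded x))
    exact integral_congr_ae (Filter.Eventually.of_forall fun q => by
      simp only [integrand_add, add_mul])
  map_smul' c P := by
    apply Subtype.ext
    funext x
    refine Eq.trans ?_ (integral_const_mul c _)
    exact integral_congr_ae (Filter.Eventually.of_forall fun q => by
      simp only [integrand_smul, mul_assoc])

variable (hβ : 0 < β) (hσ : 0 < gPar α β + lam.im) {ψ : SmoothFun n} (hψ : ExpTempered ψ)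

theorem pd_symMap (j : Fin (n + 1)) (P : Sym) :
    pd j (symMap hβ hσ hψ P) = symMap hβ hσ hψ (totalD n lam (0, (j : ℕ)) P) := by
  apply SmoothFun.ext
  intro x
  change fderiv ℝ (symInt α β n lam ψ.1 P) x (Pi.single j 1) = symInt α β n lam ψ.1 _ x
  rw [(symInt_hasFDerivAt hβ hσ ψ.contDiff.continuous hψ.expBounded P x).fderiv,
    sum_apply, Finset.sum_eq_single j]
  · simp [coordMap_apply]
  · intro i _ hi
    simp [coordMap_apply, hi]
  · simp

theorem mulExp_symMap (ε : ℤ) (j : Fin (n + 1)) (P : Sym) :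
    mulExp ε j (symMap hβ hσ hψ P) = symMap hβ hσ hψ (gen (0, (j : ℕ)) ε * P) := by
  apply SmoothFun.ext
  intro x
  change _ * ∫ q, _ = ∫ q, _
  rw [← integral_const_mul]
  refine integral_congr_ae (Filter.Eventually.of_forall fun q => ?_)
  simp only [integrand, map_mul, ev_gen, pt_x]
  ring

theorem expTempered_symMap (P : Sym) : ExpTempered (symMap hβ hσ hψ P) := by
  intro l
  change ExpBounded _
  induction l using List.reverseRecOn generalizing P with
  | nil => exact symInt_expBounded hβ hσ hψ.expBounded P
  | append_singleton l i ih =>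
    rw [List.map_append, List.prod_append, List.map_singleton, List.prod_singleton,
        Module.End.mul_apply, pd_symMap]
    exact ih _

end functional

end Sym

end BCToda

namespace BCToda

/-! ### Integration by parts in y and z. -/

open MeasureTheory

/-- Integrability of f and f' forces f to vanish at ±∞, and by continuity the contributions of the
two half-lines at a cancel. The exceptional point is needed at z₀ = ln β. -/
theorem integral_eq_zero_of_hasDerivAt_of_ne {f f' : ℝ → ℂ} (a : ℝ) (hc : Continuous f)
    (hd : ∀ t, t ≠ a → HasDerivAt f (f' t) t) (hf : Integrable f) (hf' : Integrable f') :
    ∫ t, f' t = 0 := by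
  have h1 := integral_Ioi_of_hasDerivAt_of_tendsto (a := a) hc.continuousWithinAt
    (fun t ht => hd t (ne_of_gt ht)) hf'.integrableOn
    (tendsto_zero_of_hasDerivAt_of_integrableOn_Ioi (a := a)
      (fun t ht => hd t (ne_of_gt ht)) hf'.integrableOn hf.integrableOn)
  have h2 := integral_Iic_of_hasDerivAt_of_tendsto (a := a) hc.continuousWithinAt
    (fun t ht => hd t (ne_of_lt ht)) hf'.integrableOn
    (tendsto_zero_of_hasDerivAt_of_integrableOn_Iic (a := a - 1)
      (fun t ht => hd t (ne_of_lt (by linarith [Set.mem_Iic.1 ht]))) hf'.integrableOn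
      hf.integrableOn)
  have h3 := intervalIntegral.integral_Iic_add_Ioi (b := a) hf'.integrableOn hf'.integrableOn
  rw [← h3, h1, h2]
  ring

/-- Coordinate i is split off by a measure-preserving equivalence; Fubini reduces the claim to
almost every line in that direction. -/
theorem integral_pi_eq_zero_of_hasDerivAt {m : ℕ} {F F' : (Fin m → ℝ) → ℂ} (i : Fin m) (a : ℝ)
    (hc : ∀ z, Continuous fun s => F (Function.update z i s))
    (hd : ∀ z t, t ≠ a →
      HasDerivAt (fun s => F (Function.update z i s)) (F' (Function.update z i t)) t)
    (hF : Integrable F) (hF' : Integrable F') : ∫ z, F' z = 0 := by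
  cases m with
  | zero => exact i.elim0
  | succ m =>
    let e : ℝ × (Fin m → ℝ) ≃ᵐ (Fin (m + 1) → ℝ) :=
      (MeasurableEquiv.piFinSuccAbove (fun _ => ℝ) i).symm
    have he : MeasurePreserving e :=
      (volume_preserving_piFinSuccAbove (fun _ : Fin (m + 1) => ℝ) i).symm _
    have h1 : Integrable fun p => F (e p) := he.integrable_comp_of_integrable hF
    have h2 : Integrable fun p => F' (e p) := he.integrable_comp_of_integrable hF'
    have hu (t : ℝ) (w : Fin m → ℝ) : e (t, w) = Function.update (e (0, w)) i t :=
      (Fin.update_insertNth (α := fun _ => ℝ) i 0 t w).symm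
    rw [← he.integral_comp' (f := e) F', Measure.volume_eq_prod, integral_prod_symm _ h2]
    refine integral_eq_zero_of_ae ?_
    filter_upwards [h1.prod_left_ae, h2.prod_left_ae] with w h3 h4
    have hw : (fun t => F (e (t, w))) = fun t => F (Function.update (e (0, w)) i t) :=
      funext fun t => congrArg F (hu t w)
    refine integral_eq_zero_of_hasDerivAt_of_ne (f := fun t => F (e (t, w))) a ?_ ?_ h3 h4
    · rw [hw]
      exact hc _
    · intro t ht
      rw [hw, hu t w]
      exact hd _ t ht

section prod

variable {m m' : ℕ} {F F' : (Fin m → ℝ) × (Fin m' → ℝ) → ℂ}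

theorem integral_prod_eq_zero_of_hasDerivAt_snd (i : Fin m') (a : ℝ)
    (hc : ∀ y z, Continuous fun s => F (y, Function.update z i s))
    (hd : ∀ y z t, t ≠ a →
      HasDerivAt (fun s => F (y, Function.update z i s)) (F' (y, Function.update z i t)) t)
    (hF : Integrable F) (hF' : Integrable F') : ∫ q, F' q = 0 := by
  rw [Measure.volume_eq_prod, integral_prod _ hF']
  refine integral_eq_zero_of_ae ?_
  filter_upwards [hF.prod_right_ae, hF'.prod_right_ae] with y h3 h4
  exact integral_pi_eq_zero_of_hasDerivAt i a (hc y) (hd y) h3 h4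

theorem integral_prod_eq_zero_of_hasDerivAt_fst (i : Fin m)
    (hd : ∀ y z t, HasDerivAt (fun s => F (Function.update y i s, z)) (F' (Function.update y i t, z)) t)
    (hF : Integrable F) (hF' : Integrable F') : ∫ q, F' q = 0 := by
  rw [Measure.volume_eq_prod, integral_prod_symm _ hF']
  refine integral_eq_zero_of_ae ?_
  filter_upwards [hF.prod_left_ae, hF'.prod_left_ae] with z h3 h4
  refine integral_pi_eq_zero_of_hasDerivAt (F := fun y => F (y, z)) i 0 (fun y => ?_)
    (fun y t _ => hd y z t) h3 h4
  exact continuous_iff_continuousAt.2 fun t => (hd y z t).continuousAt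

end prod

theorem HasDerivAt.ofReal_cpow_const {f : ℝ → ℝ} {f' t : ℝ} (h : HasDerivAt f f' t)
    (ht : 0 < f t) (s : ℂ) :
    HasDerivAt (fun t => (f t : ℂ) ^ s) (f' * s * (f t : ℂ) ^ (s - 1)) t := by
  have h1 : HasDerivAt (fun w : ℂ => w ^ s) (s * (f t : ℂ) ^ (s - 1) * 1) (f t : ℂ) :=
    (hasDerivAt_id (f t : ℂ)).cpow_const (Complex.ofReal_mem_slitPlane.2 ht)
  refine (HasDerivAt.scomp t h1 h.ofReal_comp).congr_deriv ?_
  rw [smul_eq_mul]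
  ring

namespace Sym

section edge

variable {α β : ℝ} {lam : ℂ}

theorem edge_eq_zero {t : ℝ} (ht : t < Real.log β) : edge α β lam t = 0 := by
  rw [edge, heaviside, if_neg (by linarith), Complex.ofReal_zero, mul_zero]

theorem edge_eq {t : ℝ} (ht : Real.log β ≤ t) : edge α β lam t =
    ((1 + β * Real.exp (-t) : ℝ) : ℂ) ^ (-Complex.I * lam - (gPar α β : ℂ))
      * ((1 - β * Real.exp (-t) : ℝ) : ℂ) ^ (-Complex.I * lam + (gPar α β : ℂ) - 1) := by
  rw [edge, heaviside, if_pos (by linarith), Complex.ofReal_one, mul_one]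

/-- The boundary factor multiplied by `1 - β² e^{-2t}`. -/
def edgeReg (α β : ℝ) (lam : ℂ) (t : ℝ) : ℂ :=
  edge α β lam t * (1 - (β : ℂ) ^ 2 * (Real.exp (-t) : ℂ) ^ 2)

theorem edgeReg_eq (hβ : 0 < β) {t : ℝ} (ht : Real.log β < t) : edgeReg α β lam t =
    ((1 + β * Real.exp (-t) : ℝ) : ℂ) ^ (-Complex.I * lam - (gPar α β : ℂ) + 1)
      * ((1 - β * Real.exp (-t) : ℝ) : ℂ) ^ (-Complex.I * lam + (gPar α β : ℂ)) := by
  have h1 : (0 : ℝ) < 1 + β * Real.exp (-t) := by positivity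
  have h2 : (0 : ℝ) < 1 - β * Real.exp (-t) := by linarith [mul_exp_neg_lt_one hβ ht]
  have h1' : ((1 + β * Real.exp (-t) : ℝ) : ℂ) ≠ 0 := Complex.ofReal_ne_zero.2 h1.ne'
  have h2' : ((1 - β * Real.exp (-t) : ℝ) : ℂ) ≠ 0 := Complex.ofReal_ne_zero.2 h2.ne'
  rw [edgeReg, edge_eq ht.le, Complex.cpow_add _ _ h1', Complex.cpow_sub _ _ h2', Complex.cpow_one,
    Complex.cpow_one]
  have h3 : (1 - (β : ℂ) ^ 2 * (Real.exp (-t) : ℂ) ^ 2)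
      = ((1 + β * Real.exp (-t) : ℝ) : ℂ) * ((1 - β * Real.exp (-t) : ℝ) : ℂ) := by
    push_cast
    ring
  rw [h3]
  field_simp

/-- The extra factor raises the exponent of 1 - β e^{-t} to one with positive real part g + Im λ.
The function therefore reaches 0 at ln β and can be rewritten with a positive part on the whole
line. -/
theorem continuous_edgeReg (hβ : 0 < β) (hσ : 0 < gPar α β + lam.im) :
    Continuous (edgeReg α β lam) := by
  have hs : 0 < (-Complex.I * lam + (gPar α β : ℂ)).re := by
    simpa [add_comm] using hσ
  have h : edgeReg α β lam = fun t =>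
      ((1 + β * Real.exp (-t) : ℝ) : ℂ) ^ (-Complex.I * lam - (gPar α β : ℂ) + 1)
      * ((max (1 - β * Real.exp (-t)) 0 : ℝ) : ℂ) ^ (-Complex.I * lam + (gPar α β : ℂ)) := by
    funext t
    have h0 : (0 : ℂ) ^ (-Complex.I * lam + (gPar α β : ℂ)) = 0 :=
      Complex.zero_cpow fun h => by rw [h] at hs; simp at hs
    rcases lt_trichotomy t (Real.log β) with ht | ht | ht
    · have h1 : 1 ≤ β * Real.exp (-t) := by
        calc (1 : ℝ) ≤ Real.exp (Real.log β - t) := Real.one_le_exp (by linarith)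
          _ = β * Real.exp (-t) := by rw [sub_eq_add_neg, Real.exp_add, Real.exp_log hβ]
      rw [max_eq_right (by linarith), Complex.ofReal_zero, h0, mul_zero, edgeReg, edge_eq_zero ht,
        zero_mul]
    · have h1 : β * Real.exp (-t) = 1 := by
        rw [ht, Real.exp_neg, Real.exp_log hβ, mul_inv_cancel₀ hβ.ne']
      have h2 : (β : ℂ) * (Real.exp (-t) : ℂ) = 1 := by exact_mod_cast h1
      rw [h1, sub_self, max_self, Complex.ofReal_zero, h0, mul_zero, edgeReg, ← mul_pow, h2]
      simp
    · have h2 : (0 : ℝ) < 1 - β * Real.exp (-t) := by linarith [mul_exp_neg_lt_one hβ ht]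
      rw [max_eq_left h2.le, edgeReg_eq hβ ht]
  rw [h]
  refine Continuous.mul (continuous_iff_continuousAt.2 fun t => ?_) ?_
  · have h1 : (0 : ℝ) < 1 + β * Real.exp (-t) := by positivity
    exact (Complex.continuousAt_ofReal_cpow_const _ _ (Or.inr h1.ne')).comp
      (f := fun t => 1 + β * Real.exp (-t)) (by fun_prop)
  · exact (Complex.continuous_ofReal_cpow_const hs).comp
      (f := fun t => max (1 - β * Real.exp (-t)) 0) (by fun_prop)

theorem edgeReg_hasDerivAt (hβ : 0 < β) {t : ℝ} (ht : t ≠ Real.log β) :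
    HasDerivAt (edgeReg α β lam) (edge α β lam t * (2 * α * (Real.exp (-t) : ℂ)
      + (1 - 2 * Complex.I * lam) * (β : ℂ) ^ 2 * (Real.exp (-t) : ℂ) ^ 2)) t := by
  rcases ht.lt_or_gt with ht | ht
  · rw [edge_eq_zero ht, zero_mul]
    refine (hasDerivAt_const t (0 : ℂ)).congr_of_eventuallyEq ?_
    filter_upwards [Iio_mem_nhds ht] with s hs
    rw [edgeReg, edge_eq_zero hs, zero_mul]
  · have h1 : (0 : ℝ) < 1 + β * Real.exp (-t) := by positivity
    have h2 : (0 : ℝ) < 1 - β * Real.exp (-t) := by linarith [mul_exp_neg_lt_one hβ ht]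
    have d1 : HasDerivAt (fun t => 1 + β * Real.exp (-t)) (-(β * Real.exp (-t))) t := by
      refine (((hasDerivAt_neg t).exp.const_mul β).const_add 1).congr_deriv ?_
      ring
    have d2 : HasDerivAt (fun t => 1 - β * Real.exp (-t)) (β * Real.exp (-t)) t := by
      refine (((hasDerivAt_neg t).exp.const_mul β).const_sub 1).congr_deriv ?_
      ring
    have d := (HasDerivAt.ofReal_cpow_const d1 h1 (-Complex.I * lam - (gPar α β : ℂ) + 1)).mul
      (HasDerivAt.ofReal_cpow_const d2 h2 (-Complex.I * lam + (gPar α β : ℂ)))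
    refine (d.congr_of_eventuallyEq ?_).congr_deriv ?_
    · filter_upwards [Ioi_mem_nhds ht] with s hs
      exact edgeReg_eq hβ hs
    · have h1' : ((1 + β * Real.exp (-t) : ℝ) : ℂ) ≠ 0 := Complex.ofReal_ne_zero.2 h1.ne'
      have h2' : ((1 - β * Real.exp (-t) : ℝ) : ℂ) ≠ 0 := Complex.ofReal_ne_zero.2 h2.ne'
      -- The definition of g enters here: it makes the term linear in e^{-t} equal to 2α e^{-t}, as
      -- the boundary matrix demands.
      have hg : (α : ℂ) = β * (gPar α β - 1 / 2) := by
        rw [gPar]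
        push_cast
        have hb : (β : ℂ) ≠ 0 := Complex.ofReal_ne_zero.2 hβ.ne'
        field_simp
        ring
      have e2 : ((1 - β * Real.exp (-t) : ℝ) : ℂ) ^ (-Complex.I * lam + (gPar α β : ℂ))
          = ((1 - β * Real.exp (-t) : ℝ) : ℂ) ^ (-Complex.I * lam + (gPar α β : ℂ) - 1)
            * ((1 - β * Real.exp (-t) : ℝ) : ℂ) := by
        rw [Complex.cpow_sub _ _ h2', Complex.cpow_one]
        field_simp
      rw [edge_eq ht.le, e2, Complex.cpow_add _ _ h1', add_sub_cancel_right, Complex.cpow_one, hg]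
      push_cast
      ring

end edge

theorem ev_bdry (β : ℝ) (v : Var → ℝ) :
    ev v (bdry β) = 1 - (β : ℂ) ^ 2 * (Real.exp (-v (2, 0)) : ℂ) ^ 2 := by
  simp only [bdry, map_sub, map_one, map_mul, map_pow, ev_gen, ev_sc]
  simp

section ibp

variable {α β : ℝ} {n : ℕ} {lam : ℂ} (hβ : 0 < β) (hσ : 0 < gPar α β + lam.im)
  {ψ : (Fin n → ℝ) → ℂ} (hc : Continuous ψ) (hψ : ExpBounded ψ)
include hβ hσ hc hψ

theorem symInt_totalD_z_succ {j : ℕ} (hj : j + 1 ≤ n) (P : Sym) (x : Fin (n + 1) → ℝ) :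
    symInt α β n lam ψ (totalD n lam (2, j + 1) P) x = 0 := by
  have hd (y : Fin n → ℝ) (z : Fin (n + 1) → ℝ) (t : ℝ) : HasDerivAt
      (fun s => integrand α β n lam P x (y, Function.update z ⟨j + 1, by omega⟩ s) * ψ y)
      (integrand α β n lam (totalD n lam (2, j + 1) P) x
        (y, Function.update z ⟨j + 1, by omega⟩ t) * ψ y) t := by
    have h := ev_mul_bulk_hasDerivAt n lam (pt x z y) (2, j + 1) P t
    have h0 (s : ℝ) : Function.update z ⟨j + 1, by omega⟩ s 0 = z 0 := by
      rw [Function.update_of_ne]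
      simp [Fin.ext_iff]
    have hu (s : ℝ) : Function.update (pt x z y) (2, j + 1) s
        = pt x (Function.update z ⟨j + 1, by omega⟩ s) y := (pt_update_z x z y ⟨j + 1, by omega⟩ s).symm
    simp only [hu] at h
    simp only [integrand, h0]
    exact (h.mul_const (edge α β lam (z 0))).mul_const (ψ y)
  exact integral_prod_eq_zero_of_hasDerivAt_snd
    (F := fun q => integrand α β n lam P x q * ψ q.1) ⟨j + 1, by omega⟩ 0
    (fun y z => continuous_iff_continuousAt.2 fun t => (hd y z t).continuousAt)
    (fun y z t _ => hd y z t) (integrable_integrand_mul hβ hσ _ hc hψ x)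
    (integrable_integrand_mul hβ hσ _ hc hψ x)

/-- The symbol integrated by parts is P times `bdry`; with this factor the edge becomes `edgeReg`,
so no boundary term arises at ln β. -/
theorem symInt_zTotal_zero (P : Sym) (x : Fin (n + 1) → ℝ) :
    symInt α β n lam ψ (zTotal α β lam 0 (upSum n 0) P) x = 0 := by
  have hu (y : Fin n → ℝ) (z : Fin (n + 1) → ℝ) (s : ℝ) : Function.update (pt x z y) (2, 0) s
      = pt x (Function.update z 0 s) y := (pt_update_z x z y 0 s).symm
  have hz (y : Fin n → ℝ) (z : Fin (n + 1) → ℝ) (s : ℝ) :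
      pt x (Function.update z 0 s) y (2, 0) = s := by
    rw [← hu, Function.update_self]
  have hF (y : Fin n → ℝ) (z : Fin (n + 1) → ℝ) :
      (fun s => integrand α β n lam (P * bdry β) x (y, Function.update z 0 s) * ψ y) = fun s =>
        ev (Function.update (pt x z y) (2, 0) s) P * bulk n lam (Function.update (pt x z y) (2, 0) s)
          * edgeReg α β lam s * ψ y := by
    funext s
    rw [integrand, map_mul, ev_bdry, hz]
    simp only [hu, edgeReg, Function.update_self]
    ring
  refine integral_prod_eq_zero_of_hasDerivAt_snd
    (F := fun q => integrand α β n lam (P * bdry β) x q * ψ q.1) 0 (Real.log β)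
    (fun y z => ?_) (fun y z t ht => ?_) (integrable_integrand_mul hβ hσ _ hc hψ x)
    (integrable_integrand_mul hβ hσ _ hc hψ x)
  · simp only [hF]
    refine Continuous.mul (Continuous.mul ?_ (continuous_edgeReg hβ hσ)) continuous_const
    exact continuous_iff_continuousAt.2 fun t =>
      (ev_mul_bulk_hasDerivAt n lam (pt x z y) (2, 0) P t).continuousAt
  · simp only [hF]
    refine (((ev_mul_bulk_hasDerivAt n lam (pt x z y) (2, 0) P t).mul
      (edgeReg_hasDerivAt hβ ht)).mul_const (ψ y)).congr_deriv ?_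
    have e1 : ev (pt x (Function.update z 0 t) y) (gen (2, 0) (-1)) = (Real.exp (-t) : ℂ) := by
      rw [ev_gen, hz]
      simp
    simp only [hu, integrand, zTotal, bulkLogD_z_zero, dBdry, bdry, map_add, map_sub, map_mul,
      map_neg, map_ofNat, map_pow, map_one, ev_sc, e1, edgeReg, Function.update_self]
    ring

theorem symInt_zTotal {j : ℕ} (hj : j ≤ n) (P : Sym) (x : Fin (n + 1) → ℝ) :
    symInt α β n lam ψ (zTotal α β lam j (upSum n j) P) x = 0 := by
  cases j with
  | zero => exact symInt_zTotal_zero hβ hσ hc hψ P x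
  | succ j =>
    have h : zTotal α β lam (j + 1) (upSum n (j + 1)) P = totalD n lam (2, j + 1) P := by
      rw [zTotal, totalD, bulkLogD_z_succ hj]
      ring
    rw [h]
    exact symInt_totalD_z_succ hβ hσ hc hψ hj P x

end ibp

section functional

variable {α β : ℝ} {n : ℕ} {lam : ℂ} (hβ : 0 < β) (hσ : 0 < gPar α β + lam.im)
  {ψ : SmoothFun n} (hψ : ExpTempered ψ)

theorem symMap_zTotal {j : ℕ} (hj : j < n) (P : Sym) :
    symMap hβ hσ hψ (zTotal α β lam j (up 0 j + up 1 j) P) = 0 := by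
  apply SmoothFun.ext
  intro x
  have h := symInt_zTotal hβ hσ ψ.contDiff.continuous hψ.expBounded hj.le P x
  rw [upSum, if_pos hj] at h
  exact h

theorem symMap_zTotal_last (P : Sym) :
    symMap hβ hσ hψ (zTotal α β lam n (up 0 n) P) = 0 := by
  apply SmoothFun.ext
  intro x
  have h := symInt_zTotal hβ hσ ψ.contDiff.continuous hψ.expBounded le_rfl P x
  rw [upSum, if_neg (lt_irrefl n)] at h
  exact h

/-- Integration by parts in y_j; boundary terms are absent because the kernel outweighs the growth
of ψ. -/
theorem symMap_pd (j : Fin n) (P : Sym) :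
    symMap hβ hσ (hψ.pd j) P = -symMap hβ hσ hψ (totalD n lam (1, (j : ℕ)) P) := by
  refine eq_neg_of_add_eq_zero_right ?_
  apply SmoothFun.ext
  intro x
  have h1 := integrable_integrand_mul hβ hσ (totalD n lam (1, (j : ℕ)) P) ψ.contDiff.continuous
    hψ.expBounded x
  have h2 := integrable_integrand_mul hβ hσ P (pd j ψ).contDiff.continuous
    (hψ.pd j).expBounded x
  refine (integral_add h1 h2).symm.trans ?_
  refine integral_prod_eq_zero_of_hasDerivAt_fst
    (F := fun q => integrand α β n lam P x q * ψ.1 q.1) j (fun y z t => ?_)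
    (integrable_integrand_mul hβ hσ _ ψ.contDiff.continuous hψ.expBounded x) (h1.add h2)
  have h := ev_mul_bulk_hasDerivAt n lam (pt x z y) (1, (j : ℕ)) P t
  simp only [← pt_update_y] at h
  have h3 : HasDerivAt (fun s => ψ.1 (Function.update y j s))
      ((pd j ψ).1 (Function.update y j t)) t :=
    (ψ.differentiableAt (Function.update y j t)).hasFDerivAt.comp_hasDerivAt t
      (hasDerivAt_update y j t)
  refine ((h.mul_const (edge α β lam (z 0))).mul h3).congr_deriv ?_
  rfl

theorem symMap_mulExp (ε : ℤ) (j : Fin n) (P : Sym) :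
    symMap hβ hσ (hψ.mulExp ε j) P = symMap hβ hσ hψ (gen (1, (j : ℕ)) ε * P) := by
  apply SmoothFun.ext
  intro x
  refine integral_congr_ae (Filter.Eventually.of_forall fun q => ?_)
  change integrand α β n lam P x q * (_ * ψ.1 q.1) = _
  simp only [integrand, map_mul, ev_gen, pt_y]
  ring

end functional

end Sym

end BCToda

namespace BCToda

/-! ### Operators acting as multiplication by symbols. -/

namespace Sym

theorem mem_indep_succ {a : Fin 3} {k : ℕ} {P : Sym} :
    P ∈ indep a (k + 1) ↔ P ∈ indep a k ∧ D (a, k) P = 0 :=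
  ⟨fun h => ⟨fun j hj => h j (by omega), h k (by omega)⟩, fun h j hj => by
    rcases Nat.lt_succ_iff_lt_or_eq.1 hj with h' | rfl
    · exact h.1 j h'
    · exact h.2⟩

/-- The data of operators `d'` act on the image of `T` by multiplication with the symbols `d`. -/
structure Acts {V : Type*} [AddCommGroup V] [Module ℂ V] (T : Sym →ₗ[ℂ] V) (K : Subalgebra ℂ Sym)
    (d' : MonodromyData (Module.End ℂ V)) (d : MonodromyData Sym) : Prop where
  b : ∀ P ∈ K, d'.b (T P) = T (d.b * P)
  f : ∀ P ∈ K, d'.f (T P) = T (d.f * P)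
  h : ∀ P ∈ K, d'.h (T P) = T (d.h * P)
  c : ∀ P ∈ K, d'.c (T P) = T (d.c * P)

/-- The data of operators `d'` act on the first argument of `B` by the transposed symbols. -/
structure ActsTransposed {V W : Type*} [AddCommGroup V] [Module ℂ V] [AddCommGroup W] [Module ℂ W]
    (B : W →ₗ[ℂ] Sym →ₗ[ℂ] V) (K : Subalgebra ℂ Sym)
    (d' : MonodromyData (Module.End ℂ W)) (d : MonodromyData Sym) : Prop where
  b : ∀ ψ, ∀ P ∈ K, B (d'.b ψ) P = B ψ (d.b * P)
  f : ∀ ψ, ∀ P ∈ K, B (d'.f ψ) P = B ψ ((d.f + sc Complex.I * d.h) * P)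
  h : ∀ ψ, ∀ P ∈ K, B (d'.h ψ) P = -B ψ (d.h * P)
  c : ∀ ψ, ∀ P ∈ K, B (d'.c ψ) P = B ψ (d.c * P)

variable {V W : Type*} [AddCommGroup V] [Module ℂ V] [AddCommGroup W] [Module ℂ W]

theorem smul_apply_sym (T : Sym →ₗ[ℂ] V) (c : ℂ) (Q : Sym) : c • T Q = T (sc c * Q) := by
  rw [← map_smul, Algebra.smul_def]

/-- The new particle's operators act on the integral before the old data do. Their symbols do not
contain the earlier variables of the same kind, so the old data still act by multiplication. -/
theorem Acts.step {T : Sym →ₗ[ℂ] V} {a : Fin 3} {k : ℕ}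
    {d' : MonodromyData (Module.End ℂ V)} {d : MonodromyData Sym} (hd : Acts T (indep a k) d' d)
    {lam w : ℂ} {t r X X' : Sym} (hX : X ∈ indep a k) (hX' : X' ∈ indep a k)
    (ht : t ∈ indep a k) (hr : r ∈ indep a k) (hDt : D (a, k) t = -t) (hDr : D (a, k) r = r)
    {p e e' : Module.End ℂ V}
    (hp : ∀ P, p (T P)
      = T (sc Complex.I * (D (a, k) P + P * (sc Complex.I * sc lam + t - r))))
    (he : ∀ P, e (T P) = T (X * P)) (he' : ∀ P, e' (T P) = T (X' * P)) :
    Acts T (indep a (k + 1)) (MonodromyData.step (algebraMap ℂ _ w) p e e' d')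
      (symStep (sc Complex.I) (sc (1 / 2)) (sc lam) (sc w) X X' t r d) := by
  have hA : sc Complex.I * sc lam + t - r ∈ indep a k :=
    sub_mem (add_mem (mul_mem (sc_mem_indep _ _ _) (sc_mem_indep _ _ _)) ht) hr
  have hDA : D (a, k) (sc Complex.I * sc lam + t - r) = -t - r := by
    simp [Derivation.leibniz, hDt, hDr]
  generalize hAe : sc Complex.I * sc lam + t - r = A at *
  have hp1 {P : Sym} (hP : P ∈ indep a (k + 1)) : p (T P) = T (sc Complex.I * (A * P)) := by
    rw [hp, (mem_indep_succ.1 hP).2, zero_add, mul_comm P]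
  -- The square is i²(A² + D A), with D A = -t - r.
  have hp2 {P : Sym} (hP : P ∈ indep a (k + 1)) :
      p (T (sc Complex.I * (A * P))) = T (-(A ^ 2 - t - r) * P) := by
    rw [hp, Derivation.leibniz, Derivation.leibniz, hDA, D_sc, (mem_indep_succ.1 hP).2]
    congr 1
    simp only [smul_eq_mul]
    linear_combination (P * (-t - r) + A ^ 2 * P) * sc_I_mul_I
  have hI := sc_mem_indep a k Complex.I
  have h2 : sc (2 : ℂ) = 2 := map_ofNat _ 2
  have hI2 : sc (Complex.I / 2) = sc Complex.I * sc (1 / 2) := by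
    rw [← map_mul]
    congr 1
    ring
  refine ⟨fun P hP => ?_, fun P hP => ?_, fun P hP => ?_, fun P hP => ?_⟩
  all_goals have hP' := (mem_indep_succ.1 hP).1
  all_goals have hIA := mul_mem hI (mul_mem hA hP')
  all_goals simp only [MonodromyData.step, symStep, hAe, LinearMap.sub_apply, LinearMap.add_apply,
    LinearMap.smul_apply, LinearMap.neg_apply, Module.End.mul_apply, Module.algebraMap_end_apply,
    hp1 hP, hp2 hP, he, he']
  · rw [hd.b _ (mul_mem (neg_mem (sub_mem (sub_mem (pow_mem hA 2) ht) hr)) hP'), hd.b _ hP',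
      hd.h _ (mul_mem hX' hIA), hd.f _ (mul_mem hX' hP'), hd.c _ (mul_mem hX' (mul_mem hX' hP'))]
    simp only [smul_apply_sym, ← map_sub, h2]
    congr 1
    ring
  · rw [hd.f _ hP', hd.h _ hP', hd.b _ (mul_mem hX hP'), hd.b _ (mul_mem hX hIA)]
    simp only [smul_apply_sym, ← map_sub, ← map_add, hI2]
    congr 1
    linear_combination (-sc (1 / 2) * d.b * X * A * P) * sc_I_mul_I
  · rw [hd.b _ (mul_mem hX hIA), hd.b _ (mul_mem hX hP'), hd.h _ hP']
    simp only [smul_apply_sym, ← map_sub, ← map_add, hI2]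
    congr 1
    ring
  · rw [hd.b _ (mul_mem hX (mul_mem hX hP')), ← map_neg]
    congr 1
    ring

/-- Transposition reverses the order: the old data multiply first and p differentiates afterwards,
so they must be constant in the new variable. The reversal turns (f, h) into (f + i h, -h), which
interchanges the diagonal entries of `toMatrix` and leaves b and c alone. -/
theorem ActsTransposed.step {B : W →ₗ[ℂ] Sym →ₗ[ℂ] V} {a : Fin 3} {k : ℕ}
    {d' : MonodromyData (Module.End ℂ W)} {d : MonodromyData Sym}
    (hd : ActsTransposed B (indep a k) d' d)
    (hDd : D (a, k) d.b = 0 ∧ D (a, k) d.f = 0 ∧ D (a, k) d.h = 0 ∧ D (a, k) d.c = 0)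
    {lam w : ℂ} {t r X X' : Sym} (hDX : D (a, k) X = X) (hDX' : D (a, k) X' = -X')
    (hDt : D (a, k) t = -t) (hDr : D (a, k) r = r)
    {p e e' : Module.End ℂ W}
    (hp : ∀ ψ P, B (p ψ) P
      = -B ψ (sc Complex.I * (D (a, k) P + P * (sc Complex.I * sc lam + t - r))))
    (he : ∀ ψ P, B (e ψ) P = B ψ (X * P)) (he' : ∀ ψ P, B (e' ψ) P = B ψ (X' * P)) :
    ActsTransposed B (indep a (k + 1)) (MonodromyData.step (algebraMap ℂ _ w) p e e' d')
      (symStep (sc Complex.I) (sc (1 / 2)) (sc lam) (sc w) X X' t r d) := by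
  obtain ⟨hb, -, hh, -⟩ := hDd
  have hDA : D (a, k) (sc Complex.I * sc lam + t - r) = -t - r := by
    simp [Derivation.leibniz, hDt, hDr]
  generalize hAe : sc Complex.I * sc lam + t - r = A at *
  have h2 : sc (2 : ℂ) = 2 := map_ofNat _ 2
  have hI2 : sc (Complex.I / 2) = sc Complex.I * sc (1 / 2) := by
    rw [← map_mul]
    congr 1
    ring
  refine ⟨fun ψ P hP => ?_, fun ψ P hP => ?_, fun ψ P hP => ?_, fun ψ P hP => ?_⟩
  all_goals obtain ⟨hP', hDP⟩ := mem_indep_succ.1 hP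
  all_goals simp only [MonodromyData.step, symStep, hAe, LinearMap.sub_apply, LinearMap.add_apply,
    LinearMap.smul_apply, LinearMap.neg_apply, Module.End.mul_apply, Module.algebraMap_end_apply,
    map_sub, map_add, map_neg, map_smul, hd.b _ P hP', hd.f _ P hP', hd.h _ P hP', hd.c _ P hP',
    hp, he, he', Derivation.leibniz, hb, hh, hDX, hDX', hDA, hDP, D_sc, smul_apply_sym,
    smul_eq_mul, add_zero, zero_add, mul_zero]
  all_goals simp only [neg_neg, sub_neg_eq_add, ← map_sub, ← map_add, ← map_neg, smul_apply_sym, h2, hI2]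
  · refine congrArg (B ψ) ?_
    linear_combination (d.b * P * (-t - r) + d.b * P * A ^ 2) * sc_I_mul_I
  · refine congrArg (B ψ) ?_
    linear_combination (d.b * P * X * (sc (1 / 2) * A - A)) * sc_I_mul_I
      - (A * d.b * P * X) * two_mul_sc_half
  · refine congrArg (B ψ) ?_
    linear_combination (sc Complex.I * d.b * P * X) * two_mul_sc_half
  · refine congrArg (B ψ) ?_
    ring

end Sym

end BCToda

namespace BCToda

/-! ### The intertwining relation. -/

open MeasureTheory

/-- The restriction of operators to exponentially tempered functions. -/
def temperedRes (n : ℕ) : temperedOps n →ₐ[ℂ] Module.End ℂ (temperedSubmodule n) where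
  toFun a := (a : Op n).restrict fun f hf => a.2 f hf
  map_one' := rfl
  map_mul' _ _ := rfl
  map_zero' := rfl
  map_add' _ _ := rfl
  commutes' _ := rfl

/-- The operators `i∂_k` on exponentially tempered functions. -/
def temP (n k : ℕ) : temperedOps n := ⟨opP n k, opP_mem_temperedOps k⟩

/-- The multiplication operators on exponentially tempered functions. -/
def temE (n : ℕ) (ε : ℝ) (k : ℕ) : temperedOps n := ⟨opE n ε k, opE_mem_temperedOps ε k⟩

/-- All ingredients of the recursion lie in the subalgebra `temperedOps`, and the recursion commutes
with its inclusion. -/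
theorem bOp_mem_temperedOps (α β : ℝ) (n : ℕ) (w : ℂ) : bOp α β n w ∈ temperedOps n := by
  have h := congrArg MonodromyData.b (MonodromyData.map_chain (temperedOps n).val α β
    (algebraMap ℂ _ w) (temP n) (temE n 1) (temE n (-1)) n)
  have h' : bOp α β n w = _ := h.symm
  rw [h']
  exact Subtype.prop _

/-- The monodromy data acting on exponentially tempered functions. -/
def temperedChain (α β : ℝ) (n : ℕ) (w : ℂ) (k : ℕ) :
    MonodromyData (Module.End ℂ (temperedSubmodule n)) :=
  MonodromyData.chain α β (algebraMap ℂ _ w) (fun j => temperedRes n (temP n j))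
    (fun j => temperedRes n (temE n 1 j)) (fun j => temperedRes n (temE n (-1) j)) k

theorem temperedChain_b (α β : ℝ) (n : ℕ) (w : ℂ) (ψ : temperedSubmodule n) :
    (((temperedChain α β n w n).b ψ : temperedSubmodule n) : SmoothFun n) = bOp α β n w ψ := by
  have h1 := congrArg MonodromyData.b (MonodromyData.map_chain (temperedOps n).val α β
    (algebraMap ℂ _ w) (temP n) (temE n 1) (temE n (-1)) n)
  have h2 := congrArg MonodromyData.b (MonodromyData.map_chain (temperedRes n) α β
    (algebraMap ℂ _ w) (temP n) (temE n 1) (temE n (-1)) n)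
  have h1' : _ = bOp α β n w := h1
  rw [AlgHom.commutes] at h2
  have h2' : _ = (temperedChain α β n w n).b := h2
  rw [← h1', ← h2']
  rfl

namespace Sym

section

variable {α β : ℝ} {n : ℕ} {lam : ℂ} (hβ : 0 < β) (hσ : 0 < gPar α β + lam.im)

theorem gen_self_mem_indep (a b : Fin 3) (k : ℕ) (ε : ℤ) : gen (b, k) ε ∈ indep a k :=
  gen_mem_indep (i := (b, k)) (fun _ => le_rfl) ε

theorem up_mem_indep (a b : Fin 3) (k : ℕ) : up b k ∈ indep a k :=
  mul_mem (gen_self_mem_indep _ _ _ _) (gen_self_mem_indep _ _ _ _)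

theorem dn_mem_indep {a b : Fin 3} (ha : a ≠ 2) (k : ℕ) : dn b k ∈ indep a k :=
  mul_mem (gen_self_mem_indep _ _ _ _) (gen_mem_indep (fun h => absurd h.symm ha) _)

theorem opP_symMap {ψ : SmoothFun n} (hψ : ExpTempered ψ) {k : ℕ} (hk : k < n + 1) (P : Sym) :
    opP (n + 1) k (symMap hβ hσ hψ P) = symMap hβ hσ hψ
      (sc Complex.I * (D (0, k) P + P * bulkLogD n lam (0, k))) := by
  have h := pd_symMap hβ hσ hψ ⟨k, hk⟩ P
  rw [opP, dif_pos hk, LinearMap.smul_apply, h, smul_apply_sym]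
  rfl

theorem opE_symMap {ψ : SmoothFun n} (hψ : ExpTempered ψ) {k : ℕ} (hk : k < n + 1) (P : Sym) :
    opE (n + 1) 1 k (symMap hβ hσ hψ P) = symMap hβ hσ hψ (gen (0, k) 1 * P) := by
  have h := mulExp_symMap hβ hσ hψ 1 ⟨k, hk⟩ P
  rw [Int.cast_one] at h
  rw [opE, dif_pos hk, h]

theorem opE_neg_symMap {ψ : SmoothFun n} (hψ : ExpTempered ψ) {k : ℕ} (hk : k < n + 1) (P : Sym) :
    opE (n + 1) (-1) k (symMap hβ hσ hψ P) = symMap hβ hσ hψ (gen (0, k) (-1) * P) := by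
  have h := mulExp_symMap hβ hσ hψ (-1) ⟨k, hk⟩ P
  rw [Int.cast_neg, Int.cast_one] at h
  rw [opE, dif_pos hk, h]

theorem acts_chain {ψ : SmoothFun n} (hψ : ExpTempered ψ) (w : ℂ) {k : ℕ} (hk : k ≤ n) :
    Acts (symMap hβ hσ hψ) (indep 0 k)
      (MonodromyData.chain α β (algebraMap ℂ _ w) (opP (n + 1)) (opE (n + 1) 1) (opE (n + 1) (-1)) k)
      (data α β lam w 0 k) := by
  have h2 : (0 : Fin 3) ≠ 2 := by decide
  induction k with
  | zero =>
    refine ⟨fun P _ => ?_, fun P _ => ?_, fun P _ => ?_, fun P _ => ?_⟩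
    · simp [MonodromyData.chain, data]
    · simp only [MonodromyData.chain, data, Module.algebraMap_end_apply]
      simp only [smul_apply_sym, map_neg]
    · simp [MonodromyData.chain, data]
    · simp only [MonodromyData.chain, data, Module.algebraMap_end_apply]
      simp only [smul_apply_sym, map_neg, map_pow]
  | succ k ih =>
    refine (ih (by omega)).step (gen_self_mem_indep _ _ _ _)
      (gen_self_mem_indep _ _ _ _) (up_mem_indep _ _ k) (dn_mem_indep h2 k) ?_ ?_
      (fun P => ?_) (opE_symMap hβ hσ hψ (by omega)) (opE_neg_symMap hβ hσ hψ (by omega))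
    · simp [D_up_coord h2]
    · simp [D_dn_coord h2]
    · rw [opP_symMap hβ hσ hψ (by omega), bulkLogD_x (by omega)]

/-- The first n particles act by `acts_chain`; the last one is stepped separately, with r = 0, since
x_n is coupled to z_n only. -/
theorem bOp_symMap {ψ : SmoothFun n} (hψ : ExpTempered ψ) (w : ℂ) :
    bOp α β (n + 1) w (symMap hβ hσ hψ 1) = symMap hβ hσ hψ (lastB α β lam w n) := by
  have h2 : (0 : Fin 3) ≠ 2 := by decide
  have h := (acts_chain hβ hσ hψ w le_rfl).step (lam := lam) (w := w) (t := up 0 n) (r := 0)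
    (gen_self_mem_indep 0 0 n 1)
    (gen_self_mem_indep 0 0 n (-1)) (up_mem_indep _ _ n) (zero_mem _)
    (by simp [D_up_coord h2]) (by simp) (p := opP (n + 1) n)
    (fun P => by rw [opP_symMap hβ hσ hψ n.lt_succ_self, bulkLogD_x_last, sub_zero])
    (opE_symMap hβ hσ hψ n.lt_succ_self) (opE_neg_symMap hβ hσ hψ n.lt_succ_self)
  have h1 := h.b 1 (one_mem _)
  rw [mul_one] at h1
  exact h1

/-- `symMap`, as a bilinear map. -/
def symPairing : temperedSubmodule n →ₗ[ℂ] Sym →ₗ[ℂ] SmoothFun (n + 1) where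
  toFun ψ := symMap hβ hσ ψ.2
  map_add' ψ ψ' := by
    refine LinearMap.ext fun P => SmoothFun.ext fun x => ?_
    refine Eq.trans ?_ (integral_add
      (integrable_integrand_mul hβ hσ P ψ.1.contDiff.continuous ψ.2.expBounded x)
      (integrable_integrand_mul hβ hσ P ψ'.1.contDiff.continuous ψ'.2.expBounded x))
    exact integral_congr_ae (Filter.Eventually.of_forall fun q => mul_add _ _ _)
  map_smul' c ψ := by
    refine LinearMap.ext fun P => SmoothFun.ext fun x => ?_
    refine Eq.trans ?_ (integral_const_mul c _)
    exact integral_congr_ae (Filter.Eventually.of_forall fun q => mul_left_comm _ _ _)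

theorem symPairing_temP {k : ℕ} (hk : k < n) (ψ : temperedSubmodule n) (P : Sym) :
    symPairing hβ hσ (temperedRes n (temP n k) ψ) P = -symPairing hβ hσ ψ
      (sc Complex.I * (D (1, k) P + P * bulkLogD n lam (1, k))) := by
  have h := symMap_pd hβ hσ ψ.2 ⟨k, hk⟩ P
  have h1 : temperedRes n (temP n k) ψ
      = Complex.I • (⟨pd ⟨k, hk⟩ ψ.1, ExpTempered.pd ψ.2 _⟩ : temperedSubmodule n) := by
    apply Subtype.ext
    change opP n k ψ.1 = _
    rw [opP, dif_pos hk]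
    rfl
  rw [h1, map_smul, LinearMap.smul_apply, ← smul_apply_sym, ← smul_neg]
  exact congrArg _ h

theorem symPairing_temE {k : ℕ} (hk : k < n) (ψ : temperedSubmodule n) (P : Sym) :
    symPairing hβ hσ (temperedRes n (temE n 1 k) ψ) P = symPairing hβ hσ ψ (gen (1, k) 1 * P) := by
  have h := symMap_mulExp hβ hσ ψ.2 1 ⟨k, hk⟩ P
  have h1 : temperedRes n (temE n 1 k) ψ
      = (⟨mulExp (1 : ℤ) ⟨k, hk⟩ ψ.1, ExpTempered.mulExp ψ.2 _ _⟩ : temperedSubmodule n) := by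
    apply Subtype.ext
    change opE n 1 k ψ.1 = _
    rw [opE, dif_pos hk, Int.cast_one]
  rw [h1]
  exact h

theorem symPairing_temE_neg {k : ℕ} (hk : k < n) (ψ : temperedSubmodule n) (P : Sym) :
    symPairing hβ hσ (temperedRes n (temE n (-1) k) ψ) P
      = symPairing hβ hσ ψ (gen (1, k) (-1) * P) := by
  have h := symMap_mulExp hβ hσ ψ.2 (-1) ⟨k, hk⟩ P
  have h1 : temperedRes n (temE n (-1) k) ψ
      = (⟨mulExp (-1 : ℤ) ⟨k, hk⟩ ψ.1, ExpTempered.mulExp ψ.2 _ _⟩ : temperedSubmodule n) := by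
    apply Subtype.ext
    change opE n (-1) k ψ.1 = _
    rw [opE, dif_pos hk, Int.cast_neg, Int.cast_one]
  rw [h1]
  exact h

theorem actsTransposed_chain (w : ℂ) {k : ℕ} (hk : k ≤ n) :
    ActsTransposed (symPairing hβ hσ) (indep 1 k) (temperedChain α β n w k)
      (data α β lam w 1 k) := by
  have h2 : (1 : Fin 3) ≠ 2 := by decide
  induction k with
  | zero =>
    refine ⟨fun ψ P _ => ?_, fun ψ P _ => ?_, fun ψ P _ => ?_, fun ψ P _ => ?_⟩
    · simp [temperedChain, MonodromyData.chain, data]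
    · simp only [temperedChain, MonodromyData.chain, data, Module.algebraMap_end_apply]
      simp only [map_smul, LinearMap.smul_apply, smul_apply_sym, map_neg, mul_zero, add_zero]
    · simp [temperedChain, MonodromyData.chain, data]
    · simp only [temperedChain, MonodromyData.chain, data, Module.algebraMap_end_apply]
      simp only [map_smul, LinearMap.smul_apply, smul_apply_sym, map_neg, map_pow]
  | succ k ih =>
    refine (ih (by omega)).step (D_data 1 le_rfl (by simp)) ?_ ?_ ?_ ?_
      (fun ψ P => ?_) (symPairing_temE hβ hσ (by omega)) (symPairing_temE_neg hβ hσ (by omega))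
    · simp [D_gen]
    · simp [D_gen]
    · simp [D_up_coord h2]
    · simp [D_dn_coord h2]
    · rw [symPairing_temP hβ hσ (by omega), bulkLogD_y (by omega)]

theorem symMap_bOp {ψ : SmoothFun n} (hψ : ExpTempered ψ) (w : ℂ) :
    symMap hβ hσ (bOp_mem_temperedOps α β n w ψ hψ) 1
      = symMap hβ hσ hψ (data α β lam w 1 n).b := by
  have h := (actsTransposed_chain hβ hσ w le_rfl).b ⟨ψ, hψ⟩ 1 (one_mem _)
  rw [mul_one] at h
  refine Eq.trans ?_ h
  have h1 : (temperedChain α β n w n).b ⟨ψ, hψ⟩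
      = ⟨bOp α β n w ψ, bOp_mem_temperedOps α β n w ψ hψ⟩ :=
    Subtype.ext (temperedChain_b α β n w ⟨ψ, hψ⟩)
  rw [h1]
  rfl

/-- Both sides are read as symbols, which `apply_lastB` compares; its hypotheses are the two
integrations by parts in z. -/
theorem bOp_symMap_one {ψ : SmoothFun n} (hψ : ExpTempered ψ) (w : ℂ) :
    bOp α β (n + 1) w (symMap hβ hσ hψ 1)
      = (lam ^ 2 - w) • symMap hβ hσ (bOp_mem_temperedOps α β n w ψ hψ) 1 := by
  rw [bOp_symMap, symMap_bOp, apply_lastB _ (fun j hj => symMap_zTotal hβ hσ hψ hj)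
    (symMap_zTotal_last hβ hσ hψ)]

end

end Sym

end BCToda

namespace BCToda

open MeasureTheory BCToda.Sym

/-! ### Raised functions, Ψ, and its eigenvalues. -/

section raising

variable {α β : ℝ} {n : ℕ} {lam : ℂ} (hβ : 0 < β) (hσ : 0 < gPar α β + lam.im)
  {ψ : SmoothFun n} (hψ : ExpTempered ψ)
include hβ hσ hψ

theorem raisingConverges (x : Fin (n + 1) → ℝ) : RaisingConverges α β lam ψ.1 x := by
  refine (integrable_integrand_mul hβ hσ 1 ψ.contDiff.continuous hψ.expBounded x).congr
    (Filter.Eventually.of_forall fun q => ?_)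
  simp only [integrand, map_one, one_mul, kernelIntegrand_eq]

theorem raising_eq :
    raising α β lam ψ.1 = (prefactor α β lam • symMap hβ hσ hψ 1 : SmoothFun (n + 1)).1 := by
  funext x
  change _ = prefactor α β lam * ∫ q, _
  rw [raising, Measure.volume_eq_prod, integral_prod _
    (integrable_integrand_mul hβ hσ 1 ψ.contDiff.continuous hψ.expBounded x)]
  simp only [integrand, map_one, one_mul, kernelIntegrand_eq]

theorem bOp_raised (w : ℂ) : bOp α β (n + 1) w (prefactor α β lam • symMap hβ hσ hψ 1)
    = (lam ^ 2 - w) • prefactor α β lam •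
      symMap hβ hσ (bOp_mem_temperedOps α β n w ψ hψ) 1 := by
  rw [map_smul, bOp_symMap_one, smul_comm]

theorem symMap_smul (c : ℂ) (P : Sym) :
    symMap hβ hσ ((temperedSubmodule n).smul_mem c hψ) P = c • symMap hβ hσ hψ P :=
  congrArg (fun T : Sym →ₗ[ℂ] SmoothFun (n + 1) => T P)
    ((symPairing hβ hσ).map_smul c ⟨ψ, hψ⟩)

theorem BOp_raised (u : ℂ) : (BOp α β (n + 1) u (prefactor α β lam • symMap hβ hσ hψ 1)).1
    = (lam ^ 2 - u ^ 2) • raising α β lam (BOp α β n u ψ).1 := by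
  have h : BOp α β n u ψ = (u - Complex.I / 2) • bOp α β n (u ^ 2) ψ := by
    rw [BOp_eq]
    rfl
  have ht := bOp_mem_temperedOps α β n (u ^ 2) ψ hψ
  rw [h, raising_eq hβ hσ ((temperedSubmodule n).smul_mem _ ht), symMap_smul hβ hσ ht, BOp_eq,
    LinearMap.smul_apply, bOp_raised hβ hσ hψ]
  change (_ : SmoothFun (n + 1)).1 = ((lam ^ 2 - u ^ 2) • _ : SmoothFun (n + 1)).1
  congr 1
  simp only [smul_smul]
  congr 1
  ring

end raising

/-- Temperedness is carried along because it is the hypothesis of the next raising step; each step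
multiplies the eigenvalue by λ² - w. -/
theorem exists_smooth_Psi {α β : ℝ} (hβ : 0 < β) (n : ℕ) (lam : Fin n → ℂ)
    (h : ∀ j, 0 < gPar α β + (lam j).im) : ∃ F : SmoothFun n, F.1 = Psi α β n lam ∧ ExpTempered F ∧
      ∀ w, bOp α β n w F = (∏ j, (lam j ^ 2 - w)) • F := by
  induction n with
  | zero =>
    obtain ⟨F, hF⟩ : ∃ F : SmoothFun 0, F.1 = fun _ => 1 :=
      ⟨⟨_, show ContDiff ℝ ∞ _ from contDiff_const⟩, rfl⟩
    refine ⟨F, hF, fun l => ?_, fun w => ?_⟩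
    · match l with
      | [] => exact ⟨1, 0, zero_le_one, le_rfl, fun x => by
          change ‖F.1 x‖ ≤ _
          rw [hF]
          simp⟩
      | i :: _ => exact i.elim0
    · rw [Finset.univ_eq_empty, Finset.prod_empty, one_smul]
      rfl
  | succ n ih =>
    obtain ⟨F, hF, ht, hw⟩ := ih (fun j => lam j.castSucc) fun j => h _
    have hσ := h (Fin.last n)
    refine ⟨prefactor α β (lam (Fin.last n)) • symMap hβ hσ ht 1, ?_,
      (temperedSubmodule (n + 1)).smul_mem _ (expTempered_symMap hβ hσ ht 1), fun w => ?_⟩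
    · rw [Psi, ← hF, raising_eq hβ hσ ht]
    · rw [bOp_raised]
      have h1 : symMap hβ hσ (bOp_mem_temperedOps α β n w F ht) 1
          = (∏ j : Fin n, (lam j.castSucc ^ 2 - w)) • symMap hβ hσ ht 1 := by
        rw [← symMap_smul hβ hσ ht]
        congr 2
        exact hw w
      rw [h1, Fin.prod_univ_castSucc, smul_smul, smul_smul, smul_smul]
      congr 1
      ring

/-- Any linear functional turns the eigenvalue equation into an equality of scalar polynomials in w,
valid for all w; functionals separate vectors, so the coefficients agree. -/
theorem coeff_bPoly_apply {α β : ℝ} {n : ℕ} {F : SmoothFun n} {q : ℂ[X]}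
    (h : ∀ w, bOp α β n w F = q.eval w • F) (i : ℕ) :
    (bPoly α β n).coeff i F = q.coeff i • F := by
  rw [← sub_eq_zero, ← Module.forall_dual_apply_eq_zero_iff ℂ]
  intro φ
  let r : ℂ[X] := ∑ j ∈ Finset.range ((bPoly α β n).natDegree + 1),
    Polynomial.C (φ ((bPoly α β n).coeff j F)) * Polynomial.X ^ j
  have hr : r = Polynomial.C (φ F) * q := by
    refine Polynomial.funext fun w => ?_
    have h' := congrArg φ (h w)
    rw [← evalScalar_bPoly, evalScalar_apply, Polynomial.eval_eq_sum_range, LinearMap.sum_apply,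
      map_sum, map_smul, smul_eq_mul] at h'
    rw [Polynomial.eval_mul, Polynomial.eval_C, mul_comm, ← h', Polynomial.eval_finsetSum]
    refine Finset.sum_congr rfl fun j _ => ?_
    rw [← map_pow, ← Algebra.commutes, ← Algebra.smul_def, LinearMap.smul_apply, map_smul]
    rw [Polynomial.eval_mul, Polynomial.eval_C, Polynomial.eval_pow, Polynomial.eval_X, smul_eq_mul,
      mul_comm]
  have hc := congrArg (fun s => Polynomial.coeff s i) hr
  simp only [r, Polynomial.finsetSum_coeff, Polynomial.coeff_C_mul_X_pow] at hc
  rw [Polynomial.coeff_C_mul, Finset.sum_ite_eq] at hc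
  rw [map_sub, map_smul, smul_eq_mul, mul_comm, ← hc]
  split_ifs with hi
  · rw [sub_self]
  · rw [Polynomial.coeff_eq_zero_of_natDegree_lt (by simpa using hi), LinearMap.zero_apply, map_zero,
      sub_zero]

/-- Vieta's formula after extracting (-1)^n; this sign cancels the one in `hamiltonian_eq`. -/
theorem coeff_prod_C_sub_X {n s : ℕ} (hs : s ≤ n) (a : Fin n → ℂ) :
    (∏ j, (Polynomial.C (a j) - Polynomial.X)).coeff (n - s)
      = (-1) ^ n * ((-1) ^ s * ∑ t ∈ Finset.powersetCard s (Finset.univ : Finset (Fin n)),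
          ∏ j ∈ t, a j) := by
  have h1 : ∏ j, (Polynomial.C (a j) - Polynomial.X)
      = Polynomial.C ((-1) ^ n) * ∏ j, (Polynomial.X + Polynomial.C (-a j)) := by
    have h2 (j : Fin n) : Polynomial.C (a j) - Polynomial.X
        = -1 * (Polynomial.X + Polynomial.C (-a j)) := by
      rw [map_neg]
      ring
    simp only [h2]
    rw [Finset.prod_mul_distrib, Finset.prod_const, Finset.card_univ, Fintype.card_fin]
    simp
  rw [h1, Polynomial.coeff_C_mul, Finset.prod_X_add_C_coeff _ _ (by simp), Finset.card_univ,
    Fintype.card_fin, Nat.sub_sub_self hs]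
  congr 1
  rw [Finset.mul_sum]
  refine Finset.sum_congr rfl fun t ht => ?_
  rw [Finset.prod_neg, (Finset.mem_powersetCard.1 ht).2]

theorem hamiltonian_apply {α β : ℝ} {n : ℕ} {F : SmoothFun n} {lam : Fin n → ℂ}
    (h : ∀ w, bOp α β n w F = (∏ j, (lam j ^ 2 - w)) • F) {s : ℕ} (hs : s ≤ n) :
    hamiltonian α β n s F = ((-1) ^ s * ∑ t ∈ Finset.powersetCard s (Finset.univ : Finset (Fin n)),
      ∏ j ∈ t, lam j ^ 2) • F := by
  have h1 : ∀ w, bOp α β n w F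
      = (∏ j, (Polynomial.C (lam j ^ 2) - Polynomial.X)).eval w • F := fun w => by
    rw [h, Polynomial.eval_prod]
    simp only [Polynomial.eval_sub, Polynomial.eval_C, Polynomial.eval_X]
  have h2 := coeff_bPoly_apply h1 (n - s)
  rw [coeff_prod_C_sub_X hs] at h2
  have h3 : ((-1) ^ n : Op n) = algebraMap ℂ (Op n) ((-1) ^ n) := by simp
  rw [hamiltonian_eq, Module.End.mul_apply, h2, h3, Module.algebraMap_end_apply, smul_smul,
    ← mul_assoc, neg_one_pow_mul_self, one_mul]

theorem Psi_one (α β : ℝ) (lam : Fin 1 → ℂ) (x : Fin 1 → ℝ) :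
    Psi α β 1 lam x = prefactor α β (lam 0) * ∫ z in Set.Ioi (Real.log β),
      Complex.exp (Complex.I * lam 0 * ((x 0 - 2 * z : ℝ) : ℂ) - (Real.exp (z - x 0) : ℂ))
        * ((1 + β * Real.exp (-z) : ℝ) : ℂ) ^ (-Complex.I * lam 0 - (gPar α β : ℂ))
        * ((1 - β * Real.exp (-z) : ℝ) : ℂ) ^ (-Complex.I * lam 0 + (gPar α β : ℂ) - 1) := by
  set G : ℝ → ℂ := fun z =>
    Complex.exp (Complex.I * lam 0 * ((x 0 - 2 * z : ℝ) : ℂ) - (Real.exp (z - x 0) : ℂ))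
        * ((1 + β * Real.exp (-z) : ℝ) : ℂ) ^ (-Complex.I * lam 0 - (gPar α β : ℂ))
        * ((1 - β * Real.exp (-z) : ℝ) : ℂ) ^ (-Complex.I * lam 0 + (gPar α β : ℂ) - 1) with hG
  have h1 (y : Fin 0 → ℝ) (z : Fin 1 → ℝ) : kernelIntegrand α β (lam 0) x z y * 1
      = (Set.Ici (Real.log β)).indicator G (z 0) := by
    rw [kernelIntegrand]
    by_cases hz : Real.log β ≤ z 0
    · rw [Set.indicator_of_mem (Set.mem_Ici.2 hz), heaviside, if_pos (by linarith)]
      simp [hG]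
    · rw [Set.indicator_of_notMem (by simpa using hz), heaviside, if_neg (by linarith)]
      simp
  change prefactor α β (lam 0) * ∫ y : Fin 0 → ℝ, ∫ z : Fin 1 → ℝ,
    kernelIntegrand α β (lam 0) x z y * 1 = _
  simp only [h1]
  -- The Heaviside function equals 1 at ln β, so the support is the closed half-line; the endpoint
  -- is a null set.
  rw [← integral_Ici_eq_integral_Ioi, ← integral_indicator measurableSet_Ici]
  have h2 := (volume_preserving_funUnique (Fin 1) ℝ).integral_comp'
    ((Set.Ici (Real.log β)).indicator G)
  have h3 : ∫ z : Fin 1 → ℝ, (Set.Ici (Real.log β)).indicator G (z 0)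
      = ∫ t, (Set.Ici (Real.log β)).indicator G t := h2
  -- The y-integral runs over a point, where the volume is a Dirac measure.
  rw [h3, Measure.volume_pi_eq_dirac, integral_dirac]

end BCToda

end

theorem mainTheorem1 (α β : ℝ) (hβ : 0 < β) (hg : 0 < 1 / 2 + α / β) :
    -- the operators `ℍ_s` are the coefficients of `𝔹_n(u)`, and they commute
    (∀ n : ℕ,
      BCToda.BPoly α β n
        = (-1) ^ n * (Polynomial.X - BCToda.scal n (Complex.I / 2))
          * (Polynomial.X ^ (2 * n) + ∑ s ∈ Finset.Icc 1 n,
              Polynomial.C (BCToda.hamiltonian α β n s) * Polynomial.X ^ (2 * (n - s)))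
      ∧ ∀ r ∈ Finset.Icc 1 n, ∀ s ∈ Finset.Icc 1 n,
          Commute (BCToda.hamiltonian α β n r) (BCToda.hamiltonian α β n s))
    -- the one-particle function
    ∧ (∀ (lam : Fin 1 → ℂ) (x : Fin 1 → ℝ), -(1 / 2 + α / β) < (lam 0).im →
        BCToda.Psi α β 1 lam x
          = ((2 * β : ℝ) : ℂ) ^ (Complex.I * lam 0)
              / Complex.Gamma (((1 / 2 + α / β : ℝ) : ℂ) - Complex.I * lam 0)
            * ∫ z in Set.Ioi (Real.log β),
                Complex.exp (Complex.I * lam 0 * ((x 0 - 2 * z : ℝ) : ℂ)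
                    - (Real.exp (z - x 0) : ℂ))
                * ((1 + β * Real.exp (-z) : ℝ) : ℂ)
                    ^ (-Complex.I * lam 0 - ((1 / 2 + α / β : ℝ) : ℂ))
                * ((1 - β * Real.exp (-z) : ℝ) : ℂ)
                    ^ (-Complex.I * lam 0 + ((1 / 2 + α / β : ℝ) : ℂ) - 1))
    -- the recursion: all its integrals converge absolutely
    ∧ (∀ (n : ℕ) (lam : Fin (n + 1) → ℂ), (∀ j, -(1 / 2 + α / β) < (lam j).im) →
        ∀ x : Fin (n + 1) → ℝ,
          BCToda.RaisingConverges α β (lam (Fin.last n))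
              (BCToda.Psi α β n fun j => lam j.castSucc) x
          ∧ BCToda.Psi α β (n + 1) lam x
              = BCToda.raising α β (lam (Fin.last n))
                  (BCToda.Psi α β n fun j => lam j.castSucc) x)
    -- `Ψ` is smooth and is a joint eigenfunction of `ℍ_1, …, ℍ_n`
    ∧ (∀ (n : ℕ) (lam : Fin n → ℂ), (∀ j, -(1 / 2 + α / β) < (lam j).im) →
        ∃ F : BCToda.SmoothFun n, F.1 = BCToda.Psi α β n lam ∧
          ∀ s ∈ Finset.Icc 1 n,
            BCToda.hamiltonian α β n s F
              = ((-1) ^ s * ∑ t ∈ Finset.powersetCard s (Finset.univ : Finset (Fin n)),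
                  ∏ j ∈ t, lam j ^ 2) • F)
    -- the intertwining relation on exponentially tempered smooth functions
    ∧ (∀ (n : ℕ) (lam : ℂ), -(1 / 2 + α / β) < lam.im →
        ∀ φ : BCToda.SmoothFun n, BCToda.ExpTempered φ →
          (∀ x, BCToda.RaisingConverges α β lam φ.1 x)
          ∧ ∃ F : BCToda.SmoothFun (n + 1), F.1 = BCToda.raising α β lam φ.1 ∧
              ∀ u : ℂ, (BCToda.BOp α β (n + 1) u F).1
                = (lam ^ 2 - u ^ 2) • BCToda.raising α β lam (BCToda.BOp α β n u φ).1) := by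
  have hgp {lam : ℂ} (h : -(1 / 2 + α / β) < lam.im) : 0 < BCToda.gPar α β + lam.im := by
    rw [BCToda.gPar]
    linarith
  refine ⟨fun n => ⟨BCToda.BPoly_expansion α β n, fun r _ s _ =>
    BCToda.commute_hamiltonian α β n r s⟩, fun lam x _ => BCToda.Psi_one α β lam x,
    fun n lam h x => ⟨?_, rfl⟩, fun n lam h => ?_, fun n lam h φ hφ => ?_⟩
  · obtain ⟨F, hF, ht, -⟩ := BCToda.exists_smooth_Psi hβ n (fun j => lam j.castSucc)
      fun j => hgp (h _)
    rw [← hF]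
    exact BCToda.raisingConverges hβ (hgp (h _)) ht x
  · obtain ⟨F, hF, -, hw⟩ := BCToda.exists_smooth_Psi hβ n lam fun j => hgp (h j)
    exact ⟨F, hF, fun s hs => BCToda.hamiltonian_apply hw (Finset.mem_Icc.1 hs).2⟩
  · exact ⟨BCToda.raisingConverges hβ (hgp h) hφ, _, (BCToda.raising_eq hβ (hgp h) hφ).symm,
      BCToda.BOp_raised hβ (hgp h) hφ⟩
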